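/- **Theorem.** Let $s\ge 1$ and $r\ge 0$ be integers, let $\sigma$ be a finite signature (of function and relation symbols), and let $\mathcal P$ be a $\sigma$-problem, i.e. a set of $\sigma$-structures with domain $[n]=\{0,\dots,n-1\}$, $n\ge 1$. Then $\mathcal P\in \mathrm{NTISP}^\sigma(n^{s+r},n^s)$ if and only if there is a formula $\phi\in\mathrm{ESO}^\sigma(s,r)$ such that for every $\sigma$-structure $\langle [n],\sigma\rangle$ $$\langle [n],\sigma\rangle\in\mathcal P \iff \langle [n],\sigma,succ,0\rangle\models\phi .$$ *The machines.* A nondeterministic RAM (NRAM) for $\sigma$ has read-only input registers: $L$, containing $n$, and for each $k$-ary symbol $Q$ of $\sigma$ and $a\in[n]^k$ a register $Q[a]$ containing the value (for relations: the truth value $0$ or $1$) of $Q$ at $a$. It has computation registers, which contain natural numbers, initially $0$: accumulators $A,B_1,\dots,B_d$, where $d$ is the largest arity of a symbol of $\sigma$, but at least $1$, and the main memory $R_0,R_1,\dots$. A program is a finite sequence of the instructions $A:=L$; $A:=0$; $A:=A+1$; $A:=A-1$ (with $0-1=0$); $guess(A)$ (store any natural number in $A$); $A:=Q(B_1,\dots,B_k)$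 for a $k$-ary symbol $Q$ of $\sigma$ (giving $0$ if some $B_i\ge n$); $A:=R(A)$; $B_i:=A$; $R(A):=B_i$; if $A=B_i$ then goto $i_0$ else goto $i_1$; $accept$; $reject$; where $accept$ is the last instruction and occurs nowhere else. A problem $\mathcal P$ is in $\mathrm{NTISP}^\sigma(T(n),S(n))$ if there are an NRAM and a constant $c$ such that the structures for which the NRAM has an accepting computation are exactly those in $\mathcal P$, and each structure in $\mathcal P$, of domain $[n]$, has an accepting computation that performs at most $c\,T(n)$ instructions, accesses only main memory addresses at most $c\,S(n)$, and in which all computation registers always contain numbers at most $c\max\{n,S(n)\}$. *The formulas.* On $[n]$, $succ(a)=a+1$ for $a<n-1$ and $succ(n-1)=n-1$; on $[n]^\delta$, $succ^{(\delta)}$ is the successor for the lexicographic order, the last tuple $(n-1,\dots,n-1)$ being mapped to itself. $\mathrm{ESO}^\sigma(s,r)$ is the class of the formulas $$\exists \bar g\ \forall x_1\dots\forall x_s\ \forall y_1\dots\forall y_r\ \psi(\bar x,\bar y)$$ where $\bar g$ is a finite set of function and relation symbols of arity at most $s+r$, and $\psi$ is a quantifier-free formula of signature $\sigma\cup\{0,succ\}\cup\bar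 g$ in which each occurrence of a symbol of $\bar g$ of arity $s+\delta$, $\delta\ge1$, has arbitrary terms as its first $s$ arguments, while its last $\delta$ arguments form the vector $(y_1,\dots,y_\delta)$ or the vector $succ^{(\delta)}(y_1,\dots,y_\delta)$. The arguments of the other symbols are arbitrary terms. -/

import Mathlib

universe u v

namespace TimeSpace


/-! ### Finite structures and problems -/

/-- A structure `⟨[n], σ⟩` whose domain is `[n] = {0, …, n-1}`, `n ≥ 1`. -/
structure FinStr (σ : FirstOrder.Language.{u, v}) where
  card : ℕ
  pos : 0 < card
  str : σ.Structure (Fin card)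

/-- A `σ`-problem is a set of finite `σ`-structures. -/
abbrev Problem (σ : FirstOrder.Language.{u, v}) := Set (FinStr σ)

/-! ### Nondeterministic random access machines -/

/-- The arity of a (function or relation) symbol. -/
noncomputable def symArity (σ : FirstOrder.Language.{u, v}) : σ.Symbols → ℕ
  | Sum.inl f => f.1
  | Sum.inr R => R.1

/-- The number of accumulators `B₁, …, B_d`: the largest arity of a symbol of `σ`, but at least one
(without any `B` a machine could neither branch nor write into its memory). -/
noncomputable def numAcc (σ : FirstOrder.Language.{u, v}) : ℕ :=
  max 1 (⨆ q : σ.Symbols, symArity σ q)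

theorem symArity_le_numAcc (σ : FirstOrder.Language.{u, v}) [Finite σ.Symbols] (q : σ.Symbols) :
    symArity σ q ≤ numAcc σ :=
  le_max_of_le_right (le_ciSup (Set.finite_range (symArity σ)).bddAbove q)

theorem fun_le_numAcc {σ : FirstOrder.Language.{u, v}} [Finite σ.Symbols] {k : ℕ} (f : σ.Functions k) :
    k ≤ numAcc σ :=
  symArity_le_numAcc σ (Sum.inl ⟨k, f⟩)

theorem rel_le_numAcc {σ : FirstOrder.Language.{u, v}} [Finite σ.Symbols] {k : ℕ} (Q : σ.Relations k) :
    k ≤ numAcc σ :=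
  symArity_le_numAcc σ (Sum.inr ⟨k, Q⟩)

/-- The instructions of a program with lines `0, …, len`. -/
inductive Instr (σ : FirstOrder.Language.{u, v}) (len : ℕ) : Type (max u v)
  /-- `A := L`, where `L` contains the size `n` of the input -/
  | getSize
  /-- `A := 0` -/
  | setZero
  /-- `A := A + 1` -/
  | incr
  /-- `A := A - 1` -/
  | decr
  /-- `guess(A)` -/
  | guess
  /-- `A := f(B₁, …, B_k)` for a function symbol `f` of the input -/
  | getFun {k : ℕ} (f : σ.Functions k)
  /-- `A := Q(B₁, …, B_k)` for a relation symbol `Q` of the input -/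
  | getRel {k : ℕ} (Q : σ.Relations k)
  /-- `A := R(A)` -/
  | load
  /-- `B_b := A` -/
  | copy (b : Fin (numAcc σ))
  /-- `R(A) := B_b` -/
  | store (b : Fin (numAcc σ))
  /-- `if A = B_b then goto i₀ else goto i₁` -/
  | branch (b : Fin (numAcc σ)) (i₀ i₁ : Fin (len + 1))
  | accept
  | reject

/-- A nondeterministic RAM: a nonempty program in which `accept` is the last instruction and
occurs nowhere else. -/
structure NRAM (σ : FirstOrder.Language.{u, v}) where
  len : ℕ
  prog : Fin (len + 1) → Instr σ len
  accept_iff : ∀ i, prog i = Instr.accept ↔ i = Fin.last len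

/-- The contents of the read/write registers: the accumulators `A`, `B₁, …, B_d` and the main
memory `R₀, R₁, …`. -/
@[ext]
structure Regs (d : ℕ) where
  A : ℕ
  B : Fin d → ℕ
  R : ℕ → ℕ

/-- All registers contain `0`. -/
noncomputable def Regs.init (d : ℕ) : Regs d := ⟨0, fun _ => 0, fun _ => 0⟩

/-- The content of the input register `f[a]`; it is `0` if `a` is not a tuple over `[n]`. -/
noncomputable def FinStr.readFun {σ : FirstOrder.Language.{u, v}} (S : FinStr σ) {k : ℕ} (f : σ.Functions k)
    (a : Fin k → ℕ) : ℕ :=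
  if h : ∀ i, a i < S.card then (S.str.funMap f (fun i => ⟨a i, h i⟩)).val else 0

open Classical in
/-- The content of the input register `Q[a]`: the truth value, as `1` or `0`, of `Q` at `a`; it is
`0` if `a` is not a tuple over `[n]`. -/
noncomputable def FinStr.readRel {σ : FirstOrder.Language.{u, v}} (S : FinStr σ) {k : ℕ} (Q : σ.Relations k)
    (a : Fin k → ℕ) : ℕ :=
  if ∃ h : ∀ i, a i < S.card, S.str.RelMap Q (fun i => ⟨a i, h i⟩) then 1 else 0

/-- `I.Effect S m m'`: executing `I` on the input `S` may change the register contents from `m` to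
`m'`. The instructions `accept` and `reject` stop the machine. -/
noncomputable def Instr.Effect {σ : FirstOrder.Language.{u, v}} [Finite σ.Symbols] {len : ℕ} (I : Instr σ len)
    (S : FinStr σ) (m m' : Regs (numAcc σ)) : Prop :=
  match I with
  | .getSize => m' = { m with A := S.card }
  | .setZero => m' = { m with A := 0 }
  | .incr => m' = { m with A := m.A + 1 }
  | .decr => m' = { m with A := m.A - 1 }
  | .guess => ∃ a : ℕ, m' = { m with A := a }
  | .getFun f => m' = { m with A := S.readFun f (fun i => m.B (Fin.castLE (fun_le_numAcc f) i)) }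
  | .getRel Q => m' = { m with A := S.readRel Q (fun i => m.B (Fin.castLE (rel_le_numAcc Q) i)) }
  | .load => m' = { m with A := m.R m.A }
  | .copy b => m' = { m with B := Function.update m.B b m.A }
  | .store b => m' = { m with R := Function.update m.R m.A (m.B b) }
  | .branch _ _ _ => m' = m
  | .accept => False
  | .reject => False

/-- `I.Next i m j`: after executing `I`, standing in line `i`, on register contents `m`, the program
continues in line `j`. -/
noncomputable def Instr.Next {σ : FirstOrder.Language.{u, v}} {len : ℕ} (I : Instr σ len)
    (i : Fin (len + 1)) (m : Regs (numAcc σ)) (j : Fin (len + 1)) : Prop :=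
  match I with
  | .branch b i₀ i₁ => j = if m.A = m.B b then i₀ else i₁
  | _ => j.val = i.val + 1

/-- The instruction accesses the main memory (at the address contained in `A`). -/
noncomputable def Instr.AccessesMemory {σ : FirstOrder.Language.{u, v}} {len : ℕ} (I : Instr σ len) : Prop :=
  match I with
  | .load => True
  | .store _ => True
  | _ => False

/-- A configuration: the current line of the program and the register contents. -/
structure Config {σ : FirstOrder.Language.{u, v}} (M : NRAM σ) where
  pc : Fin (M.len + 1)
  regs : Regs (numAcc σ)

noncomputable def Config.start {σ : FirstOrder.Language.{u, v}} (M : NRAM σ) : Config M := ⟨0, Regs.init _⟩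

/-- One step of the computation of `M` on the input `S`. -/
noncomputable def NRAM.Step {σ : FirstOrder.Language.{u, v}} [Finite σ.Symbols] (M : NRAM σ) (S : FinStr σ)
    (C C' : Config M) : Prop :=
  (M.prog C.pc).Effect S C.regs C'.regs ∧ (M.prog C.pc).Next C.pc C.regs C'.pc

/-- `C 0, …, C t` is an accepting computation of `M` on the input `S`; it performs `t + 1`
instructions, the last of which is `accept`. -/
noncomputable def NRAM.AcceptingRun {σ : FirstOrder.Language.{u, v}} [Finite σ.Symbols] (M : NRAM σ) (S : FinStr σ)
    (t : ℕ) (C : ℕ → Config M) : Prop :=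
  C 0 = Config.start M ∧ (∀ i < t, M.Step S (C i) (C (i + 1))) ∧
    M.prog (C t).pc = Instr.accept

/-- Every memory access in the computation `C 0, …, C t` is to an address at most `a`, and all
computation registers always contain numbers at most `b`. -/
noncomputable def NRAM.SpaceBounded {σ : FirstOrder.Language.{u, v}} (M : NRAM σ) (t : ℕ) (C : ℕ → Config M)
    (a b : ℕ) : Prop :=
  (∀ i ≤ t, (M.prog (C i).pc).AccessesMemory → (C i).regs.A ≤ a) ∧
  (∀ i ≤ t, (C i).regs.A ≤ b ∧ (∀ j, (C i).regs.B j ≤ b) ∧ ∀ x, (C i).regs.R x ≤ b)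

/-- The class of the `σ`-problems recognized by a nondeterministic RAM in time `O(T(n))` and space
`O(S(n))`: the machine accepts exactly the members of the problem, and every member has an
accepting computation of `O(T(n))` instructions that accesses only addresses `O(S(n))` and uses only
numbers `O(max (n, S(n)))`. -/
noncomputable def NTISP (σ : FirstOrder.Language.{u, v}) [Finite σ.Symbols] (T S : ℕ → ℕ) : Set (Problem σ) :=
  {P | ∃ (M : NRAM σ) (c : ℕ), ∀ X : FinStr σ,
    (X ∈ P ↔ ∃ t C, M.AcceptingRun X t C) ∧
    (X ∈ P → ∃ t C, M.AcceptingRun X t C ∧ t + 1 ≤ c * T X.card ∧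
      M.SpaceBounded t C (c * S X.card) (c * max X.card (S X.card)))}

/-! ### The logic -/

/-- The non-cyclic successor on `[n]`. -/
noncomputable def succFin {n : ℕ} (a : Fin n) : Fin n :=
  if h : a.val + 1 < n then ⟨a.val + 1, h⟩ else a

/-- The non-cyclic lexicographical successor on `[n]^δ`, most significant component first. The last
tuple is fixed; in any other tuple the components after the last one that is different from `n - 1`
become `0`, that one is incremented, and those before it are unchanged. -/
noncomputable def lexSucc {n δ : ℕ} (y : Fin δ → Fin n) : Fin δ → Fin n := fun i =>
  if ∀ j, (y j).val = n - 1 then y i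
  else if ∀ j, i < j → (y j).val = n - 1 then
    if (y i).val = n - 1 then ⟨0, (y i).pos⟩ else succFin (y i)
  else y i

/-- The terms that may occur in an `(s,r)`-restricted formula with input signature `σ` and guessed
symbols `G`: a guessed symbol of arity at most `s` takes any arguments; one of arity `s + δ`,
`1 ≤ δ ≤ r`, takes any first `s` arguments, followed by the vector `(y₁, …, y_δ)` (if `next` is
`false`) or `succ(y₁, …, y_δ)` (if `next` is `true`). -/
inductive RTerm (σ : FirstOrder.Language.{u, v}) (G : FirstOrder.Language.{0, 0}) (s r : ℕ) : Type u
  | x (i : Fin s)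
  | y (j : Fin r)
  | zero
  | succ (t : RTerm σ G s r)
  | input {k : ℕ} (f : σ.Functions k) (a : Fin k → RTerm σ G s r)
  | guessLow {k : ℕ} (hk : k ≤ s) (g : G.Functions k) (a : Fin k → RTerm σ G s r)
  | guessHigh {δ : ℕ} (hδ : 1 ≤ δ) (hr : δ ≤ r) (g : G.Functions (s + δ))
      (a : Fin s → RTerm σ G s r) (next : Bool)

/-- The `(s,r)`-restricted quantifier-free formulas. -/
inductive RFormula (σ : FirstOrder.Language.{u, v}) (G : FirstOrder.Language.{0, 0}) (s r : ℕ) : Type (max u v)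
  | eq (t₁ t₂ : RTerm σ G s r)
  | input {k : ℕ} (Q : σ.Relations k) (a : Fin k → RTerm σ G s r)
  | guessLow {k : ℕ} (hk : k ≤ s) (g : G.Relations k) (a : Fin k → RTerm σ G s r)
  | guessHigh {δ : ℕ} (hδ : 1 ≤ δ) (hr : δ ≤ r) (g : G.Relations (s + δ))
      (a : Fin s → RTerm σ G s r) (next : Bool)
  | not (φ : RFormula σ G s r)
  | and (φ ψ : RFormula σ G s r)
  | or (φ ψ : RFormula σ G s r)

/-- The value of the vector `(y₁, …, y_δ)` or `succ(y₁, …, y_δ)`. -/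
noncomputable def iterVec {n r δ : ℕ} (hr : δ ≤ r) (y : Fin r → Fin n) (next : Bool) : Fin δ → Fin n :=
  if next then lexSucc (fun j => y (Fin.castLE hr j)) else fun j => y (Fin.castLE hr j)

/-- The value of a term in `⟨[n], σ, succ, 0⟩` expanded by an interpretation of the guessed
symbols. -/
noncomputable def RTerm.val {σ : FirstOrder.Language.{u, v}} {G : FirstOrder.Language.{0, 0}} {s r : ℕ} (X : FinStr σ)
    (I : G.Structure (Fin X.card)) (x : Fin s → Fin X.card) (y : Fin r → Fin X.card) :
    RTerm σ G s r → Fin X.card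
  | .x i => x i
  | .y j => y j
  | .zero => ⟨0, X.pos⟩
  | .succ t => succFin (t.val X I x y)
  | .input f a => X.str.funMap f (fun i => (a i).val X I x y)
  | .guessLow _ g a => I.funMap g (fun i => (a i).val X I x y)
  | .guessHigh _ hr g a next =>
      I.funMap g (Fin.append (fun i => (a i).val X I x y) (iterVec hr y next))

/-- Truth of a formula in `⟨[n], σ, succ, 0⟩` expanded by an interpretation of the guessed
symbols. -/
noncomputable def RFormula.Holds {σ : FirstOrder.Language.{u, v}} {G : FirstOrder.Language.{0, 0}} {s r : ℕ} (X : FinStr σ)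
    (I : G.Structure (Fin X.card)) (x : Fin s → Fin X.card) (y : Fin r → Fin X.card) :
    RFormula σ G s r → Prop
  | .eq t₁ t₂ => t₁.val X I x y = t₂.val X I x y
  | .input Q a => X.str.RelMap Q (fun i => (a i).val X I x y)
  | .guessLow _ g a => I.RelMap g (fun i => (a i).val X I x y)
  | .guessHigh _ hr g a next =>
      I.RelMap g (Fin.append (fun i => (a i).val X I x y) (iterVec hr y next))
  | .not φ => ¬ φ.Holds X I x y
  | .and φ ψ => φ.Holds X I x y ∧ ψ.Holds X I x y
  | .or φ ψ => φ.Holds X I x y ∨ ψ.Holds X I x y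

/-- The formulas `∃ g ∀ x₁ … ∀ x_s ∀ y₁ … ∀ y_r ψ` of the logic `ESO(s,r)` with input signature
`σ`: `g` is a finite set of function and relation symbols of arity at most `s + r` and `ψ` is an
`(s,r)`-restricted quantifier-free formula. -/
structure ESO (σ : FirstOrder.Language.{u, v}) (s r : ℕ) where
  guessed : FirstOrder.Language.{0, 0}
  finite : Finite guessed.Symbols
  arity_le : ∀ q : guessed.Symbols, symArity guessed q ≤ s + r
  matrix : RFormula σ guessed s r

/-- `X.Satisfies φ`: the structure `X`, with `succ` and `0`, is a model of `φ`. -/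
noncomputable def FinStr.Satisfies {σ : FirstOrder.Language.{u, v}} {s r : ℕ} (X : FinStr σ) (φ : ESO σ s r) : Prop :=
  ∃ I : φ.guessed.Structure (Fin X.card),
    ∀ (x : Fin s → Fin X.card) (y : Fin r → Fin X.card), φ.matrix.Holds X I x y

end TimeSpace

namespace TimeSpace

/-! ### Structured programs -/

section StructuredPrograms

variable {σ : FirstOrder.Language.{u, v}}

/-! Both sides cut n^(s+r) units of time into n^r blocks of O(n^s). For a formula, a block is a
value of y, and the first s arguments name the places inside it; for a machine, a block is a stretch
of C·n^s consecutive steps. The restriction on the last arguments says that a block is compared only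
with itself and with its successor, which is the logical form of the space bound n^s.

From formulas to machines (`mem_NTISP_of_ESO`). For fixed y the matrix reads a guessed symbol only
at (a, y₁…y_δ) and (a, succ(y₁…y_δ)), so everything it can read fits into a table with O(n^s)
entries. The machine guesses the table for the first y, runs through y in lexicographic order,
checks the matrix for all x, and passes to the next table: where the prefix on which a symbol
depends changes, the successor entry becomes the current one and a new successor entry is guessed.
`satisfies_iff_exists_tables` shows that sequences of tables linked in this way amount to
interpretations of the guessed symbols, once the condition `Coherent` is added for the prefix that
is its own successor. Without multiplication the address belonging to a tuple cannot be computed in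
constant time. Therefore each tuple has a record that contains its components, and a lookup guesses
a record and compares components. A guessed address is known to be that of a record because only the
first fields of records are nonzero addresses that contain themselves (`Rep.eq_recAddr`). So a
lookup takes constant time and a pass over the table O(n^s). Correctness of the guessing programs is
stated by `Spec`, which is two-sided: every completed execution, whatever it guesses, has an
admissible outcome, and every admissible outcome is reached within the bounds.

From machines to formulas (`exists_ESO_of_mem_NTISP`). An accepting computation is prolonged by
idling in the last line to N·n^r steps, where N = C·n^s exceeds all numbers that occur. A time is a
pair (t, w) with t < N, w < n^r, and a number below N is a leading digit below the constant C with
an s-tuple. Hence the computation is described by functions of t and w that symbols of arity s + r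
can represent (`certLang`, `Decodes`), and the correctness of a step on the accumulators is a local
condition. The difficulty is the memory. Every step is treated as a write to the address in A,
possibly of the old value. Within a block the accesses of one address are linked into a list: the
value read is the one written at the previous access or, at the first access, the content at the
beginning of the block; the last access determines the content at the beginning of the next block.
By the lemmas on `Chained`, a few local conditions force the links to be the true ones, so that
certificates (`Cert`) and accepting runs can be obtained from each other (`exists_run_of_cert`,
`exists_cert_of_run`). One of these conditions is p < t for times in a block, and the order as a
relation would need 2s arguments. With two digits in base about √N, however, there are at most N
pairs of digits u < v. They are listed by unary functions whose correctness is again local, and the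
number of an entry witnesses p < t (`Less`, `exists_digits`). Finally `Cert` is turned into a
formula by a calculus of definable properties and of numbers defined by cases (`LDef`, `LNum`). -/

theorem numAcc_pos (σ : FirstOrder.Language.{u, v}) : 0 < numAcc σ :=
  lt_of_lt_of_le Nat.zero_lt_one (le_max_left _ _)

/-- The accumulator `B₁`, used in all comparisons. -/
noncomputable def acc0 (σ : FirstOrder.Language.{u, v}) : Fin (numAcc σ) := ⟨0, numAcc_pos σ⟩

/-- The instructions without control flow. -/
inductive Op (σ : FirstOrder.Language.{u, v}) : Type (max u v)
  | getSize
  | setZero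
  | incr
  | guess
  | getFun {k : ℕ} (f : σ.Functions k)
  | getRel {k : ℕ} (Q : σ.Relations k)
  | load
  | copy (b : Fin (numAcc σ))
  | store (b : Fin (numAcc σ))

def Op.toInstr (len : ℕ) : Op σ → Instr σ len
  | .getSize => .getSize
  | .setZero => .setZero
  | .incr => .incr
  | .guess => .guess
  | .getFun f => .getFun f
  | .getRel Q => .getRel Q
  | .load => .load
  | .copy b => .copy b
  | .store b => .store b

/-- Structured programs; all tests compare `A` with the first accumulator `B₁`. The program
`loop pre body` executes `pre` and stops if the test succeeds, otherwise it executes `body` and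
starts again. -/
inductive Cmd (σ : FirstOrder.Language.{u, v}) : Type (max u v)
  | skip
  | op (o : Op σ)
  | fail
  | seq (c₁ c₂ : Cmd σ)
  | ite (c₁ c₂ : Cmd σ)
  | loop (pre body : Cmd σ)

/-- The lines of an assembled program. -/
inductive Line (σ : FirstOrder.Language.{u, v}) : Type (max u v)
  | op (o : Op σ)
  | jump (i j : ℕ)
  | fail

def Cmd.size : Cmd σ → ℕ
  | .skip => 0
  | .op _ => 1
  | .fail => 1
  | .seq c₁ c₂ => c₁.size + c₂.size
  | .ite c₁ c₂ => c₁.size + c₂.size + 2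
  | .loop pre body => pre.size + body.size + 2

/-- The code of a structured program when it is placed in line `k`. -/
def Cmd.code : Cmd σ → ℕ → List (Line σ)
  | .skip, _ => []
  | .op o, _ => [.op o]
  | .fail, _ => [.fail]
  | .seq c₁ c₂, k => c₁.code k ++ c₂.code (k + c₁.size)
  | .ite c₁ c₂, k =>
      .jump (k + 1) (k + 1 + c₁.size + 1) :: (c₁.code (k + 1) ++
        .jump (k + (c₁.size + c₂.size + 2)) (k + (c₁.size + c₂.size + 2)) ::
          c₂.code (k + 1 + c₁.size + 1))
  | .loop pre body, k =>
      pre.code k ++ .jump (k + (pre.size + body.size + 2)) (k + pre.size + 1) ::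
        (body.code (k + pre.size + 1) ++ [.jump k k])

theorem Cmd.length_code (c : Cmd σ) (k : ℕ) : (c.code k).length = c.size := by
  induction c generalizing k with
  | skip | op | fail => rfl
  | seq c₁ c₂ h₁ h₂ => simp [Cmd.code, Cmd.size, h₁, h₂]
  | ite c₁ c₂ h₁ h₂ => simp [Cmd.code, Cmd.size, h₁, h₂]; ring
  | loop c₁ c₂ h₁ h₂ => simp [Cmd.code, Cmd.size, h₁, h₂]; ring

/-- The code `l` stands in the lines `k, k + 1, …` of `L`. -/
def CodeAt (L : List (Line σ)) (k : ℕ) (l : List (Line σ)) : Prop :=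
  ∀ i < l.length, L[k + i]? = l[i]?

theorem CodeAt.left {L : List (Line σ)} {k : ℕ} {l₁ l₂ : List (Line σ)}
    (h : CodeAt L k (l₁ ++ l₂)) : CodeAt L k l₁ := by
  intro i hi
  rw [h i (by simp; omega), List.getElem?_append_left hi]

theorem CodeAt.right {L : List (Line σ)} {k : ℕ} {l₁ l₂ : List (Line σ)}
    (h : CodeAt L k (l₁ ++ l₂)) : CodeAt L (k + l₁.length) l₂ := by
  intro i hi
  rw [add_assoc, h _ (by simp; omega), List.getElem?_append_right (by omega)]
  simp

theorem CodeAt.head {L : List (Line σ)} {k : ℕ} {a : Line σ} {l : List (Line σ)}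
    (h : CodeAt L k (a :: l)) : L[k]? = some a := by
  simpa using h 0 (by simp)

theorem CodeAt.tail {L : List (Line σ)} {k : ℕ} {a : Line σ} {l : List (Line σ)}
    (h : CodeAt L k (a :: l)) : CodeAt L (k + 1) l := by
  intro i hi
  simpa [add_assoc, add_comm 1 i] using h (i + 1) (by simpa using hi)

variable [Finite σ.Symbols]

noncomputable def Op.Effect (o : Op σ) (X : FinStr σ) (m m' : Regs (numAcc σ)) : Prop :=
  (o.toInstr 0).Effect X m m'

/-- `Exec X ok c k m m'`: the program `c` may change the register contents from `m` to `m'`, in `k`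
steps, all register contents on the way satisfying `ok`. -/
inductive Exec (X : FinStr σ) (ok : Regs (numAcc σ) → Prop) :
    Cmd σ → ℕ → Regs (numAcc σ) → Regs (numAcc σ) → Prop
  | skip {m} : Exec X ok .skip 0 m m
  | op {o m m'} : o.Effect X m m' → ok m' → Exec X ok (.op o) 1 m m'
  | seq {c₁ c₂ k₁ k₂ m₁ m₂ m₃} : Exec X ok c₁ k₁ m₁ m₂ → Exec X ok c₂ k₂ m₂ m₃ →
      Exec X ok (.seq c₁ c₂) (k₁ + k₂) m₁ m₃
  | iteT {c₁ c₂ k m m'} : m.A = m.B (acc0 σ) → Exec X ok c₁ k m m' →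
      Exec X ok (.ite c₁ c₂) (k + 2) m m'
  | iteF {c₁ c₂ k m m'} : m.A ≠ m.B (acc0 σ) → Exec X ok c₂ k m m' →
      Exec X ok (.ite c₁ c₂) (k + 1) m m'
  | loopDone {pre body k m m'} : Exec X ok pre k m m' → m'.A = m'.B (acc0 σ) →
      Exec X ok (.loop pre body) (k + 1) m m'
  | loopStep {pre body k₁ k₂ k₃ m m₁ m₂ m'} : Exec X ok pre k₁ m m₁ → m₁.A ≠ m₁.B (acc0 σ) →
      Exec X ok body k₂ m₁ m₂ → Exec X ok (.loop pre body) k₃ m₂ m' →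
      Exec X ok (.loop pre body) (k₁ + 1 + (k₂ + 1 + k₃)) m m'

theorem Exec.ok_of_ok {X : FinStr σ} {ok : Regs (numAcc σ) → Prop} {c : Cmd σ} {k : ℕ}
    {m m' : Regs (numAcc σ)} (h : Exec X ok c k m m') (hm : ok m) : ok m' := by
  induction h <;> simp_all

/-- One step of the assembled program `L`. -/
noncomputable def LStep (L : List (Line σ)) (X : FinStr σ) (a b : ℕ × Regs (numAcc σ)) : Prop :=
  match L[a.1]? with
  | some (.op o) => o.Effect X a.2 b.2 ∧ b.1 = a.1 + 1
  | some (.jump i j) =>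
      b.2 = a.2 ∧ b.1 = min (if a.2.A = a.2.B (acc0 σ) then i else j) L.length
  | _ => False

/-- Computations of an assembled program, with the number of steps. -/
inductive Path (L : List (Line σ)) (X : FinStr σ) (ok : Regs (numAcc σ) → Prop) :
    ℕ → ℕ × Regs (numAcc σ) → ℕ × Regs (numAcc σ) → Prop
  | nil {a} : Path L X ok 0 a a
  | cons {k a b c} : LStep L X a b → ok b.2 → Path L X ok k b c → Path L X ok (k + 1) a c

theorem Path.trans {L : List (Line σ)} {X : FinStr σ} {ok : Regs (numAcc σ) → Prop} {k l : ℕ}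
    {a b c : ℕ × Regs (numAcc σ)} (h : Path L X ok k a b) (h' : Path L X ok l b c) :
    Path L X ok (k + l) a c := by
  induction h with
  | nil => simpa using h'
  | cons h₁ h₂ _ ih =>
    rw [Nat.add_right_comm]
    exact .cons h₁ h₂ (ih h')

theorem LStep.jump {L : List (Line σ)} {X : FinStr σ} {k i j : ℕ} (h : L[k]? = some (.jump i j))
    (hi : i ≤ L.length) (hj : j ≤ L.length) (m : Regs (numAcc σ)) (b : ℕ × Regs (numAcc σ)) :
    LStep L X (k, m) b ↔ b = (if m.A = m.B (acc0 σ) then i else j, m) := by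
  simp only [LStep, h]
  split_ifs <;> simp [Prod.ext_iff, *, and_comm]

theorem Path.single {L : List (Line σ)} {X : FinStr σ} {ok : Regs (numAcc σ) → Prop}
    {a b : ℕ × Regs (numAcc σ)} (h : LStep L X a b) (h' : ok b.2) : Path L X ok 1 a b :=
  .cons h h' .nil

/-- The execution is retraced line by line. A jump leaves the registers alone, so `ok` survives it;
this is why `Exec` demands `ok` only after operations. -/
theorem Exec.path {L : List (Line σ)} {X : FinStr σ} {ok : Regs (numAcc σ) → Prop} {c : Cmd σ}
    {k : ℕ} {m m' : Regs (numAcc σ)} (h : Exec X ok c k m m') (hm : ok m) {i : ℕ}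
    (hc : CodeAt L i (c.code i)) (hl : i + c.size ≤ L.length) :
    Path L X ok k (i, m) (i + c.size, m') := by
  induction h generalizing i with
  | skip => exact .nil
  | op h h' =>
    refine .single ?_ h'
    have := hc.head
    simp [LStep, this, h, Cmd.size]
  | @seq c₁ c₂ k₁ k₂ m₁ m₂ m₃ e₁ e₂ h₁ h₂ =>
    simp only [Cmd.size] at hl ⊢
    have := hc.right
    rw [Cmd.length_code] at this
    rw [← add_assoc]
    exact (h₁ hm hc.left (by omega)).trans (h₂ (e₁.ok_of_ok hm) this (by omega))
  | @iteT c₁ c₂ k m m' h e ih =>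
    simp only [Cmd.size] at hl ⊢
    have h₁ := hc.head
    have h₂ := hc.tail.left
    have h₃ := hc.tail.right.head
    rw [Cmd.length_code] at h₃
    have p₁ : Path L X ok 1 (i, m) (i + 1, m) :=
      .single ((LStep.jump h₁ (by omega) (by omega) _ _).2 (by simp [h])) hm
    have p₃ : Path L X ok 1 (i + 1 + c₁.size, m') (i + (c₁.size + c₂.size + 2), m') :=
      .single ((LStep.jump h₃ (by omega) (by omega) _ _).2 (by simp)) (e.ok_of_ok hm)
    have := p₁.trans ((ih hm h₂ (by omega)).trans p₃)
    rwa [show 1 + (k + 1) = k + 2 by ring] at this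
  | @iteF c₁ c₂ k m m' h e ih =>
    simp only [Cmd.size] at hl ⊢
    have h₁ := hc.head
    have h₂ := hc.tail.right.tail
    rw [Cmd.length_code] at h₂
    have p₁ : Path L X ok 1 (i, m) (i + 1 + c₁.size + 1, m) :=
      .single ((LStep.jump h₁ (by omega) (by omega) _ _).2 (by simp [h])) hm
    have := p₁.trans (ih hm h₂ (by omega))
    rwa [show 1 + k = k + 1 by ring, show i + 1 + c₁.size + 1 + c₂.size =
      i + (c₁.size + c₂.size + 2) by ring] at this
  | @loopDone pre body k m m' e h ih =>
    simp only [Cmd.size] at hl ⊢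
    have h₁ := hc.left
    have h₂ := hc.right.head
    rw [Cmd.length_code] at h₂
    exact (ih hm h₁ (by omega)).trans
      (.single ((LStep.jump h₂ (by omega) (by omega) _ _).2 (by simp [h])) (e.ok_of_ok hm))
  | @loopStep pre body k₁ k₂ k₃ m m₁ m₂ m' e₁ h e₂ e₃ ih₁ ih₂ ih₃ =>
    simp only [Cmd.size] at hl ih₃ ⊢
    have h₁ := hc.left
    have h₂ := hc.right.head
    have h₃ := hc.right.tail.left
    have h₄ := hc.right.tail.right.head
    rw [Cmd.length_code] at h₂ h₃ h₄
    rw [Cmd.length_code] at h₄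
    have hm₁ := e₁.ok_of_ok hm
    have hm₂ := e₂.ok_of_ok hm₁
    refine ((ih₁ hm h₁ (by omega)).trans (.single ((LStep.jump h₂ (by omega) (by omega) _ _).2
      (by simp [h]; rfl)) hm₁)).trans ?_
    exact ((ih₂ hm₁ h₃ (by omega)).trans (.single ((LStep.jump h₄ (by omega) (by omega) _ _).2
      (by simp)) hm₂)).trans (ih₃ hm₂ hc hl)

/-- A path that ends behind the last line cannot get stuck or stop inside the code of `c`, and that
code can be left only at its end. The bound on the length of the remaining path is what the
induction over the rounds of a loop needs. -/
theorem Path.exec {L : List (Line σ)} {X : FinStr σ} {ok : Regs (numAcc σ) → Prop} (c : Cmd σ)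
    {k : ℕ} {i : ℕ} {m : Regs (numAcc σ)} {e : ℕ × Regs (numAcc σ)}
    (hp : Path L X ok k (i, m) e) (he : L.length ≤ e.1)
    (hc : CodeAt L i (c.code i)) (hl : i + c.size ≤ L.length) :
    ∃ k₁ k₂ m', Exec X ok c k₁ m m' ∧ Path L X ok k₂ (i + c.size, m') e ∧ k₂ ≤ k := by
  induction c generalizing k i m with
  | skip => exact ⟨0, k, m, .skip, hp, le_rfl⟩
  | op o =>
    have h := hc.head
    simp only [Cmd.size] at hl
    cases hp with
    | nil => simp at he; omega
    | @cons k a b c h₁ h₂ h₃ =>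
      simp only [LStep, h] at h₁
      obtain ⟨b₁, b₂⟩ := b
      obtain ⟨h₁, rfl⟩ := h₁
      exact ⟨1, k, b₂, .op h₁ h₂, h₃, by omega⟩
  | fail =>
    have h := hc.head
    simp only [Cmd.size] at hl
    cases hp with
    | nil => simp at he; omega
    | cons h₁ h₂ h₃ => simp [LStep, h] at h₁
  | seq c₁ c₂ ih₁ ih₂ =>
    simp only [Cmd.size] at hl ⊢
    have h₂ := hc.right
    rw [Cmd.length_code] at h₂
    obtain ⟨k₁, k₂, m₁, e₁, p₁, hk₁⟩ := ih₁ hp hc.left (by omega)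
    obtain ⟨k₃, k₄, m₂, e₂, p₂, hk₂⟩ := ih₂ p₁ h₂ (by omega)
    exact ⟨_, k₄, m₂, .seq e₁ e₂, by rwa [← add_assoc], by omega⟩
  | ite c₁ c₂ ih₁ ih₂ =>
    simp only [Cmd.size] at hl ⊢
    have h₁ := hc.head
    have h₂ := hc.tail.left
    have h₃ := hc.tail.right.head
    have h₄ := hc.tail.right.tail
    rw [Cmd.length_code] at h₃ h₄
    cases hp with
    | nil => simp at he; omega
    | cons s₁ o₁ p₁ =>
      rw [LStep.jump h₁ (by omega) (by omega)] at s₁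
      subst s₁
      by_cases hm : m.A = m.B (acc0 σ)
      · rw [if_pos hm] at p₁
        obtain ⟨k₁, k₂, m₁, e₁, p₂, hk₁⟩ := ih₁ p₁ h₂ (by omega)
        cases p₂ with
        | nil => simp at he; omega
        | cons s₂ o₂ p₂ =>
          rw [LStep.jump h₃ (by omega) (by omega)] at s₂
          subst s₂
          exact ⟨_, _, m₁, .iteT hm e₁, by simpa using p₂, by omega⟩
      · rw [if_neg hm] at p₁
        obtain ⟨k₁, k₂, m₁, e₁, p₂, hk₁⟩ := ih₂ p₁ h₄ (by omega)
        exact ⟨_, _, m₁, .iteF hm e₁, by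
          rwa [show i + 1 + c₁.size + 1 + c₂.size = i + (c₁.size + c₂.size + 2) by ring] at p₂,
          by omega⟩
  | loop pre body ih₁ ih₂ =>
    simp only [Cmd.size] at hl ⊢
    have h₁ := hc.left
    have h₂ := hc.right.head
    have h₃ := hc.right.tail.left
    have h₄ := hc.right.tail.right.head
    rw [Cmd.length_code] at h₂ h₃ h₄
    rw [Cmd.length_code] at h₄
    -- Each round consumes its own jumps, so the remaining path becomes shorter.
    induction k using Nat.strong_induction_on generalizing m with
    | _ k ih =>
    obtain ⟨k₁, k₂, m₁, e₁, p₁, hk₁⟩ := ih₁ hp h₁ (by omega)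
    cases p₁ with
    | nil => simp at he; omega
    | cons s₁ o₁ p₁ =>
      rw [LStep.jump h₂ (by omega) (by omega)] at s₁
      subst s₁
      by_cases hm : m₁.A = m₁.B (acc0 σ)
      · rw [if_pos hm] at p₁
        exact ⟨_, _, m₁, .loopDone e₁ hm, p₁, by omega⟩
      · rw [if_neg hm] at p₁
        obtain ⟨k₃, k₄, m₂, e₂, p₂, hk₂⟩ := ih₂ p₁ h₃ (by omega)
        cases p₂ with
        | nil => simp at he; omega
        | cons s₂ o₂ p₂ =>
          rw [LStep.jump h₄ (by omega) (by omega)] at s₂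
          subst s₂
          rw [ite_self] at p₂
          obtain ⟨k₅, k₆, m₃, e₃, p₃, hk₃⟩ := ih _ (by omega) p₂
          exact ⟨_, _, m₃, .loopStep e₁ hm e₂ e₃, p₃, by omega⟩

/-! ### The machine of a structured program -/

/-- Jump targets are cut off at the line of `accept`. `LStep` does the same, so the two step
relations agree for every list of lines, without a condition of well-formedness. -/
noncomputable def Line.toInstr (len : ℕ) : Line σ → Instr σ len
  | .op o => o.toInstr len
  | .jump i j => .branch (acc0 σ) ⟨min i len, by omega⟩ ⟨min j len, by omega⟩
  | .fail => .reject

omit [Finite σ.Symbols] in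
theorem Line.toInstr_ne_accept {len : ℕ} (l : Line σ) : l.toInstr len ≠ .accept := by
  rcases l with (_ | _ | _) | _ | _ <;> simp [Line.toInstr, Op.toInstr]

/-- The machine with program `L`, followed by `accept`. -/
noncomputable def machine (L : List (Line σ)) : NRAM σ where
  len := L.length
  prog i := if h : i.1 < L.length then (L[i.1]).toInstr L.length else .accept
  accept_iff i := by
    split_ifs with h
    · simp only [Line.toInstr_ne_accept, false_iff]
      rintro rfl
      simp at h
    · simp only [true_iff]
      exact Fin.ext (by simp; omega)

def Config.toPair {M : NRAM σ} (C : Config M) : ℕ × Regs (numAcc σ) := (C.pc, C.regs)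

theorem machine_step_iff {L : List (Line σ)} {X : FinStr σ} (C C' : Config (machine L)) :
    (machine L).Step X C C' ↔ LStep L X C.toPair C'.toPair := by
  obtain ⟨i, m⟩ := C
  obtain ⟨j, m'⟩ := C'
  by_cases h : i.1 < L.length
  · have hL : L[i.1]? = some L[i.1] := List.getElem?_eq_getElem h
    simp only [NRAM.Step, machine, h, dite_true, LStep, Config.toPair, hL]
    rcases hl : L[i.1] with o | ⟨a, b⟩ | _
    · cases o <;> simp [Line.toInstr, Op.toInstr, Instr.Next, Op.Effect, Instr.Effect]
    · simp only [Line.toInstr, Instr.Effect, Instr.Next, and_congr_right_iff]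
      rintro rfl
      by_cases hm : m'.A = m'.B (acc0 σ)
      · simp only [hm, if_true]
        exact Fin.ext_iff (n := L.length + 1)
      · simp only [hm, if_false]
        exact Fin.ext_iff (n := L.length + 1)
    · simp [Line.toInstr, Instr.Effect]
  · simp [NRAM.Step, machine, h, LStep, Config.toPair, Instr.Effect]

theorem path_of_steps {L : List (Line σ)} {X : FinStr σ} (t : ℕ) (C : ℕ → Config (machine L))
    (h : ∀ i < t, (machine L).Step X (C i) (C (i + 1))) :
    Path L X (fun _ => True) t (C 0).toPair (C t).toPair := by
  induction t generalizing C with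
  | zero => exact .nil
  | succ t ih =>
    exact .cons ((machine_step_iff _ _).1 (h 0 (by omega))) trivial
      (ih (fun i => C (i + 1)) fun i hi => h (i + 1) (by omega))

theorem Path.exists_steps {L : List (Line σ)} {X : FinStr σ} {ok : Regs (numAcc σ) → Prop} {t : ℕ}
    {a b : ℕ × Regs (numAcc σ)} (h : Path L X ok t a b) (ha : a.1 ≤ L.length) (hok : ok a.2) :
    ∃ C : ℕ → Config (machine L), (C 0).toPair = a ∧ (C t).toPair = b ∧
      (∀ i < t, (machine L).Step X (C i) (C (i + 1))) ∧ ∀ i ≤ t, ok (C i).regs := by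
  induction h with
  | @nil a =>
    exact ⟨fun _ => ⟨⟨a.1, Nat.lt_succ_of_le ha⟩, a.2⟩, rfl, rfl, by simp, fun _ _ => hok⟩
  | @cons k a b c h₁ h₂ _ ih =>
    have hb : b.1 ≤ L.length := by
      unfold LStep at h₁
      split at h₁
      · next h => have := (List.getElem?_eq_some_iff.1 h).1; omega
      · exact h₁.2.trans_le (min_le_right _ _)
      · exact h₁.elim
    obtain ⟨C, hC, hC', hs, ho⟩ := ih hb h₂
    refine ⟨fun i => Nat.casesOn i ⟨⟨a.1, Nat.lt_succ_of_le ha⟩, a.2⟩ C, rfl, hC', ?_, ?_⟩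
    · rintro (_ | i) hi
      · refine (machine_step_iff _ _).2 ?_
        simp only [hC]
        exact h₁
      · exact hs i (by omega)
    · rintro (_ | i) hi
      · exact hok
      · exact ho i (by omega)

/-- All register contents are at most `b`. -/
def Regs.Le {d : ℕ} (b : ℕ) (m : Regs d) : Prop := m.A ≤ b ∧ (∀ j, m.B j ≤ b) ∧ ∀ x, m.R x ≤ b

/-- An accessed address is the content of A, so a bound on the register contents bounds the
addresses too. The `k + 1` counts the final `accept`. In `h₁` nothing is assumed about the size of
the numbers, since a machine must reject also when it guesses wildly. -/
theorem mem_NTISP_of_cmd {P : Problem σ} {T S : ℕ → ℕ} (c : Cmd σ) (K : ℕ) (b : ℕ → ℕ)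
    (hb : ∀ n, 0 < n → b n ≤ K * S n)
    (h₁ : ∀ (X : FinStr σ) k m, Exec X (fun _ => True) c k (Regs.init _) m → X ∈ P)
    (h₂ : ∀ X ∈ P, ∃ k m, k + 1 ≤ K * T X.card ∧
      Exec X (Regs.Le (b X.card)) c k (Regs.init _) m) :
    P ∈ NTISP σ T S := by
  set L := c.code 0 with hL
  have hlen : L.length = c.size := Cmd.length_code _ _
  have hc : CodeAt L 0 (c.code 0) := fun i _ => by simp [hL]
  refine ⟨machine L, K, fun X => ?_⟩
  have main : X ∈ P → ∃ t C, (machine L).AcceptingRun X t C ∧ t + 1 ≤ K * T X.card ∧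
      (machine L).SpaceBounded t C (K * S X.card) (K * max X.card (S X.card)) := by
    intro hX
    obtain ⟨k, m, hk, he⟩ := h₂ X hX
    have hi : (Regs.init (numAcc σ)).Le (b X.card) := by simp [Regs.Le, Regs.init]
    obtain ⟨C, hC, hC', hs, ho⟩ := (he.path hi hc (by omega)).exists_steps (Nat.zero_le _) hi
    have hbX := hb X.card X.pos
    refine ⟨k, C, ⟨?_, hs, ?_⟩, hk, fun i hi _ => (ho i hi).1.trans hbX, fun i hi => ?_⟩
    · have h₁ := congrArg Prod.fst hC
      have h₂ := congrArg Prod.snd hC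
      rcases hC0 : C 0 with ⟨p, q⟩
      rw [hC0] at h₁ h₂
      simp only [Config.toPair] at h₁ h₂
      subst h₂
      simp only [Config.start, Config.mk.injEq, and_true]
      exact Fin.ext (by simpa using h₁)
    · refine ((machine L).accept_iff _).2 (Fin.ext ?_)
      have := congrArg Prod.fst hC'
      simp only [Config.toPair] at this
      simp [this, machine, hlen]
    · obtain ⟨h₁, h₂, h₃⟩ := ho i hi
      have : b X.card ≤ K * max X.card (S X.card) :=
        hbX.trans (Nat.mul_le_mul_left _ (le_max_right _ _))
      exact ⟨h₁.trans this, fun j => (h₂ j).trans this, fun j => (h₃ j).trans this⟩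
  refine ⟨⟨fun h => ?_, ?_⟩, main⟩
  · obtain ⟨t, C, h, -⟩ := main h
    exact ⟨t, C, h⟩
  · rintro ⟨t, C, h0, hs, ha⟩
    have hp := path_of_steps t C hs
    rw [((machine L).accept_iff _).1 ha |> fun h => show (C t).toPair = (L.length, (C t).regs) by
      simp [Config.toPair, h, machine], h0] at hp
    obtain ⟨k₁, -, m, he, -⟩ := Path.exec c (i := 0) (m := Regs.init _) hp le_rfl hc (by omega)
    exact h₁ X k₁ m he

end StructuredPrograms

end TimeSpace

namespace TimeSpace

/-! ### The lexicographic numbering of tuples -/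

section Lex

variable {n : ℕ}

/-- The number of a tuple in the lexicographic order, most significant component first. -/
def lexNum : {δ : ℕ} → (Fin δ → Fin n) → ℕ
  | 0, _ => 0
  | δ + 1, a => (a 0).val * n ^ δ + lexNum (Fin.tail a)

theorem lexNum_lt {δ : ℕ} (a : Fin δ → Fin n) : lexNum a < n ^ δ := by
  induction δ with
  | zero => simp [lexNum]
  | succ δ ih =>
    have h₁ := ih (Fin.tail a)
    have h₂ : ((a 0).val + 1) * n ^ δ ≤ n * n ^ δ := Nat.mul_le_mul_right _ (a 0).isLt
    simp only [lexNum, pow_succ']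
    linarith

theorem lexNum_injective {δ : ℕ} : Function.Injective (lexNum : (Fin δ → Fin n) → ℕ) := by
  induction δ with
  | zero => intro a b _; exact Subsingleton.elim a b
  | succ δ ih =>
    intro a b h
    have ha := lexNum_lt (Fin.tail a)
    have hb := lexNum_lt (Fin.tail b)
    simp only [lexNum] at h
    have h₀ : (a 0).val = (b 0).val := by
      have := congrArg (· / n ^ δ) h
      have hp : 0 < n ^ δ := by omega
      simpa [Nat.add_div_of_dvd_right, Nat.mul_div_cancel _ hp, Nat.div_eq_of_lt ha,
        Nat.div_eq_of_lt hb] using this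
    rw [h₀] at h
    have h₁ := ih (Nat.add_left_cancel h)
    rw [← Fin.cons_self_tail a, ← Fin.cons_self_tail b, h₁, Fin.ext h₀]

/-- The lexicographic numbering. -/
noncomputable def lexEquiv (n δ : ℕ) : (Fin δ → Fin n) ≃ Fin (n ^ δ) :=
  Equiv.ofBijective (fun a => ⟨lexNum a, lexNum_lt a⟩) <|
    (Fintype.bijective_iff_injective_and_card _).2
      ⟨fun _ _ h => lexNum_injective (congrArg Fin.val h), by simp⟩

@[simp]
theorem lexEquiv_val {δ : ℕ} (a : Fin δ → Fin n) : (lexEquiv n δ a).val = lexNum a := rfl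

@[simp]
theorem lexNum_lexEquiv_symm {δ : ℕ} (p : Fin (n ^ δ)) : lexNum ((lexEquiv n δ).symm p) = p := by
  rw [← lexEquiv_val, Equiv.apply_symm_apply]

theorem exists_lexNum_eq {δ p : ℕ} (h : p < n ^ δ) : ∃ a : Fin δ → Fin n, lexNum a = p :=
  ⟨(lexEquiv n δ).symm ⟨p, h⟩, lexNum_lexEquiv_symm _⟩

theorem lexNum_eq_zero_iff {δ : ℕ} (a : Fin δ → Fin n) : lexNum a = 0 ↔ ∀ j, (a j).val = 0 := by
  induction δ with
  | zero => simp [lexNum]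
  | succ δ ih =>
    have : n ≠ 0 := (a 0).pos.ne'
    simp [lexNum, ih, Fin.forall_fin_succ, this, Fin.tail]

theorem lexNum_add_one_eq_iff {δ : ℕ} (a : Fin δ → Fin n) :
    lexNum a + 1 = n ^ δ ↔ ∀ j, (a j).val = n - 1 := by
  induction δ with
  | zero => simp [lexNum]
  | succ δ ih =>
    have h := lexNum_lt (Fin.tail a)
    rw [Fin.forall_fin_succ]
    change _ ↔ _ ∧ ∀ j, (Fin.tail a j).val = n - 1
    rw [← ih, lexNum, add_assoc, pow_succ']
    obtain ⟨k, hk⟩ : ∃ k, n = (a 0).val + 1 + k := ⟨n - ((a 0).val + 1), by omega⟩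
    constructor
    · intro h'
      have hn : n * n ^ δ = (a 0).val * n ^ δ + n ^ δ + k * n ^ δ := by
        conv_lhs => rw [hk, ← hk]
        nth_rewrite 1 [hk]
        ring
      have : k * n ^ δ = 0 := by omega
      rcases Nat.mul_eq_zero.1 this with h0 | h0
      · exact ⟨by omega, by omega⟩
      · omega
    · rintro ⟨h₁, h₂⟩
      rw [h₂, h₁]
      obtain ⟨m, rfl⟩ : ∃ m, n = m + 1 := ⟨n - 1, by omega⟩
      simp
      ring

theorem lexSucc_of_forall {δ : ℕ} {a : Fin δ → Fin n} (h : ∀ j, (a j).val = n - 1) :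
    lexSucc a = a := by
  funext i
  simp [lexSucc, h]

/-- Induction from the leading component: if the rest is full, the carry goes into the leading
component and the rest becomes 0; otherwise the leading component stays and the successor acts on
the rest. -/
theorem lexNum_lexSucc {δ : ℕ} {a : Fin δ → Fin n} (h : ¬ ∀ j, (a j).val = n - 1) :
    lexNum (lexSucc a) = lexNum a + 1 := by
  induction δ with
  | zero => simp at h
  | succ δ ih =>
    by_cases ht : ∀ j, (Fin.tail a j).val = n - 1
    · have h0 : (a 0).val ≠ n - 1 := fun h0 => h (Fin.forall_fin_succ.2 ⟨h0, ht⟩)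
      have e0 : (lexSucc a 0).val = (a 0).val + 1 := by
        have : ∀ j : Fin (δ + 1), 0 < j → (a j).val = n - 1 := by
          intro j hj
          obtain ⟨j, rfl⟩ := Fin.exists_succ_eq.2 hj.ne'
          exact ht j
        have hlt : (a 0).val + 1 < n := by have := (a 0).isLt; omega
        rw [lexSucc, if_neg h, if_pos this, if_neg h0, succFin, dif_pos hlt]
      have et : lexNum (Fin.tail (lexSucc a)) = 0 := by
        rw [lexNum_eq_zero_iff]
        intro j
        have : ∀ i : Fin (δ + 1), j.succ < i → (a i).val = n - 1 := by
          intro i hi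
          obtain ⟨i, rfl⟩ := Fin.exists_succ_eq.2 (Fin.pos_iff_ne_zero.1 ((Fin.succ_pos j).trans hi))
          exact ht i
        have hj : (a j.succ).val = n - 1 := ht j
        rw [Fin.tail, lexSucc, if_neg h, if_pos this, if_pos hj]
      have hs := (lexNum_add_one_eq_iff _).2 ht
      rw [lexNum, e0, et, lexNum, add_assoc, hs]
      ring
    · have e0 : lexSucc a 0 = a 0 := by
        rw [lexSucc, if_neg h, if_neg]
        exact fun h' => ht fun j => h' j.succ (Fin.succ_pos j)
      have et : Fin.tail (lexSucc a) = lexSucc (Fin.tail a) := by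
        funext j
        have : (∀ i : Fin (δ + 1), j.succ < i → (a i).val = n - 1) ↔
            ∀ i, j < i → (Fin.tail a i).val = n - 1 := by
          simp [Fin.forall_fin_succ, Fin.tail]
        rw [lexSucc, if_neg ht, ← if_congr this rfl rfl, Fin.tail, lexSucc, if_neg h]
        rfl
      rw [lexNum, e0, et, ih ht, lexNum, add_assoc]

theorem lexNum_lexSucc_eq {δ : ℕ} (a : Fin δ → Fin n) :
    lexNum (lexSucc a) = min (lexNum a + 1) (n ^ δ - 1) := by
  have := lexNum_lt a
  by_cases h : ∀ j, (a j).val = n - 1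
  · have h' := (lexNum_add_one_eq_iff a).2 h
    rw [lexSucc_of_forall h, ← h']
    simp
  · have h' := fun h' => h ((lexNum_add_one_eq_iff a).1 h')
    rw [lexNum_lexSucc h]
    exact (min_eq_left (Nat.le_sub_one_of_lt (lt_of_le_of_ne this h'))).symm

end Lex

end TimeSpace

namespace TimeSpace

/-! ### Specifications of programs -/

section Spec

variable {σ : FirstOrder.Language.{u, v}} [Finite σ.Symbols]

/-- `Spec X b c T P Q`: from register contents that satisfy `P`, the program `c` ends only in one of
the situations `Q a`, and each of these can be reached within `T` steps and with numbers at
most `b`. -/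
def Spec (X : FinStr σ) (b : ℕ) (c : Cmd σ) (T : ℕ) (P : Regs (numAcc σ) → Prop) {α : Sort*}
    (Q : α → Regs (numAcc σ) → Prop) : Prop :=
  ∀ m, P m → (∀ k m', Exec X (fun _ => True) c k m m' → ∃ a, Q a m') ∧
    (m.Le b → ∀ a, ∃ k ≤ T, ∃ m', Exec X (Regs.Le b) c k m m' ∧ Q a m')

/-- A deterministic specification. -/
abbrev Det (X : FinStr σ) (b : ℕ) (c : Cmd σ) (T : ℕ) (P Q : Regs (numAcc σ) → Prop) : Prop :=
  Spec X b c T P (fun _ : Unit => Q)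

variable {X : FinStr σ} {b T T₁ T₂ T' : ℕ} {c c₁ c₂ : Cmd σ} {P P' : Regs (numAcc σ) → Prop}

/-- The two halves of `Spec` need opposite directions: an old outcome must imply some new one
(soundness), and each new outcome must come from an old one (reachability). -/
theorem Spec.conseq {α α' : Sort*} {Q : α → Regs (numAcc σ) → Prop}
    {Q' : α' → Regs (numAcc σ) → Prop} (h : Spec X b c T P Q) (hP : ∀ m, P' m → P m) (hT : T ≤ T')
    (h₁ : ∀ a, ∃ a', ∀ m, Q a m → Q' a' m) (h₂ : ∀ a', ∃ a, ∀ m, Q a m → Q' a' m) :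
    Spec X b c T' P' Q' := by
  intro m hm
  refine ⟨fun k m' he => ?_, fun hb a' => ?_⟩
  · obtain ⟨a, ha⟩ := (h m (hP m hm)).1 k m' he
    obtain ⟨a', ha'⟩ := h₁ a
    exact ⟨a', ha' _ ha⟩
  · obtain ⟨a, ha⟩ := h₂ a'
    obtain ⟨k, hk, m', he, hq⟩ := (h m (hP m hm)).2 hb a
    exact ⟨k, hk.trans hT, m', he, ha _ hq⟩

theorem Spec.pre {α : Sort*} {Q : α → Regs (numAcc σ) → Prop} (h : Spec X b c T P Q)
    (hP : ∀ m, P' m → P m) : Spec X b c T P' Q :=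
  h.conseq hP le_rfl (fun a => ⟨a, fun _ => id⟩) fun a => ⟨a, fun _ => id⟩

theorem Spec.mono {α : Sort*} {Q : α → Regs (numAcc σ) → Prop} (h : Spec X b c T P Q)
    (hT : T ≤ T') : Spec X b c T' P Q :=
  h.conseq (fun _ => id) hT (fun a => ⟨a, fun _ => id⟩) fun a => ⟨a, fun _ => id⟩

theorem Spec.post {α : Sort*} {Q Q' : α → Regs (numAcc σ) → Prop} (h : Spec X b c T P Q)
    (hQ : ∀ a m, Q a m → Q' a m) : Spec X b c T P Q' :=
  h.conseq (fun _ => id) le_rfl (fun a => ⟨a, hQ a⟩) fun a => ⟨a, hQ a⟩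

theorem Spec.skip {Q : Regs (numAcc σ) → Prop} (h : ∀ m, P m → Q m) : Det X b .skip T P Q := by
  refine fun m hm => ⟨fun k m' he => ?_, fun _ _ => ⟨0, by omega, m, .skip, h m hm⟩⟩
  cases he
  exact ⟨(), h m hm⟩

theorem Spec.seq {α : Sort*} {β : α → Sort*} {Q : α → Regs (numAcc σ) → Prop}
    {Q' : ∀ a, β a → Regs (numAcc σ) → Prop} (h₁ : Spec X b c₁ T₁ P Q)
    (h₂ : ∀ a, Spec X b c₂ T₂ (Q a) (Q' a)) :
    Spec X b (.seq c₁ c₂) (T₁ + T₂) P (fun a : PSigma β => Q' a.1 a.2) := by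
  intro m hm
  refine ⟨fun k m' he => ?_, fun hb a => ?_⟩
  · cases he with
    | seq e₁ e₂ =>
      obtain ⟨a, ha⟩ := (h₁ m hm).1 _ _ e₁
      obtain ⟨a', ha'⟩ := (h₂ a _ ha).1 _ _ e₂
      exact ⟨⟨a, a'⟩, ha'⟩
  · obtain ⟨k₁, hk₁, m₁, e₁, q₁⟩ := (h₁ m hm).2 hb a.1
    obtain ⟨k₂, hk₂, m₂, e₂, q₂⟩ := (h₂ a.1 _ q₁).2 (e₁.ok_of_ok hb) a.2
    exact ⟨_, by omega, m₂, .seq e₁ e₂, q₂⟩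

theorem Det.seq {α : Sort*} {Q : Regs (numAcc σ) → Prop} {Q' : α → Regs (numAcc σ) → Prop}
    (h₁ : Det X b c₁ T₁ P Q) (h₂ : Spec X b c₂ T₂ Q Q') :
    Spec X b (.seq c₁ c₂) (T₁ + T₂) P Q' :=
  (Spec.seq h₁ fun _ => h₂).conseq (fun _ => id) le_rfl (fun a => ⟨a.2, fun _ => id⟩)
    fun a => ⟨⟨(), a⟩, fun _ => id⟩

theorem Spec.seq_det {α : Sort*} {Q Q' : α → Regs (numAcc σ) → Prop}
    (h₁ : Spec X b c₁ T₁ P Q) (h₂ : ∀ a, Det X b c₂ T₂ (Q a) (Q' a)) :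
    Spec X b (.seq c₁ c₂) (T₁ + T₂) P Q' :=
  (Spec.seq h₁ h₂).conseq (fun _ => id) le_rfl (fun a => ⟨a.1, fun _ => id⟩)
    fun a => ⟨⟨a, ()⟩, fun _ => id⟩

theorem Spec.ite {p : Prop} {α : Sort*} {Q : α → Regs (numAcc σ) → Prop}
    (hp : ∀ m, P m → (m.A = m.B (acc0 σ) ↔ p)) (h₁ : p → Spec X b c₁ T₁ P Q)
    (h₂ : ¬p → Spec X b c₂ T₂ P Q) : Spec X b (.ite c₁ c₂) (T₁ + T₂ + 2) P Q := by
  intro m hm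
  by_cases h : p
  · refine ⟨fun k m' he => ?_, fun hb a => ?_⟩
    · cases he with
      | iteT _ he => exact (h₁ h m hm).1 _ _ he
      | iteF h' _ => exact (h' ((hp m hm).2 h)).elim
    · obtain ⟨k, hk, m', he, hq⟩ := (h₁ h m hm).2 hb a
      exact ⟨_, by omega, m', .iteT ((hp m hm).2 h) he, hq⟩
  · refine ⟨fun k m' he => ?_, fun hb a => ?_⟩
    · cases he with
      | iteT h' _ => exact (h ((hp m hm).1 h')).elim
      | iteF _ he => exact (h₂ h m hm).1 _ _ he
    · obtain ⟨k, hk, m', he, hq⟩ := (h₂ h m hm).2 hb a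
      exact ⟨_, by omega, m', .iteF (fun h' => h ((hp m hm).1 h')) he, hq⟩

/-- A failing test has no completed execution, so the type of outcomes is the tested proposition
itself: one outcome if it is true, none if it is false. -/
theorem Spec.assert {p : Prop} (hp : ∀ m, P m → (m.A = m.B (acc0 σ) ↔ p)) :
    Spec X b (.ite .skip .fail) 2 P (fun _ : p => P) := by
  intro m hm
  refine ⟨fun k m' he => ?_, fun hb a => ⟨2, le_rfl, m, .iteT ((hp m hm).2 a) .skip, hm⟩⟩
  cases he with
  | iteT h' he =>
    cases he
    exact ⟨(hp m hm).1 h', hm⟩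
  | iteF _ he => nomatch he

theorem Det.op {o : Op σ} {Q : Regs (numAcc σ) → Prop} (f : Regs (numAcc σ) → Regs (numAcc σ))
    (hf : ∀ m m', o.Effect X m m' ↔ m' = f m) (h : ∀ m, P m → Q (f m))
    (hb : ∀ m, P m → m.Le b → (f m).Le b) : Det X b (.op o) 1 P Q := by
  refine fun m hm => ⟨fun k m' he => ?_, fun hl _ =>
    ⟨1, le_rfl, f m, .op ((hf _ _).2 rfl) (hb m hm hl), h m hm⟩⟩
  cases he with
  | op h' _ => exact ⟨(), (hf _ _).1 h' ▸ h m hm⟩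

/-- An assertion about the registers `B` and `R`. -/
def AF {d : ℕ} (F : (Fin d → ℕ) → (ℕ → ℕ) → Prop) : Regs d → Prop := fun m => F m.B m.R

/-- An assertion about the registers `B` and `R`, and the value of `A`. -/
def AV {d : ℕ} (F : (Fin d → ℕ) → (ℕ → ℕ) → Prop) (a : ℕ) : Regs d → Prop :=
  fun m => F m.B m.R ∧ m.A = a

variable {F F' : (Fin (numAcc σ) → ℕ) → (ℕ → ℕ) → Prop} {a a' : ℕ}

theorem Spec.ofAV {α : Sort*} {Q : α → Regs (numAcc σ) → Prop} (h : Spec X b c T (AF F) Q) :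
    Spec X b c T (AV F a) Q :=
  h.pre fun _ => And.left

theorem Regs.Le.setA {d : ℕ} {m : Regs d} (h : m.Le b) (ha : a ≤ b) :
    Regs.Le b { m with A := a } := ⟨ha, h.2.1, h.2.2⟩

theorem Det.getSize (h : X.card ≤ b) : Det X b (.op .getSize) 1 (AF F) (AV F X.card) :=
  Det.op (fun m => { m with A := X.card }) (fun _ _ => Iff.rfl) (fun _ hm => ⟨hm, rfl⟩)
    fun _ _ hl => hl.setA h

theorem Det.setZero : Det X b (.op .setZero) 1 (AF F) (AV F 0) :=
  Det.op (fun m => { m with A := 0 }) (fun _ _ => Iff.rfl) (fun _ hm => ⟨hm, rfl⟩)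
    fun _ _ hl => hl.setA (Nat.zero_le _)

theorem Det.incr (h : a + 1 ≤ b) : Det X b (.op .incr) 1 (AV F a) (AV F (a + 1)) :=
  Det.op (fun m => { m with A := m.A + 1 }) (fun _ _ => Iff.rfl)
    (fun _ hm => ⟨hm.1, congrArg (· + 1) hm.2⟩) fun _ hm hl => hl.setA (by rw [hm.2]; exact h)

theorem Det.load (h : ∀ B R, F B R → R a = a') : Det X b (.op .load) 1 (AV F a) (AV F a') :=
  Det.op (fun m => { m with A := m.R m.A }) (fun _ _ => Iff.rfl)
    (fun m hm => ⟨hm.1, by rw [← h _ _ hm.1, ← hm.2]⟩) fun _ _ hl => hl.setA (hl.2.2 _)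

theorem Det.copy {i : Fin (numAcc σ)} (h : ∀ B R, F B R → F' (Function.update B i a) R) :
    Det X b (.op (.copy i)) 1 (AV F a) (AV F' a) :=
  Det.op (fun m => { m with B := Function.update m.B i m.A }) (fun _ _ => Iff.rfl)
    (fun m hm => ⟨by simpa [hm.2] using h _ _ hm.1, hm.2⟩) fun m _ hl =>
      ⟨hl.1, fun j => by
        by_cases hj : j = i
        · subst hj; simpa using hl.1
        · simpa [Function.update_of_ne hj] using hl.2.1 j, hl.2.2⟩

theorem Det.store {i : Fin (numAcc σ)} (h : ∀ B R, F B R → F' B (Function.update R a (B i))) :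
    Det X b (.op (.store i)) 1 (AV F a) (AF F') :=
  Det.op (fun m => { m with R := Function.update m.R m.A (m.B i) }) (fun _ _ => Iff.rfl)
    (fun m hm => by rw [hm.2]; exact h _ _ hm.1) fun m _ hl =>
      ⟨hl.1, hl.2.1, fun j => by
        by_cases hj : j = m.A
        · subst hj; simpa using hl.2.1 i
        · simpa [Function.update_of_ne hj] using hl.2.2 j⟩

theorem Det.getFun {k : ℕ} {f : σ.Functions k} (h' : a ≤ b)
    (h : ∀ B R, F B R → X.readFun f (fun i => B (Fin.castLE (fun_le_numAcc f) i)) = a) :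
    Det X b (.op (.getFun f)) 1 (AF F) (AV F a) :=
  Det.op (fun m => { m with A := X.readFun f (fun i => m.B (Fin.castLE (fun_le_numAcc f) i)) })
    (fun _ _ => Iff.rfl) (fun m hm => ⟨hm, h _ _ hm⟩)
    fun _ hm hl => hl.setA (by rw [h _ _ hm]; exact h')

theorem Det.getRel {k : ℕ} {Q : σ.Relations k} (h' : a ≤ b)
    (h : ∀ B R, F B R → X.readRel Q (fun i => B (Fin.castLE (rel_le_numAcc Q) i)) = a) :
    Det X b (.op (.getRel Q)) 1 (AF F) (AV F a) :=
  Det.op (fun m => { m with A := X.readRel Q (fun i => m.B (Fin.castLE (rel_le_numAcc Q) i)) })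
    (fun _ _ => Iff.rfl) (fun m hm => ⟨hm, h _ _ hm⟩)
    fun _ hm hl => hl.setA (by rw [h _ _ hm]; exact h')

/-- `k`-fold increment of `A`. -/
def Cmd.incrs : ℕ → Cmd σ
  | 0 => .skip
  | k + 1 => .seq (Cmd.incrs k) (.op .incr)

theorem Det.incrs {k : ℕ} (h : a + k ≤ b) : Det X b (.incrs k) k (AV F a) (AV F (a + k)) := by
  induction k with
  | zero => exact Spec.skip fun _ => id
  | succ k ih => exact (ih (by omega)).seq (Det.incr h)

/-- `A := n + k` -/
def Cmd.sizeAdd (k : ℕ) : Cmd σ := .seq (.op .getSize) (.incrs k)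

theorem Det.sizeAdd {k : ℕ} (h : X.card + k ≤ b) :
    Det X b (.sizeAdd k) (1 + k) (AF F) (AV F (X.card + k)) :=
  (Det.getSize (by omega)).seq (Det.incrs h)

/-- Consecutive execution of `c 0, …, c (k - 1)`. -/
def Cmd.seqN (c : ℕ → Cmd σ) : ℕ → Cmd σ
  | 0 => .skip
  | k + 1 => .seq (Cmd.seqN c k) (c k)

theorem Det.seqN {c : ℕ → Cmd σ} {P : ℕ → Regs (numAcc σ) → Prop} (k : ℕ)
    (h : ∀ i < k, Det X b (c i) T (P i) (P (i + 1))) : Det X b (.seqN c k) (k * T) (P 0) (P k) := by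
  induction k with
  | zero => exact Spec.skip fun _ => id
  | succ k ih =>
    rw [Nat.succ_mul]
    exact (ih fun i hi => h i (by omega)).seq (h k (by omega))

theorem Spec.seqN_assert {c : ℕ → Cmd σ} {p : ℕ → Prop} (k : ℕ)
    (h : ∀ i < k, Spec X b (c i) T P (fun _ : p i => P)) :
    Spec X b (.seqN c k) (k * T) P (fun _ : (∀ i < k, p i) => P) := by
  induction k with
  | zero =>
    have h₀ : Det X b .skip 0 P P := Spec.skip fun _ => id
    exact h₀.conseq (fun _ => id) (Nat.zero_le _) (fun _ => ⟨by simp, fun _ => id⟩)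
      fun _ => ⟨(), fun _ => id⟩
  | succ k ih =>
    rw [Nat.succ_mul]
    refine (Spec.seq (ih fun i hi => h i (by omega)) (fun _ => h k (by omega))).conseq
      (fun _ => id) le_rfl (fun a => ⟨fun i hi => ?_, fun _ => id⟩)
      fun a => ⟨⟨fun i hi => a i (by omega), a k (by omega)⟩, fun _ => id⟩
    rcases Nat.lt_succ_iff_lt_or_eq.1 hi with h' | rfl
    · exact a.1 i h'
    · exact a.2

/-- Nondeterministic choice. -/
noncomputable def Cmd.choice (c₁ c₂ : Cmd σ) : Cmd σ :=
  .seq (.op .guess) (.seq (.op (.copy (acc0 σ))) (.seq (.op .setZero) (.ite c₁ c₂)))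

/-- The guess 0 selects the first branch and every other number the second, where 1 suffices to
reach it; hence `1 ≤ b`. Since A and B₁ are overwritten, the precondition may speak only of the main
memory. -/
theorem Spec.choice {α β : Type*} {G : (ℕ → ℕ) → Prop} {Q₁ : α → Regs (numAcc σ) → Prop}
    {Q₂ : β → Regs (numAcc σ) → Prop} (hb : 1 ≤ b)
    (h₁ : Spec X b c₁ T₁ (AF fun _ R => G R) Q₁) (h₂ : Spec X b c₂ T₂ (AF fun _ R => G R) Q₂) :
    Spec X b (.choice c₁ c₂) (T₁ + T₂ + 5) (AF fun _ R => G R) (Sum.elim Q₁ Q₂) := by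
  have key : ∀ g, Spec X b (.seq (.op (.copy (acc0 σ))) (.seq (.op .setZero) (.ite c₁ c₂)))
      (1 + (1 + (T₁ + T₂ + 2))) (AV (fun _ R => G R) g)
      (fun a : {a : α ⊕ β // a.isLeft ↔ g = 0} => Sum.elim Q₁ Q₂ a.1) := by
    intro g
    refine (Det.copy (F' := fun B R => G R ∧ B (acc0 σ) = g) fun B R h => ⟨h, by simp⟩).seq ?_
    refine Det.seq ((Det.setZero (F := fun B R => G R ∧ B (acc0 σ) = g)).pre fun m hm => hm.1) ?_
    refine Spec.ite (p := g = 0) (fun m hm => ?_) (fun h => ?_) fun h => ?_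
    · rw [hm.2, hm.1.2, eq_comm]
    · exact (h₁.pre (fun m hm => hm.1.1)).conseq (fun _ => id) le_rfl
        (fun a => ⟨⟨.inl a, by simp [h]⟩, fun _ => id⟩)
        (fun a => by
          obtain ⟨a | a, ha⟩ := a
          · exact ⟨a, fun _ => id⟩
          · simp [h] at ha)
    · exact (h₂.pre (fun m hm => hm.1.1)).conseq (fun _ => id) le_rfl
        (fun a => ⟨⟨.inr a, by simp [h]⟩, fun _ => id⟩)
        (fun a => by
          obtain ⟨a | a, ha⟩ := a
          · simp [h] at ha
          · exact ⟨a, fun _ => id⟩)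
  intro m hm
  refine ⟨fun k m' he => ?_, fun hl a => ?_⟩
  · cases he with
    | seq e₁ e₂ =>
      cases e₁ with
      | op h _ =>
        obtain ⟨g, rfl⟩ := h
        obtain ⟨a, ha⟩ := (key g { m with A := g } ⟨hm, rfl⟩).1 _ _ e₂
        exact ⟨a.1, ha⟩
  · obtain ⟨g, hg, hg'⟩ : ∃ g ≤ b, (a.isLeft ↔ g = 0) := by
      rcases a with a | a
      · exact ⟨0, by omega, by simp⟩
      · exact ⟨1, hb, by simp⟩
    have hl' : Regs.Le b { m with A := g } := hl.setA hg
    obtain ⟨k, hk, m', he, hq⟩ := (key g { m with A := g } ⟨hm, rfl⟩).2 hl' ⟨a, hg'⟩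
    exact ⟨_, by omega, m', .seq (.op ⟨g, rfl⟩ hl') he, hq⟩

end Spec

end TimeSpace

namespace TimeSpace

/-! ### Variables and records in the main memory -/

section Memory

/-- The contents of the variables and of the fields of the records `0, …, size - 1`. -/
structure VarState where
  num : ℕ → ℕ
  fld : ℕ → ℕ → ℕ
  size : ℕ

def VarState.set (s : VarState) (i a : ℕ) : VarState := { s with num := Function.update s.num i a }

def VarState.setFld (s : VarState) (j p a : ℕ) : VarState :=
  { s with fld := Function.update s.fld j (Function.update (s.fld j) p a) }

/-- Append a record whose fields are `0`. -/
def VarState.push (s : VarState) : VarState :=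
  { s with fld := fun j => Function.update (s.fld j) s.size 0, size := s.size + 1 }

@[simp] theorem VarState.set_num (s : VarState) (i a : ℕ) :
    (s.set i a).num = Function.update s.num i a := rfl

@[simp] theorem VarState.set_fld (s : VarState) (i a : ℕ) : (s.set i a).fld = s.fld := rfl

@[simp] theorem VarState.set_size (s : VarState) (i a : ℕ) : (s.set i a).size = s.size := rfl

@[simp] theorem VarState.setFld_num (s : VarState) (j p a : ℕ) : (s.setFld j p a).num = s.num := rfl

@[simp] theorem VarState.setFld_size (s : VarState) (j p a : ℕ) :
    (s.setFld j p a).size = s.size := rfl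

theorem VarState.setFld_fld (s : VarState) (j p a j' p' : ℕ) :
    (s.setFld j p a).fld j' p' = if j' = j ∧ p' = p then a else s.fld j' p' := by
  simp only [VarState.setFld, Function.update_apply]
  split_ifs <;> simp_all

/-- The address of the record `p`. -/
def recAddr (n V K p : ℕ) : ℕ := n + 1 + V + K * p

/-- The memory layout: the variables `0, …, V - 1` follow after address `n`, then the records with
`K` fields each. The field `0` of a record contains its own address, and no other register in use
does so. The contents of the variables from `k` on are unspecified. -/
structure Rep (n V K k : ℕ) (s : VarState) (R : ℕ → ℕ) : Prop where
  low : ∀ a ≤ n, R a = 0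
  num : ∀ i < k, R (n + 1 + i) = s.num i
  wf : ∀ i < V, R (n + 1 + i) ≤ n ∨ n + 1 + V ≤ R (n + 1 + i)
  self : ∀ p < s.size, R (recAddr n V K p) = recAddr n V K p
  fld : ∀ p < s.size, ∀ j, 1 ≤ j → j < K → R (recAddr n V K p + j) = s.fld j p
  fld_le : ∀ p < s.size, ∀ j, 1 ≤ j → j < K → s.fld j p ≤ n
  high : ∀ a, recAddr n V K s.size ≤ a → R a = 0

variable {n V K k k' : ℕ} {s s' : VarState} {R : ℕ → ℕ}

theorem Rep.mono (h : Rep n V K k s R) (hk : k' ≤ k) : Rep n V K k' s R :=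
  { h with num := fun i hi => h.num i (hi.trans_le hk) }

theorem Rep.congr (h : Rep n V K k s R) (hs : s'.size = s.size) (hf : s'.fld = s.fld)
    (hn : ∀ i < k, s'.num i = s.num i) : Rep n V K k s' R := by
  obtain ⟨a, f, z⟩ := s
  obtain ⟨a', f', z'⟩ := s'
  simp only at hs hf hn
  subst hs hf
  exact { h with num := fun i hi => (h.num i hi).trans (hn i hi).symm }

theorem recAddr_add_lt {p q j : ℕ} (hp : p < q) (hj : j < K) :
    recAddr n V K p + j < recAddr n V K q := by
  have : K * (p + 1) ≤ K * q := Nat.mul_le_mul_left _ hp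
  simp only [recAddr]
  rw [Nat.mul_succ] at this
  omega

theorem recAddr_add_inj {p q i j : ℕ} (hi : i < K) (hj : j < K)
    (h : recAddr n V K p + i = recAddr n V K q + j) : p = q ∧ i = j := by
  rcases lt_trichotomy p q with h' | h' | h'
  · have := recAddr_add_lt (n := n) (V := V) h' hi
    omega
  · subst h'
    omega
  · have := recAddr_add_lt (n := n) (V := V) h' hj
    omega

theorem le_recAddr (p : ℕ) : n + 1 + V ≤ recAddr n V K p := Nat.le_add_right _ _

/-- A write may extend the range of specified variables by one but leave no gap, hence `i ≤ k`. The
values from n + 1 to n + V are excluded because they are addresses of variables, and a variable must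
not contain its own address. -/
theorem Rep.set (h : Rep n V K k s R) {i a : ℕ} (hi : i < V) (hik : i ≤ k)
    (hk' : k' ≤ max k (i + 1)) (ha : a ≤ n ∨ n + 1 + V ≤ a) :
    Rep n V K k' (s.set i a) (Function.update R (n + 1 + i) a) where
  low b hb := by rw [Function.update_of_ne (by omega), h.low b hb]
  num j hj := by
    by_cases hij : j = i
    · subst hij; simp
    · rw [Function.update_of_ne (by omega), h.num j (by omega)]
      simp [Function.update_of_ne hij]
  wf j hj := by
    by_cases hij : j = i
    · subst hij; simpa using ha
    · rw [Function.update_of_ne (by omega)]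
      exact h.wf j hj
  self p hp := by
    have := le_recAddr (n := n) (V := V) (K := K) p
    rw [Function.update_of_ne (by omega), h.self p hp]
  fld p hp j h₁ h₂ := by
    have := le_recAddr (n := n) (V := V) (K := K) p
    rw [Function.update_of_ne (by omega), h.fld p hp j h₁ h₂]
    rfl
  fld_le := h.fld_le
  high b hb := by
    have := le_recAddr (n := n) (V := V) (K := K) (s.set i a).size
    rw [Function.update_of_ne (by omega)]
    exact h.high b hb

theorem Rep.setFld (h : Rep n V K k s R) {j p a : ℕ} (hk : k ≤ V) (hp : p < s.size) (h₁ : 1 ≤ j)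
    (h₂ : j < K) (ha : a ≤ n) :
    Rep n V K k (s.setFld j p a) (Function.update R (recAddr n V K p + j) a) := by
  have hr := le_recAddr (n := n) (V := V) (K := K) p
  refine ⟨fun b hb => ?_, fun i hi => ?_, fun i hi => ?_, fun q hq => ?_, fun q hq i hi₁ hi₂ => ?_,
    fun q hq i hi₁ hi₂ => ?_, fun b hb => ?_⟩
  · rw [Function.update_of_ne (by omega), h.low b hb]
  · rw [Function.update_of_ne (by omega), h.num i hi]
    rfl
  · rw [Function.update_of_ne (by omega)]
    exact h.wf i hi
  · rw [Function.update_of_ne, h.self q hq]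
    intro h'
    have := recAddr_add_inj (i := 0) (by omega) h₂ h'
    omega
  · rw [VarState.setFld_fld]
    split_ifs with h'
    · rw [h'.1, h'.2, Function.update_self]
    · rw [Function.update_of_ne, h.fld q hq i hi₁ hi₂]
      exact fun e => h' (recAddr_add_inj hi₂ h₂ e).symm
  · rw [VarState.setFld_fld]
    split_ifs with h'
    · exact ha
    · exact h.fld_le q hq i hi₁ hi₂
  · have := recAddr_add_lt (n := n) (V := V) hp h₂
    simp only [VarState.setFld_size] at hb
    rw [Function.update_of_ne (by omega), h.high b hb]

/-- Writing the first field is enough: behind the last record the memory is untouched, so the other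
fields of the new record are already 0. -/
theorem Rep.push (h : Rep n V K k s R) (hk : k ≤ V) (hK : 0 < K) :
    Rep n V K k s.push
      (Function.update R (recAddr n V K s.size) (recAddr n V K s.size)) := by
  have hr := le_recAddr (n := n) (V := V) (K := K) s.size
  refine ⟨fun b hb => ?_, fun i hi => ?_, fun i hi => ?_, fun q hq => ?_, fun q hq i hi₁ hi₂ => ?_,
    fun q hq i hi₁ hi₂ => ?_, fun b hb => ?_⟩
  · rw [Function.update_of_ne (by omega), h.low b hb]
  · rw [Function.update_of_ne (by omega), h.num i hi]
    rfl
  · rw [Function.update_of_ne (by omega)]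
    exact h.wf i hi
  · rcases Nat.lt_succ_iff_lt_or_eq.1 hq with hq | rfl
    · have := recAddr_add_lt (n := n) (V := V) hq hK
      rw [Function.update_of_ne (by omega), h.self q hq]
    · rw [Function.update_self]
  · rw [Function.update_of_ne]
    · rcases Nat.lt_succ_iff_lt_or_eq.1 hq with hq | rfl
      · simp [VarState.push, Function.update_of_ne hq.ne, h.fld q hq i hi₁ hi₂]
      · simp [VarState.push, h.high (recAddr n V K s.size + i) (by omega)]
    · intro h'
      have := recAddr_add_inj (j := 0) hi₂ hK h'
      omega
  · rcases Nat.lt_succ_iff_lt_or_eq.1 hq with hq | rfl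
    · simp [VarState.push, Function.update_of_ne hq.ne, h.fld_le q hq i hi₁ hi₂]
    · simp [VarState.push]
  · have : recAddr n V K s.push.size = recAddr n V K s.size + K := by
      simp [recAddr, VarState.push]; ring
    rw [Function.update_of_ne (by omega), h.high b (by omega)]

/-- A nonzero register which contains its own address is the first field of a record. -/
theorem Rep.eq_recAddr (h : Rep n V K k s R) (hK : 0 < K) {q : ℕ} (hq : R q = q) (h0 : q ≠ 0) :
    ∃ p < s.size, q = recAddr n V K p := by
  rcases Nat.lt_or_ge n q with h₁ | h₁
  swap
  · exact absurd (hq.symm.trans (h.low q h₁)) h0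
  rcases Nat.lt_or_ge q (n + 1 + V) with h₂ | h₂
  · obtain ⟨i, rfl⟩ : ∃ i, q = n + 1 + i := ⟨q - (n + 1), by omega⟩
    have := h.wf i (by omega)
    omega
  rcases Nat.lt_or_ge q (recAddr n V K s.size) with h₃ | h₃
  swap
  · exact absurd (hq.symm.trans (h.high q h₃)) h0
  obtain ⟨e, rfl⟩ : ∃ e, q = n + 1 + V + e := ⟨q - (n + 1 + V), by omega⟩
  have he : n + 1 + V + e = recAddr n V K (e / K) + e % K := by
    rw [recAddr, add_assoc (n + 1 + V), Nat.div_add_mod]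
  have hp : e / K < s.size := by
    rw [Nat.div_lt_iff_lt_mul hK, mul_comm]
    simp only [recAddr] at h₃
    omega
  refine ⟨e / K, hp, ?_⟩
  rcases Nat.eq_zero_or_pos (e % K) with h₄ | h₄
  · rw [he, h₄, add_zero]
  -- The fields other than the first hold numbers up to n, whereas `q` lies behind the variables.
  · have h₅ := h.fld _ hp _ h₄ (Nat.mod_lt _ hK)
    have h₆ := h.fld_le _ hp _ h₄ (Nat.mod_lt _ hK)
    rw [← he, hq] at h₅
    omega

end Memory

/-! ### Programs for access to variables and records -/

section Access

variable {σ : FirstOrder.Language.{u, v}} [Finite σ.Symbols]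

/-- `A :=` variable `i` -/
def Cmd.get (i : ℕ) : Cmd σ := .seq (.sizeAdd (1 + i)) (.op .load)

/-- variable `i := A` -/
noncomputable def Cmd.put (i : ℕ) : Cmd σ :=
  .seq (.op (.copy (acc0 σ))) (.seq (.sizeAdd (1 + i)) (.op (.store (acc0 σ))))

/-- `A :=` field `j` of the record to which the variable `i` points -/
def Cmd.getFld (i j : ℕ) : Cmd σ := .seq (.get i) (.seq (.incrs j) (.op .load))

/-- field `j` of the record to which the variable `i` points `:= A` -/
noncomputable def Cmd.putFld (i j : ℕ) : Cmd σ :=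
  .seq (.op (.copy (acc0 σ))) (.seq (.get i) (.seq (.incrs j) (.op (.store (acc0 σ)))))

/-- variable `i :=` a pointer to some record -/
noncomputable def Cmd.anyPtr (i : ℕ) : Cmd σ :=
  .seq (.op .guess) (.seq (.op (.copy (acc0 σ))) (.seq (.op .load)
    (.ite (.seq (.op .setZero) (.ite .fail
      (.seq (.sizeAdd (1 + i)) (.op (.store (acc0 σ)))))) .fail)))

/-- Append a record at the address in the variable `i`. -/
noncomputable def Cmd.newRec (i : ℕ) : Cmd σ :=
  .seq (.get i) (.seq (.op (.copy (acc0 σ))) (.op (.store (acc0 σ))))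

variable {X : FinStr σ} {b T V K k k' : ℕ} {s : VarState}
  {F : (Fin (numAcc σ) → ℕ) → (ℕ → ℕ) → Prop} {a i j p : ℕ}

/-- The assertion that the main memory represents `s`, with the variables below `k`. -/
abbrev RepF (X : FinStr σ) (V K k : ℕ) (s : VarState) :
    (Fin (numAcc σ) → ℕ) → (ℕ → ℕ) → Prop := fun _ R => Rep X.card V K k s R

/-- The numbers up to `b` suffice for all addresses. -/
def Fits (X : FinStr σ) (V K b size : ℕ) : Prop := recAddr X.card V K size + K ≤ b

omit [Finite σ.Symbols] in
theorem Fits.le (h : Fits X V K b i) : X.card + 1 + V ≤ b :=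
  (le_recAddr i).trans ((Nat.le_add_right _ _).trans h)

omit [Finite σ.Symbols] in
theorem Fits.recAddr_le (h : Fits X V K b i) (hp : p ≤ i) (hj : j ≤ K) :
    recAddr X.card V K p + j ≤ b := by
  have : K * p ≤ K * i := Nat.mul_le_mul_left _ hp
  simp only [Fits, recAddr] at *
  omega

theorem Det.get (hb : Fits X V K b s.size) (hF : ∀ B R, F B R → Rep X.card V K k s R) (hi : i < k)
    (hk : k ≤ V) : Det X b (.get i) (1 + (1 + i) + 1) (AF F) (AV F (s.num i)) := by
  have := hb.le
  refine (Det.sizeAdd (by omega)).seq (Det.load fun B R h => ?_)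
  rw [← (hF B R h).num i hi, add_assoc]

theorem Det.put (hb : Fits X V K b s.size) (hF : ∀ B R, F B R → Rep X.card V K k s R) (hi : i < V)
    (hik : i ≤ k) (hk' : k' ≤ max k (i + 1)) (ha : a ≤ X.card ∨ X.card + 1 + V ≤ a) :
    Det X b (.put i) (1 + (1 + (1 + i) + 1)) (AV F a) (AF (RepF X V K k' (s.set i a))) := by
  have := hb.le
  refine (Det.copy (F' := fun B R => Rep X.card V K k s R ∧ B (acc0 σ) = a)
    fun B R h => ⟨hF B R h, by simp⟩).seq ?_
  refine Det.seq (Det.sizeAdd (k := 1 + i) (by omega)).ofAV (Det.store ?_)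
  rintro B R ⟨h, rfl⟩
  rw [← add_assoc]
  exact h.set hi hik hk' ha

/-- `Det.put` for a program that does not overwrite `B₁`. -/
theorem Det.putB (hb : Fits X V K b s.size) (hi : i < V)
    (hik : i ≤ k) (hk' : k' ≤ max k (i + 1)) (ha : a ≤ X.card ∨ X.card + 1 + V ≤ a) :
    Det X b (.seq (.sizeAdd (1 + i)) (.op (.store (acc0 σ)))) (1 + (1 + i) + 1)
      (AF fun B R => Rep X.card V K k s R ∧ B (acc0 σ) = a)
      (AF (RepF X V K k' (s.set i a))) := by
  have := hb.le
  refine (Det.sizeAdd (k := 1 + i) (by omega)).seq (Det.store ?_)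
  rintro B R ⟨h, rfl⟩
  rw [← add_assoc]
  exact h.set hi hik hk' ha

theorem Det.getFld (hb : Fits X V K b s.size) (hF : ∀ B R, F B R → Rep X.card V K k s R)
    (hi : i < k) (hk : k ≤ V) (hp : s.num i = recAddr X.card V K p) (hps : p < s.size) (h₁ : 1 ≤ j)
    (h₂ : j < K) : Det X b (.getFld i j) (1 + (1 + i) + 1 + (j + 1)) (AF F)
      (AV F (s.fld j p)) := by
  refine (Det.get hb hF hi hk).seq ?_
  rw [hp]
  refine (Det.incrs (hb.recAddr_le hps.le h₂.le)).seq (Det.load fun B R h => ?_)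
  exact (hF B R h).fld p hps j h₁ h₂

theorem Det.putFld (hb : Fits X V K b s.size) (hF : ∀ B R, F B R → Rep X.card V K k s R)
    (hi : i < k) (hk : k ≤ V) (hp : s.num i = recAddr X.card V K p) (hps : p < s.size) (h₁ : 1 ≤ j)
    (h₂ : j < K) (ha : a ≤ X.card) :
    Det X b (.putFld i j) (1 + (1 + (1 + i) + 1 + (j + 1))) (AV F a)
      (AF (RepF X V K k (s.setFld j p a))) := by
  refine (Det.copy (F' := fun B R => Rep X.card V K k s R ∧ B (acc0 σ) = a)
    fun B R h => ⟨hF B R h, by simp⟩).seq ?_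
  refine Det.seq (Det.get hb (fun _ _ h => And.left h) hi hk).ofAV ?_
  rw [hp]
  refine (Det.incrs (hb.recAddr_le hps.le h₂.le)).seq (Det.store ?_)
  rintro B R ⟨h, rfl⟩
  exact h.setFld hk hps h₁ h₂ ha

theorem Det.newRec (hb : Fits X V K b s.size) (hK : 0 < K) (hi : i < k) (hk : k ≤ V)
    (hp : s.num i = recAddr X.card V K s.size) :
    Det X b (.newRec i) (1 + (1 + i) + 1 + 2) (AF (RepF X V K k s))
      (AF (RepF X V K k s.push)) := by
  refine (Det.get hb (fun _ _ h => h) hi hk).seq ?_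
  refine (Det.copy (F' := fun B R => Rep X.card V K k s R ∧ B (acc0 σ) = s.num i)
    fun B R h => ⟨h, by simp⟩).seq (Det.store ?_)
  rintro B R ⟨h, h'⟩
  rw [h', hp]
  exact h.push hk hK

/-- The program guesses q and tests R(q) = q and q ≠ 0, which by `Rep.eq_recAddr` leaves exactly the
addresses of records. Any other guess, however large, fails, so the numbers in completed executions
need no separate bound. -/
theorem Spec.anyPtr (hb : Fits X V K b s.size) (hK : 0 < K) (hi : i < V) (hik : i ≤ k)
    (hk' : k' ≤ max k (i + 1)) :
    Spec X b (.anyPtr i) (1 + (1 + i) + 10) (AF (RepF X V K k s)) (fun p : Fin s.size =>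
      AF (RepF X V K k' (s.set i (recAddr X.card V K p)))) := by
  have hput : ∀ p, Det X b (.seq (.op .setZero) (.ite .fail
      (.seq (.sizeAdd (1 + i)) (.op (.store (acc0 σ)))))) (1 + (0 + (1 + (1 + i) + 1) + 2))
      (AF fun B R => Rep X.card V K k s R ∧ B (acc0 σ) = recAddr X.card V K p)
      (AF (RepF X V K k' (s.set i (recAddr X.card V K p)))) := by
    intro p
    refine Det.setZero.seq (Spec.ite (p := False) (fun m hm => ?_) (fun h => h.elim) fun _ => ?_)
    · have h₁ := hm.1.2
      have h₂ := hm.2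
      have := le_recAddr (n := X.card) (V := V) (K := K) p
      simp only [iff_false]
      omega
    · exact (Det.putB hb hi hik hk' (Or.inr (le_recAddr p))).pre fun m hm => hm.1
  intro m hm
  refine ⟨fun t m' he => ?_, fun hl p => ?_⟩
  · cases he with
    | seq e₁ e₂ =>
    cases e₁ with
    | op h₁ _ =>
    obtain ⟨q, rfl⟩ := h₁
    cases e₂ with
    | seq e₁ e₂ =>
    cases e₁ with
    | op h₁ _ =>
    cases h₁
    cases e₂ with
    | seq e₁ e₂ =>
    cases e₁ with
    | op h₁ _ =>
    cases h₁
    cases e₂ with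
    | iteF _ e => nomatch e
    | iteT hq e =>
    simp only [Function.update_self] at hq
    -- The register 0 contains its own address as well; the inner test removes this case.
    have h0 : q ≠ 0 := by
      rintro rfl
      cases e with
      | seq e₁ e₂ =>
      cases e₁ with
      | op h₁ _ =>
      cases h₁
      cases e₂ with
      | iteT _ e => nomatch e
      | iteF h _ => exact h (by simp)
    obtain ⟨p, hp, rfl⟩ := Rep.eq_recAddr hm hK hq h0
    set q := recAddr X.card V K p with hqp
    obtain ⟨-, h⟩ := (hput p ⟨m.R q, Function.update m.B (acc0 σ) q, m.R⟩
      ⟨hm, by simp [hqp]⟩).1 _ _ e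
    exact ⟨⟨p, hp⟩, h⟩
  · set q := recAddr X.card V K p with hq
    have hqb : q ≤ b := hb.recAddr_le (j := 0) p.2.le (Nat.zero_le _)
    have hRq : m.R q = q := Rep.self hm p p.2
    set m₁ : Regs (numAcc σ) := { m with A := q } with hm₁
    set m₂ : Regs (numAcc σ) := { m₁ with B := Function.update m.B (acc0 σ) q } with hm₂
    have l₁ : m₁.Le b := hl.setA hqb
    have l₂ : m₂.Le b := ⟨hqb, fun j => by
        by_cases hj : j = acc0 σ
        · subst hj; simpa [hm₂] using hqb
        · simpa [hm₂, Function.update_of_ne hj] using hl.2.1 j, hl.2.2⟩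
    obtain ⟨t, ht, m', he, h'⟩ := (hput p m₂ ⟨hm, by simp [hm₂, hq]⟩).2 l₂ ()
    refine ⟨_, ?_, m', .seq (.op ⟨q, rfl⟩ l₁) (.seq (.op (m' := m₂) rfl l₂) (.seq (.op (m' := m₂) ?_ l₂)
      (.iteT ?_ he))), h'⟩
    · omega
    · change m₂ = { m₂ with A := m.R q }
      rw [hRq]
    · simp [hm₂, hm₁]

end Access

end TimeSpace

namespace TimeSpace

/-! ### Formulas over tables -/

section Tables

variable {σ : FirstOrder.Language.{u, v}} {G : FirstOrder.Language.{0, 0}} {s r : ℕ}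

/-- Extend a tuple by zeros, or cut it. -/
def padVec {n k : ℕ} (hn : 0 < n) (s : ℕ) (a : Fin k → Fin n) : Fin s → Fin n :=
  fun i => if h : i.1 < k then a ⟨i.1, h⟩ else ⟨0, hn⟩

/-- The number `a` as an element of `[n]`, `0` if it is too large. -/
def toFin {n : ℕ} (hn : 0 < n) (a : ℕ) : Fin n := if h : a < n then ⟨a, h⟩ else ⟨0, hn⟩

/-- For fixed `y`, a table contains for each guessed symbol its values at the tuples that end in
`(y₁, …, y_δ)` or, in the copy `true`, in `succ(y₁, …, y_δ)`. -/
abbrev Table (G : FirstOrder.Language.{0, 0}) (s n : ℕ) :=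
  G.Symbols → Bool → (Fin s → Fin n) → ℕ

/-- The value of a term when the guessed symbols are read from a table. -/
noncomputable def RTerm.valT (X : FinStr σ) (θ : Table G s X.card) (x : Fin s → Fin X.card)
    (y : Fin r → Fin X.card) : RTerm σ G s r → Fin X.card
  | .x i => x i
  | .y j => y j
  | .zero => ⟨0, X.pos⟩
  | .succ t => succFin (t.valT X θ x y)
  | .input f a => X.str.funMap f (fun i => (a i).valT X θ x y)
  | .guessLow (k := k) _ g a =>
      toFin X.pos (θ (Sum.inl ⟨k, g⟩) false (padVec X.pos s fun i => (a i).valT X θ x y))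
  | .guessHigh (δ := δ) _ _ g a next =>
      toFin X.pos (θ (Sum.inl ⟨s + δ, g⟩) next fun i => (a i).valT X θ x y)

/-- The truth of a formula when the guessed symbols are read from a table. -/
noncomputable def RFormula.HoldsT (X : FinStr σ) (θ : Table G s X.card) (x : Fin s → Fin X.card)
    (y : Fin r → Fin X.card) : RFormula σ G s r → Prop
  | .eq t₁ t₂ => t₁.valT X θ x y = t₂.valT X θ x y
  | .input Q a => X.str.RelMap Q (fun i => (a i).valT X θ x y)
  | .guessLow (k := k) _ g a =>
      θ (Sum.inr ⟨k, g⟩) false (padVec X.pos s fun i => (a i).valT X θ x y) ≠ 0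
  | .guessHigh (δ := δ) _ _ g a next =>
      θ (Sum.inr ⟨s + δ, g⟩) next (fun i => (a i).valT X θ x y) ≠ 0
  | .not φ => ¬ φ.HoldsT X θ x y
  | .and φ ψ => φ.HoldsT X θ x y ∧ ψ.HoldsT X θ x y
  | .or φ ψ => φ.HoldsT X θ x y ∨ ψ.HoldsT X θ x y

/-- The arguments of a symbol of arity `k` whose first arguments are `a`. -/
noncomputable def argVec {n k : ℕ} (a : Fin s → Fin n) (y : Fin r → Fin n) (next : Bool)
    (hk : k ≤ s + r) : Fin k → Fin n :=
  fun i => if h : i.1 < s then a ⟨i.1, h⟩ else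
    iterVec (δ := k - s) (by omega) y next ⟨i.1 - s, by omega⟩

open Classical in
/-- The table of an interpretation of the guessed symbols. -/
noncomputable def tableOf {n : ℕ} (hG : ∀ q : G.Symbols, symArity G q ≤ s + r)
    (I : G.Structure (Fin n)) (y : Fin r → Fin n) : Table G s n
  | Sum.inl ⟨_, g⟩, next, a => (I.funMap g (argVec a y next (hG (Sum.inl ⟨_, g⟩)))).val
  | Sum.inr ⟨_, g⟩, next, a => if I.RelMap g (argVec a y next (hG (Sum.inr ⟨_, g⟩))) then 1 else 0

theorem argVec_padVec {n k : ℕ} (hn : 0 < n) (hk : k ≤ s) (hk' : k ≤ s + r) (a : Fin k → Fin n)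
    (y : Fin r → Fin n) (next : Bool) : argVec (padVec hn s a) y next hk' = a := by
  funext i
  simp [argVec, padVec, i.2.trans_le hk]

theorem argVec_append {n δ : ℕ} (hδ : δ ≤ r) (hk' : s + δ ≤ s + r) (a : Fin s → Fin n)
    (y : Fin r → Fin n) (next : Bool) :
    argVec a y next hk' = Fin.append a (iterVec hδ y next) := by
  -- The lengths `s + δ - s` and `δ` of the vectors are equal only propositionally, so the equation
  -- is generalized over the length.
  have key : ∀ δ' (h' : δ' ≤ r) (hd : δ' = δ) (j : ℕ) (hj : j < δ') (hj' : j < δ),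
      iterVec h' y next ⟨j, hj⟩ = iterVec hδ y next ⟨j, hj'⟩ := by
    rintro δ' h' rfl j hj hj'
    rfl
  funext i
  refine Fin.addCases (fun i => ?_) (fun j => ?_) i
  · simp [argVec]
  · simp only [argVec, Fin.val_natAdd, Fin.append_right]
    rw [dif_neg (by omega), key _ _ (by omega) _ _ (by omega)]
    congr 1
    exact Fin.ext (by simp)

theorem toFin_val {n : ℕ} (hn : 0 < n) (a : Fin n) : toFin hn a.val = a := by simp [toFin]

/-- The table for `y` contains every value of a guessed symbol that a restricted term can ask for at
this `y`. -/
theorem RTerm.valT_tableOf (X : FinStr σ) (hG : ∀ q : G.Symbols, symArity G q ≤ s + r)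
    (I : G.Structure (Fin X.card)) (x : Fin s → Fin X.card) (y : Fin r → Fin X.card)
    (t : RTerm σ G s r) : t.valT X (tableOf hG I y) x y = t.val X I x y := by
  induction t with
  | x | y | zero => rfl
  | succ t ih => simp only [valT, val, ih]
  | input f a ih => simp only [valT, val, ih]
  | guessLow hk g a ih =>
    simp only [valT, val, ih, tableOf, toFin_val]
    exact congrArg _ (argVec_padVec X.pos hk _ _ _ _)
  | guessHigh _ hr g a next ih =>
    simp only [valT, val, ih, tableOf, toFin_val]
    exact congrArg _ (argVec_append hr _ _ _ _)

theorem RFormula.holdsT_tableOf (X : FinStr σ) (hG : ∀ q : G.Symbols, symArity G q ≤ s + r)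
    (I : G.Structure (Fin X.card)) (x : Fin s → Fin X.card) (y : Fin r → Fin X.card)
    (φ : RFormula σ G s r) : φ.HoldsT X (tableOf hG I y) x y ↔ φ.Holds X I x y := by
  induction φ with
  | eq | input => simp only [HoldsT, Holds, RTerm.valT_tableOf]
  | guessLow hk g a =>
    simp only [HoldsT, Holds, tableOf, RTerm.valT_tableOf, ne_eq, ite_eq_right_iff, one_ne_zero,
      imp_false, not_not]
    exact iff_of_eq (congrArg _ (argVec_padVec X.pos hk _ _ _ _))
  | guessHigh _ hr g a next =>
    simp only [HoldsT, Holds, tableOf, RTerm.valT_tableOf, ne_eq, ite_eq_right_iff, one_ne_zero,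
      imp_false, not_not]
    exact iff_of_eq (congrArg _ (argVec_append hr _ _ _ _))
  | not φ ih => simp only [HoldsT, Holds, ih]
  | and φ ψ ih₁ ih₂ => simp only [HoldsT, Holds, ih₁, ih₂]
  | or φ ψ ih₁ ih₂ => simp only [HoldsT, Holds, ih₁, ih₂]

end Tables

/-! ### Evaluation of terms and formulas by programs -/

section Eval

variable {σ : FirstOrder.Language.{u, v}} {G : FirstOrder.Language.{0, 0}} {s r : ℕ}

/-- Write `f 0, …, f (m - 1)` into the variables from `k` on. -/
def VarState.setMany (S : VarState) (k m : ℕ) (f : ℕ → ℕ) : VarState :=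
  { S with num := fun j => if k ≤ j ∧ j < k + m then f (j - k) else S.num j }

theorem VarState.setMany_succ (S : VarState) (k m : ℕ) (f : ℕ → ℕ) :
    S.setMany k (m + 1) f = (S.setMany k m f).set (k + m) (f m) := by
  simp only [setMany, set, mk.injEq, and_true]
  funext j
  by_cases hj : j = k + m
  · subst hj; simp
  · rw [Function.update_of_ne hj]
    congr 1
    simp only [eq_iff_iff]
    omega

/-- The table field for a guessed symbol. -/
def tabField (s : ℕ) (ι : G.Symbols → ℕ) (g : G.Symbols) (next : Bool) : ℕ :=
  s + 1 + (2 * ι g + next.toNat)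

/-- The variables and records contain the data for the evaluation of a formula at `(x, y)`: a
pointer to the record of `x`, the components of `y`, in each record the components of its tuple and
the table entries. -/
structure Enc (X : FinStr σ) (V K : ℕ) (ι : G.Symbols → ℕ) (θ : Table G s X.card)
    (x : Fin s → Fin X.card) (y : Fin r → Fin X.card) (S : VarState) : Prop where
  size : S.size = X.card ^ s
  ptr : S.num 0 = recAddr X.card V K (lexNum x)
  y : ∀ j : Fin r, S.num (2 + j) = y j
  dig : ∀ (a : Fin s → Fin X.card) (i : Fin s), S.fld (i + 1) (lexNum a) = a i
  tab : ∀ g next a, S.fld (tabField s ι g next) (lexNum a) = θ g next a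

variable {X : FinStr σ} {V K k : ℕ} {ι : G.Symbols → ℕ} {θ : Table G s X.card}
    {x : Fin s → Fin X.card} {y : Fin r → Fin X.card} {S : VarState}

theorem Enc.congr {S' : VarState} (h : Enc X V K ι θ x y S) (hs : S'.size = S.size)
    (hf : S'.fld = S.fld) (hn : ∀ i < 2 + r, S'.num i = S.num i) : Enc X V K ι θ x y S' where
  size := hs.trans h.size
  ptr := (hn 0 (by omega)).trans h.ptr
  y j := (hn _ (by omega)).trans (h.y j)
  dig a i := by rw [hf, h.dig]
  tab g next a := by rw [hf, h.tab]

theorem Enc.set (h : Enc X V K ι θ x y S) {i a : ℕ} (hi : 2 + r ≤ i) :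
    Enc X V K ι θ x y (S.set i a) :=
  h.congr rfl rfl fun j hj => by rw [VarState.set_num, Function.update_of_ne (by omega)]

theorem Enc.setMany (h : Enc X V K ι θ x y S) {m : ℕ} {f : ℕ → ℕ} (hi : 2 + r ≤ k) :
    Enc X V K ι θ x y (S.setMany k m f) :=
  h.congr rfl rfl fun j hj => by simp only [VarState.setMany]; rw [if_neg (by omega)]

variable [Finite σ.Symbols] {b : ℕ}

/-- `B_{i+1}` -/
noncomputable def accN (σ : FirstOrder.Language.{u, v}) (i : ℕ) : Fin (numAcc σ) :=
  if h : i < numAcc σ then ⟨i, h⟩ else acc0 σ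

/-- Copy the variables `k, …, k + m - 1` to `B₁, …, B_m`. -/
noncomputable def Cmd.loadArgs (k m : ℕ) : Cmd σ :=
  .seqN (fun i => .seq (.get (k + i)) (.op (.copy (accN σ i)))) m

theorem Det.loadArgs {m k' : ℕ} (hb : Fits X V K b S.size) (hm : m ≤ numAcc σ) (hk : k + m ≤ k')
    (hk' : k' ≤ V) : Det X b (.loadArgs k m) (m * (k + m + 4)) (AF (RepF X V K k' S))
      (AF fun B R => Rep X.card V K k' S R ∧ ∀ i < m, B (accN σ i) = S.num (k + i)) := by
  refine (Det.seqN (c := fun i => .seq (.get (k + i)) (.op (.copy (accN σ i))))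
    (P := fun j => AF fun B R => Rep X.card V K k' S R ∧ ∀ i < j, B (accN σ i) = S.num (k + i))
    m fun i hi => ?_).pre fun m hm => ⟨hm, by simp⟩
  refine Spec.mono (T := 1 + (1 + (k + i)) + 1 + 1) ?_ (by omega)
  refine Spec.post (Det.seq (Det.get hb (fun _ _ h => h.1) (by omega) hk')
    (Det.copy (F' := fun B R => Rep X.card V K k' S R ∧ ∀ j < i + 1, B (accN σ j) = S.num (k + j))
      fun B R h => ?_)) fun _ _ h => h.1
  refine ⟨h.1, fun j hj => ?_⟩
  by_cases hij : j = i
  · subst hij; simp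
  · have : accN σ j ≠ accN σ i := by
      simp only [accN]
      rw [dif_pos (by omega), dif_pos (by omega)]
      simpa using hij
    rw [Function.update_of_ne this, h.2 j (by omega)]

/-- `A :=` field `j` of the record whose tuple is given by the variables `k, …, k + s - 1`. -/
noncomputable def Cmd.lookup (s k j : ℕ) : Cmd σ :=
  .seq (.anyPtr (k + s)) (.seq (.seqN (fun i => .seq (.getFld (k + s) (i + 1))
    (.seq (.op (.copy (acc0 σ))) (.seq (.get (k + i)) (.ite .skip .fail)))) s)
    (.getFld (k + s) j))

/-- A record is guessed and its digits are compared with the variables. The digits determine the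
record, so the specification is deterministic in spite of the guess, and the time does not depend on
n. -/
theorem Det.lookup (hb : Fits X V K b S.size) (hk : k + s < V) (hs : s < K)
    (hsize : S.size = X.card ^ s)
    (hdig : ∀ (a : Fin s → Fin X.card) (i : Fin s), S.fld (i + 1) (lexNum a) = a i)
    {a : Fin s → Fin X.card} (ha : ∀ i : Fin s, S.num (k + i) = a i) {j : ℕ} (h₁ : 1 ≤ j)
    (h₂ : j < K) : ∃ q, Det X b (.lookup s k j)
      (1 + (1 + (k + s)) + 10 + (s * (3 * k + 3 * s + 20) + (1 + (1 + (k + s)) + 1 + (j + 1))))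
      (AF (RepF X V K (k + s) S))
      (AV (RepF X V K (k + s + 1) (S.set (k + s) q)) (S.fld j (lexNum a))) := by
  -- The work variable `k + s` keeps the pointer to the record that was found.
  refine ⟨recAddr X.card V K (lexNum a), ?_⟩
  have hchk : ∀ p : Fin S.size, ∀ i < s, Spec X b (.seq (.getFld (k + s) (i + 1))
      (.seq (.op (.copy (acc0 σ))) (.seq (.get (k + i)) (.ite .skip .fail))))
      (3 * k + 3 * s + 20)
      (AF (RepF X V K (k + s + 1) (S.set (k + s) (recAddr X.card V K p))))
      (fun _ : S.fld (i + 1) p = S.num (k + i) =>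
        AF (RepF X V K (k + s + 1) (S.set (k + s) (recAddr X.card V K p)))) := by
    intro p i hi
    have hg := Det.getFld (X := X) (b := b) (V := V) (K := K) (k := k + s + 1) (i := k + s)
      (j := i + 1) (s := S.set (k + s) (recAddr X.card V K p)) (p := p)
      (F := RepF X V K (k + s + 1) (S.set (k + s) (recAddr X.card V K p))) hb
      (fun _ _ h => h) (by omega) (by omega) (by simp) p.2 (by omega) (by omega)
    refine Spec.mono (hg.seq ((Det.copy (F' := fun B R =>
      Rep X.card V K (k + s + 1) (S.set (k + s) (recAddr X.card V K p)) R ∧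
        B (acc0 σ) = S.fld (i + 1) p) fun B R h => ⟨h, by simp⟩).seq (Det.seq
      (Det.get (i := k + i) (k := k + s + 1) (s := S.set (k + s) (recAddr X.card V K p))
        (F := fun B R => Rep X.card V K (k + s + 1) (S.set (k + s) (recAddr X.card V K p)) R ∧
          B (acc0 σ) = S.fld (i + 1) p) hb (fun _ _ h => And.left h) (by omega)
        (by omega)).ofAV ?_))) (T := 1 + (1 + (k + s)) + 1 + (i + 1 + 1) +
          (1 + (1 + (1 + (k + i)) + 1 + 2))) (by omega)
    refine (Spec.assert (p := S.fld (i + 1) p = S.num (k + i)) fun m hm => ?_).post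
      fun _ m h => h.1.1
    rw [hm.2, hm.1.2, VarState.set_num, Function.update_of_ne (by omega), eq_comm]
  refine Spec.conseq (T := 1 + (1 + (k + s)) + 10 +
    (s * (3 * k + 3 * s + 20) + (1 + (1 + (k + s)) + 1 + (j + 1))))
    (Spec.seq (Spec.anyPtr hb (by omega) hk le_rfl (k' := k + s + 1) (by omega)) fun p =>
      (Spec.seq_det (Spec.seqN_assert s (hchk p)) fun _ => Det.getFld (p := p) (k := k + s + 1)
        (s := S.set (k + s) (recAddr X.card V K p)) (i := k + s) hb (fun _ _ h => h)
        (by omega) (by omega) (by simp) p.2 h₁ h₂)) (fun _ => id) le_rfl ?_ ?_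
  · rintro ⟨p, hp⟩
    refine ⟨(), fun m hm => ?_⟩
    obtain ⟨a', ha'⟩ := exists_lexNum_eq (p.2.trans_eq hsize)
    have : a' = a := by
      funext i
      have := hp i i.2
      rw [← ha', hdig, ha] at this
      exact Fin.ext this
    rw [← this, ha']
    exact hm
  · intro _
    refine ⟨⟨⟨lexNum a, hsize ▸ lexNum_lt a⟩, fun i hi => ?_⟩, fun m hm => hm⟩
    rw [hdig a ⟨i, hi⟩, ha ⟨i, hi⟩]

/-- variable `k := 0` -/
noncomputable def Cmd.putZero (k : ℕ) : Cmd σ := .seq (.op .setZero) (.put k)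

/-- variable `k := 1` -/
noncomputable def Cmd.putOne (k : ℕ) : Cmd σ := .seq (.op .setZero) (.seq (.op .incr) (.put k))

theorem Det.putZero {k' : ℕ} (hb : Fits X V K b S.size) {F : (Fin (numAcc σ) → ℕ) → (ℕ → ℕ) → Prop}
    (hF : ∀ B R, F B R → Rep X.card V K k S R) {i : ℕ} (hi : i < V) (hik : i ≤ k)
    (hk' : k' ≤ max k (i + 1)) : Det X b (.putZero i) (1 + (1 + (1 + (1 + i) + 1))) (AF F)
      (AF (RepF X V K k' (S.set i 0))) :=
  Det.setZero.seq (Det.put hb hF hi hik hk' (Or.inl (Nat.zero_le _)))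

theorem Det.putOne {k' : ℕ} (hb : Fits X V K b S.size) {F : (Fin (numAcc σ) → ℕ) → (ℕ → ℕ) → Prop}
    (hF : ∀ B R, F B R → Rep X.card V K k S R) {i : ℕ} (hi : i < V) (hik : i ≤ k)
    (hk' : k' ≤ max k (i + 1)) : Det X b (.putOne i) (1 + (1 + (1 + (1 + (1 + i) + 1)))) (AF F)
      (AF (RepF X V K k' (S.set i 1))) := by
  have := hb.le
  have := X.pos
  exact Det.setZero.seq ((Det.incr (by omega)).seq (Det.put hb hF hi hik hk' (Or.inl (by omega))))

/-- Execute `c₁` if the variable `k` is `0` and `c₂` otherwise. -/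
noncomputable def Cmd.ifZero (k : ℕ) (c₁ c₂ : Cmd σ) : Cmd σ :=
  .seq (.op .setZero) (.seq (.op (.copy (acc0 σ))) (.seq (.get k) (.ite c₁ c₂)))

theorem Spec.ifZero {α : Sort*} {Q : α → Regs (numAcc σ) → Prop} {c₁ c₂ : Cmd σ} {T₁ T₂ k' : ℕ}
    (hb : Fits X V K b S.size) (hk : k < k') (hk' : k' ≤ V)
    (h₁ : S.num k = 0 → Spec X b c₁ T₁ (AF (RepF X V K k' S)) Q)
    (h₂ : S.num k ≠ 0 → Spec X b c₂ T₂ (AF (RepF X V K k' S)) Q) :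
    Spec X b (.ifZero k c₁ c₂) (1 + (1 + (1 + (1 + k) + 1 + (T₁ + T₂ + 2))))
      (AF (RepF X V K k' S)) Q := by
  refine Det.setZero.seq ((Det.copy (F' := fun B R => Rep X.card V K k' S R ∧ B (acc0 σ) = 0)
    fun B R h => ⟨h, by simp⟩).seq (Det.seq (Det.get hb (fun _ _ h => And.left h) hk hk').ofAV ?_))
  refine Spec.ite (p := S.num k = 0) (fun m hm => ?_) (fun h => (h₁ h).pre fun m hm => hm.1.1)
    fun h => (h₂ h).pre fun m hm => hm.1.1
  rw [hm.2, hm.1.2]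

/-- Execute `c₁` if the variable `k` contains the size of the input and `c₂` otherwise. -/
noncomputable def Cmd.ifSize (k : ℕ) (c₁ c₂ : Cmd σ) : Cmd σ :=
  .seq (.op .getSize) (.seq (.op (.copy (acc0 σ))) (.seq (.get k) (.ite c₁ c₂)))

theorem Spec.ifSize {α : Sort*} {Q : α → Regs (numAcc σ) → Prop} {c₁ c₂ : Cmd σ} {T₁ T₂ k' : ℕ}
    (hb : Fits X V K b S.size) (hk : k < k') (hk' : k' ≤ V)
    (h₁ : S.num k = X.card → Spec X b c₁ T₁ (AF (RepF X V K k' S)) Q)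
    (h₂ : S.num k ≠ X.card → Spec X b c₂ T₂ (AF (RepF X V K k' S)) Q) :
    Spec X b (.ifSize k c₁ c₂) (1 + (1 + (1 + (1 + k) + 1 + (T₁ + T₂ + 2))))
      (AF (RepF X V K k' S)) Q := by
  have := hb.le
  refine (Det.getSize (by omega)).seq ((Det.copy
    (F' := fun B R => Rep X.card V K k' S R ∧ B (acc0 σ) = X.card)
    fun B R h => ⟨h, by simp⟩).seq (Det.seq (Det.get hb (fun _ _ h => And.left h) hk hk').ofAV ?_))
  refine Spec.ite (p := S.num k = X.card) (fun m hm => ?_) (fun h => (h₁ h).pre fun m hm => hm.1.1)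
    fun h => (h₂ h).pre fun m hm => hm.1.1
  rw [hm.2, hm.1.2]

/-- The term `t` can be evaluated in constant time, the result being written into the variable
`k`. -/
def TermEval (ι : G.Symbols → ℕ) (K : ℕ) (t : RTerm σ G s r) : Prop :=
  ∀ k, 2 + r ≤ k → ∃ (c : Cmd σ) (w T : ℕ), ∀ (X : FinStr σ) (V b : ℕ) (θ : Table G s X.card)
    (x : Fin s → Fin X.card) (y : Fin r → Fin X.card) (S : VarState), k + w ≤ V →
    Fits X V K b S.size → (∀ g next a, θ g next a ≤ X.card) → Enc X V K ι θ x y S →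
    Det X b c T (AF (RepF X V K k S)) (AF (RepF X V K (k + 1) (S.set k (t.valT X θ x y))))

omit [Finite σ.Symbols] in
theorem RepF.weaken {S' : VarState} {k' : ℕ} {m : Regs (numAcc σ)}
    (h : AF (RepF X V K k S) m) (hk : k' ≤ k) (hs : S'.size = S.size ∧ S'.fld = S.fld)
    (hn : ∀ i < k', S'.num i = S.num i) : AF (RepF X V K k' S') m :=
  (Rep.mono h hk).congr hs.1 hs.2 hn

/-- The values are placed side by side from the variable `k` on; this works because an evaluation
preserves all variables below its target. -/
theorem TermEval.args {K m : ℕ} {a : Fin m → RTerm σ G s r} (h : ∀ i, TermEval ι K (a i)) :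
    ∀ k, 2 + r ≤ k → ∃ (c : Cmd σ) (w T : ℕ), m ≤ w ∧ ∀ (X : FinStr σ) (V b : ℕ)
      (θ : Table G s X.card) (x : Fin s → Fin X.card) (y : Fin r → Fin X.card) (S : VarState),
      k + w ≤ V → Fits X V K b S.size → (∀ g next a, θ g next a ≤ X.card) →
      Enc X V K ι θ x y S →
      ∃ f : ℕ → ℕ, (∀ i : Fin m, f i = (a i).valT X θ x y) ∧
        Det X b c T (AF (RepF X V K k S)) (AF (RepF X V K (k + m) (S.setMany k m f))) := by
  intro k hk
  choose c w T hc using fun i : Fin m => h i (k + i) (by omega)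
  refine ⟨.seqN (fun i => if hi : i < m then c ⟨i, hi⟩ else .skip) m, m + ∑ i, w i,
    m * ∑ i, T i, Nat.le_add_right _ _, fun X V b θ x y S hV hb hθ hS => ?_⟩
  refine ⟨fun i => if hi : i < m then ((a ⟨i, hi⟩).valT X θ x y).val else 0, by simp, ?_⟩
  set f : ℕ → ℕ := fun i => if hi : i < m then ((a ⟨i, hi⟩).valT X θ x y).val else 0 with hf
  have h₀ : ∀ m, AF (RepF X V K k S) m → AF (RepF X V K (k + 0) (S.setMany k 0 f)) m := by
    refine fun m hm => RepF.weaken hm (Nat.le_refl k) ⟨rfl, rfl⟩ fun i hi => ?_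
    simp only [VarState.setMany]
    rw [if_neg (by omega)]
  refine Spec.pre (Det.seqN (P := fun i => AF (RepF X V K (k + i) (S.setMany k i f))) m
    fun i hi => ?_) h₀
  rw [dif_pos hi]
  have hw := Finset.single_le_sum (f := w) (fun _ _ => Nat.zero_le _) (Finset.mem_univ ⟨i, hi⟩)
  have hT := Finset.single_le_sum (f := T) (fun _ _ => Nat.zero_le _) (Finset.mem_univ ⟨i, hi⟩)
  refine Spec.mono ?_ hT
  rw [VarState.setMany_succ, show f i = ((a ⟨i, hi⟩).valT X θ x y).val by simp [hf, hi]]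
  exact hc ⟨i, hi⟩ X V b θ x y _ (by simp only; omega) hb hθ (hS.setMany hk)

end Eval

end TimeSpace

namespace TimeSpace

/-! ### Programs for terms -/

section EvalFormula

variable {σ : FirstOrder.Language.{u, v}} {G : FirstOrder.Language.{0, 0}} {s r : ℕ}
  [Finite σ.Symbols] {ι : G.Symbols → ℕ} {K : ℕ}

omit [Finite σ.Symbols] in
theorem VarState.set_set (S : VarState) (k a a' : ℕ) : (S.set k a).set k a' = S.set k a' := by
  simp [VarState.set]

omit [Finite σ.Symbols] in
theorem succFin_val {n : ℕ} (a : Fin n) :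
    (succFin a).val = if a.val + 1 = n then a.val else a.val + 1 := by
  have := a.2
  unfold succFin
  split_ifs <;> simp_all <;> omega

/-- Evaluation of an entry of a table. -/
theorem TermEval.lookup (hK : ∀ g next, tabField s ι g next < K) {a : Fin s → RTerm σ G s r}
    (ha : ∀ i, TermEval ι K (a i)) (g : G.Symbols) (next : Bool) :
    ∀ k, 2 + r ≤ k → ∃ (c : Cmd σ) (w T : ℕ), ∀ (X : FinStr σ) (V b : ℕ) (θ : Table G s X.card)
      (x : Fin s → Fin X.card) (y : Fin r → Fin X.card) (S : VarState), k + w ≤ V →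
      Fits X V K b S.size → (∀ g next a, θ g next a ≤ X.card) → Enc X V K ι θ x y S →
      Det X b c T (AF (RepF X V K k S))
        (AF (RepF X V K (k + 1) (S.set k (θ g next fun i => (a i).valT X θ x y)))) := by
  intro k hk
  obtain ⟨c, w, T, hmw, hc⟩ := TermEval.args ha k hk
  refine Exists.intro (.seq c (.seq (.lookup s k (tabField s ι g next)) (.put k))) ?_
  refine ⟨w + s + 1, ?_⟩
  apply Exists.intro
  intro X V b θ x y S hV hb hθ hS
  obtain ⟨f, hf, hd⟩ := hc X V b θ x y S (by omega) hb hθ hS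
  have hs : s < K := by
    have := hK g next
    simp only [tabField] at this
    omega
  have hS' := hS.setMany (k := k) (m := s) (f := f) hk
  obtain ⟨q, hl⟩ := Det.lookup (X := X) (b := b) (V := V) (K := K) (k := k) (S := S.setMany k s f)
    (s := s) hb (by omega) hs hS'.size hS'.dig (a := fun i => (a i).valT X θ x y)
    (fun i => by simp [VarState.setMany, hf]) (j := tabField s ι g next)
    (by simp only [tabField]; omega) (hK g next)
  rw [hS'.tab] at hl
  refine Det.seq hd (Det.seq hl ((Det.put (s := (S.setMany k s f).set (k + s) q) (i := k)
    (k := k + s + 1)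
    (k' := k + s + 1) hb (fun _ _ h => h)
    (by omega) (by omega) (by omega) (Or.inl (hθ ..))).post fun _ m hm => ?_))
  refine RepF.weaken hm (by omega) ⟨rfl, rfl⟩ fun i hi => ?_
  by_cases hik : i = k
  · subst hik; simp
  · simp only [VarState.set_num, Function.update_of_ne hik]
    rw [Function.update_of_ne (by omega)]
    simp only [VarState.setMany]
    rw [if_neg (by omega)]

/-- Induction on the term. Input symbols are read by the corresponding instruction, components of x
from the record at the pointer, and guessed functions by a lookup in the table. -/
theorem termEval (hK : ∀ g next, tabField s ι g next < K) (hs : s < K) (t : RTerm σ G s r) :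
    TermEval ι K t := by
  have hzero : TermEval ι K (.zero : RTerm σ G s r) := fun k hk =>
    ⟨.putZero k, 1, _, fun X V b θ x y S hV hb hθ hS =>
      Det.putZero hb (fun _ _ h => h) (by omega) le_rfl (by omega)⟩
  -- Table entries range up to n, and `toFin` maps the value n, which is not in the domain, to 0;
  -- the program imitates this by one test.
  have hclamp : ∀ (g : G.Symbols) (next : Bool) (a : Fin s → RTerm σ G s r),
      (∀ i, TermEval ι K (a i)) → ∀ k, 2 + r ≤ k → ∃ (c : Cmd σ) (w T : ℕ), ∀ (X : FinStr σ)
        (V b : ℕ) (θ : Table G s X.card) (x : Fin s → Fin X.card) (y : Fin r → Fin X.card)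
        (S : VarState), k + w ≤ V → Fits X V K b S.size → (∀ g next a, θ g next a ≤ X.card) →
        Enc X V K ι θ x y S → Det X b c T (AF (RepF X V K k S)) (AF (RepF X V K (k + 1)
          (S.set k (toFin X.pos (θ g next fun i => (a i).valT X θ x y))))) := by
    intro g next a ha k hk
    obtain ⟨c, w, T, hc⟩ := TermEval.lookup hK ha g next k hk
    refine ⟨.seq c (.ifSize k (.putZero k) .skip), w + 1, ?_⟩
    apply Exists.intro
    intro X V b θ x y S hV hb hθ hS
    refine (hc X V b θ x y S (by omega) hb hθ hS).seq (Spec.ifSize (T₁ := 1 + (1 + (1 + (1 + k) + 1))) (T₂ := 0) hb (by omega) (by omega)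
      (fun h => ?_) fun h => Spec.skip fun m hm => ?_)
    · refine (Det.putZero (S := S.set k (θ g next fun i => (a i).valT X θ x y)) (i := k)
        (k := k + 1) (k' := k + 1) hb (fun _ _ h => h) (by omega) (by omega)
        (by omega)).post fun _ m hm => ?_
      simp only [VarState.set_num, Function.update_self] at h
      rw [VarState.set_set] at hm
      simpa [toFin, h] using hm
    · simp only [VarState.set_num, Function.update_self] at h
      have := hθ g next fun i => (a i).valT X θ x y
      rw [toFin, dif_pos (by omega)]
      exact hm
  induction t with
  | x i =>
    intro k hk
    refine ⟨.seq (.getFld 0 (i + 1)) (.put k), 1, ?_⟩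
    apply Exists.intro
    intro X V b θ x y S hV hb hθ hS
    refine Det.seq (T₂ := 1 + (1 + (1 + k) + 1)) (Det.getFld (p := lexNum x) hb (fun _ _ h => h)
        (by omega) (by omega) hS.ptr ?_ (by omega) (by omega)) ?_
    · rw [hS.size]
      exact lexNum_lt x
    · rw [hS.dig]
      exact Det.put hb (fun _ _ h => h) (by omega) le_rfl (by omega) (Or.inl (x i).2.le)
  | y j =>
    intro k hk
    refine ⟨.seq (.get (2 + j)) (.put k), 1, ?_⟩
    apply Exists.intro
    intro X V b θ x y S hV hb hθ hS
    refine Det.seq (T₂ := 1 + (1 + (1 + k) + 1)) (Det.get hb (fun _ _ h => h) (by omega)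
      (by omega)) ?_
    rw [hS.y]
    exact Det.put hb (fun _ _ h => h) (by omega) le_rfl (by omega) (Or.inl (y j).2.le)
  | zero => exact hzero
  | succ t ih =>
    intro k hk
    obtain ⟨c, w, T, hc⟩ := ih k hk
    refine ⟨.seq c (.seq (.op .getSize) (.seq (.op (.copy (acc0 σ))) (.seq (.get k)
      (.seq (.op .incr) (.ite .skip (.put k)))))), w + 1, ?_⟩
    apply Exists.intro
    intro X V b θ x y S hV hb hθ hS
    have hle := hb.le
    set v := t.valT X θ x y with hv
    have hvl := v.2
    refine (hc X V b θ x y S (by omega) hb hθ hS).seq ((Det.getSize (by omega)).seq ((Det.copy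
      (F' := fun B R => Rep X.card V K (k + 1) (S.set k v) R ∧ B (acc0 σ) = X.card)
      fun B R h => ⟨h, by simp⟩).seq (Det.seq (Det.get (i := k) (k := k + 1) (s := S.set k v) hb
        (fun _ _ h => And.left h) (by omega) (by omega)).ofAV (T₂ := 1 + (0 + (1 + (1 + (1 + k) + 1)) + 2)) ?_)))
    simp only [VarState.set_num, Function.update_self]
    refine (Det.incr (by omega)).seq (Spec.ite (p := v.val + 1 = X.card) (T₁ := 0)
      (fun m hm => ?_) (fun h => Spec.skip fun m hm => ?_) fun h => ?_)
    · rw [hm.2, hm.1.2]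
    · have : (RTerm.succ t).valT X θ x y = v := by
        rw [RTerm.valT, ← hv]
        exact Fin.ext (by rw [succFin_val, if_pos h])
      rw [this]
      exact hm.1.1
    · have : ((RTerm.succ t).valT X θ x y).val = v + 1 := by
        rw [RTerm.valT, ← hv, succFin_val, if_neg h]
      rw [this]
      refine (Det.put (s := S.set k v) (k := k + 1) (k' := k + 1) hb (fun _ _ h => And.left h)
        (by omega) (by omega) (by omega) (Or.inl v.2)).post fun _ m hm => ?_
      rwa [VarState.set_set] at hm
  | @input κ f a ih =>
    intro k hk
    obtain ⟨c, w, T, hmw, hc⟩ := TermEval.args ih k hk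
    refine ⟨.seq c (.seq (.loadArgs k κ) (.seq (.op (.getFun f)) (.put k))), w + 1, ?_⟩
    apply Exists.intro
    intro X V b θ x y S hV hb hθ hS
    have hle := hb.le
    obtain ⟨e, he, hd⟩ := hc X V b θ x y S (by omega) hb hθ hS
    have hκ := fun_le_numAcc f
    refine hd.seq ((Det.loadArgs (S := S.setMany k κ e) (k := k) (m := κ) (k' := k + κ) hb hκ le_rfl (by omega)).seq
      ((Det.getFun (a := ((RTerm.input f a).valT X θ x y).val) (by omega) fun B R h => ?_).seq
        ((Det.put (s := S.setMany k κ e) (i := k) (k := k + κ) (k' := k + 1) hb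
          (fun _ _ h => And.left h) (by omega) (by omega) (by omega) (Or.inl (Fin.is_lt _).le)).post
            fun _ m hm => ?_)))
    · have hB : ∀ i : Fin κ, B (Fin.castLE hκ i) = ((a i).valT X θ x y).val := by
        intro i
        have := h.2 i i.2
        rw [accN, dif_pos (i.2.trans_le hκ)] at this
        rw [← he]
        refine this.trans ?_
        simp [VarState.setMany]
      simp only [hB, FinStr.readFun, Fin.is_lt, implies_true, dite_true, RTerm.valT, Fin.eta]
    · refine RepF.weaken hm le_rfl ⟨rfl, rfl⟩ fun i hi => ?_
      by_cases hik : i = k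
      · subst hik; simp
      · simp only [VarState.set_num, Function.update_of_ne hik, VarState.setMany]
        rw [if_neg (by omega)]
  | @guessLow κ hk' g a ih =>
    intro k hk
    -- A symbol of arity at most s is stored at tuples padded by zeros, so its argument list is
    -- filled up with the term 0.
    obtain ⟨c, w, T, hc⟩ := hclamp (Sum.inl ⟨κ, g⟩) false
      (fun i => if h : i.1 < κ then a ⟨i.1, h⟩ else .zero) (fun i => by
        split_ifs
        · exact ih _
        · exact hzero) k hk
    refine ⟨c, w, T, fun X V b θ x y S hV hb hθ hS => (hc X V b θ x y S hV hb hθ hS).post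
      fun _ m hm => ?_⟩
    convert hm using 6
    simp only [RTerm.valT]
    congr 2
    funext i
    simp only [padVec]
    split_ifs <;> rfl
  | guessHigh hδ hr g a next ih =>
    intro k hk
    exact hclamp (Sum.inl ⟨_, g⟩) next a ih k hk

end EvalFormula

end TimeSpace

namespace TimeSpace

/-! ### Programs for quantifier-free formulas -/

section EvalFormula

variable {σ : FirstOrder.Language.{u, v}} {G : FirstOrder.Language.{0, 0}} {s r : ℕ}
  [Finite σ.Symbols] {ι : G.Symbols → ℕ} {K : ℕ}

/-- The truth of `φ` can be determined in constant time, the variable `k` being set to `0` if and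
only if `φ` is false. -/
theorem formulaEval (hK : ∀ g next, tabField s ι g next < K) (hs : s < K) (φ : RFormula σ G s r) :
    ∀ k, 2 + r ≤ k → ∃ (c : Cmd σ) (w T : ℕ), ∀ (X : FinStr σ) (V b : ℕ) (θ : Table G s X.card)
    (x : Fin s → Fin X.card) (y : Fin r → Fin X.card) (S : VarState), k + w ≤ V →
    Fits X V K b S.size → (∀ g next a, θ g next a ≤ X.card) → Enc X V K ι θ x y S →
    ∃ v ≤ X.card, (v ≠ 0 ↔ φ.HoldsT X θ x y) ∧
      Det X b c T (AF (RepF X V K k S)) (AF (RepF X V K (k + 1) (S.set k v))) := by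
  have ht := fun t : RTerm σ G s r => termEval hK hs t
  have hput : ∀ (X : FinStr σ) (V b k : ℕ) (S : VarState) (v v' : ℕ), k < V → Fits X V K b S.size →
      v' ≤ 1 → Det X b (if v' = 0 then .putZero k else .putOne k) (1 + (1 + (1 + (1 + (1 + k) + 1))))
        (AF (RepF X V K (k + 1) (S.set k v))) (AF (RepF X V K (k + 1) (S.set k v'))) := by
    intro X V b k S v v' hk hb hv
    obtain rfl | rfl : v' = 0 ∨ v' = 1 := by omega
    · rw [if_pos rfl]
      have h := Det.putZero (S := S.set k v) (X := X) (b := b) (V := V) (K := K) (k := k + 1)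
        (k' := k + 1) (i := k) (F := RepF X V K (k + 1) (S.set k v)) hb (fun _ _ h => h) hk
        (by omega) (by omega)
      rw [VarState.set_set] at h
      exact h.mono (by omega)
    · rw [if_neg one_ne_zero]
      have h := Det.putOne (S := S.set k v) (X := X) (b := b) (V := V) (K := K) (k := k + 1)
        (k' := k + 1) (i := k) (F := RepF X V K (k + 1) (S.set k v)) hb (fun _ _ h => h) hk
        (by omega) (by omega)
      rw [VarState.set_set] at h
      exact h
  induction φ with
  | eq t₁ t₂ =>
    intro k hk
    obtain ⟨c₁, w₁, T₁, hc₁⟩ := ht t₁ k hk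
    obtain ⟨c₂, w₂, T₂, hc₂⟩ := ht t₂ (k + 1) (by omega)
    refine ⟨.seq c₁ (.seq c₂ (.seq (.get k) (.seq (.op (.copy (acc0 σ))) (.seq (.get (k + 1))
      (.ite (.putOne k) (.putZero k)))))), w₁ + w₂ + 2, ?_⟩
    apply Exists.intro
    intro X V b θ x y S hV hb hθ hS
    have hX := X.pos
    set v₁ := t₁.valT X θ x y with hv₁
    set v₂ := t₂.valT X θ x y with hv₂
    refine ⟨if v₁ = v₂ then 1 else 0, by split_ifs <;> omega, ?_, ?_⟩
    · simp [RFormula.HoldsT, ← hv₁, ← hv₂]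
    have hw : ∀ m : Regs (numAcc σ), ∀ a, AF (RepF X V K (k + 1)
        (((S.set k v₁).set (k + 1) v₂).set k a)) m → AF (RepF X V K (k + 1) (S.set k a)) m := by
      refine fun m a hm => RepF.weaken hm le_rfl ⟨rfl, rfl⟩ fun i hi => ?_
      by_cases hik : i = k
      · subst hik; simp
      · simp only [VarState.set_num, Function.update_of_ne hik]
        rw [Function.update_of_ne (by omega), Function.update_of_ne hik]
    refine (hc₁ X V b θ x y S (by omega) hb hθ hS).seq
      ((hc₂ X V b θ x y (S.set k v₁) (by omega) hb hθ (hS.set hk)).seq (Det.seq (Det.get (i := k)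
        (k := k + 2) (s := (S.set k v₁).set (k + 1) v₂)
        (F := RepF X V K (k + 2) ((S.set k v₁).set (k + 1) v₂)) hb (fun _ _ h => h) (by omega)
        (by omega)) (Det.seq (Det.copy (F' := fun B R => Rep X.card V K (k + 2)
          ((S.set k v₁).set (k + 1) v₂) R ∧ B (acc0 σ) = v₁.val) fun B R h => ⟨h, ?_⟩) (Det.seq
          (Det.get (s := (S.set k v₁).set (k + 1) v₂) (i := k + 1) (k := k + 2) hb
            (fun _ _ h => And.left h) (by omega) (by omega)).ofAV
          (Spec.ite (p := v₁ = v₂) (T₁ := 1 + (1 + (1 + (1 + (1 + k) + 1))))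
            (T₂ := 1 + (1 + (1 + (1 + k) + 1)))
            (fun m hm => ?_) (fun h => ?_) fun h => ?_)))))
    · simp
    · rw [hm.2, hm.1.2]
      simp [Fin.ext_iff, eq_comm]
    · rw [if_pos h]
      exact ((Det.putOne (S := (S.set k v₁).set (k + 1) v₂) (i := k) (k := k + 2) (k' := k + 1) hb
        (fun _ _ h => And.left h) (by omega) (by omega) (by omega)).ofAV).post
          fun _ m hm => hw m _ hm
    · rw [if_neg h]
      exact ((Det.putZero (S := (S.set k v₁).set (k + 1) v₂) (i := k) (k := k + 2) (k' := k + 1) hb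
        (fun _ _ h => And.left h) (by omega) (by omega) (by omega)).ofAV).post
          fun _ m hm => hw m _ hm
  | @input κ Q a =>
    intro k hk
    obtain ⟨c, w, T, hmw, hc⟩ := TermEval.args (fun i => ht (a i)) k hk
    refine ⟨.seq c (.seq (.loadArgs k κ) (.seq (.op (.getRel Q)) (.put k))), w + 1, ?_⟩
    apply Exists.intro
    intro X V b θ x y S hV hb hθ hS
    have hle := hb.le
    have hX := X.pos
    obtain ⟨e, he, hd⟩ := hc X V b θ x y S (by omega) hb hθ hS
    have hκ := rel_le_numAcc Q
    set v := X.readRel Q (fun i => ((a i).valT X θ x y).val) with hv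
    have hv1 : v ≤ 1 := by
      rw [hv, FinStr.readRel]
      split_ifs <;> omega
    refine ⟨v, by omega, ?_, ?_⟩
    · simp [hv, FinStr.readRel, RFormula.HoldsT]
    refine hd.seq ((Det.loadArgs (S := S.setMany k κ e) (k := k) (m := κ) (k' := k + κ) hb hκ le_rfl
      (by omega)).seq ((Det.getRel (a := v) (by omega) fun B R h => ?_).seq
        ((Det.put (s := S.setMany k κ e) (i := k) (k := k + κ) (k' := k + 1) hb
          (fun _ _ h => And.left h) (by omega) (by omega) (by omega) (Or.inl (by omega))).post
            fun _ m hm => ?_)))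
    · have hB : ∀ i : Fin κ, B (Fin.castLE hκ i) = ((a i).valT X θ x y).val := by
        intro i
        have := h.2 i i.2
        rw [accN, dif_pos (i.2.trans_le hκ)] at this
        rw [← he]
        refine this.trans ?_
        simp [VarState.setMany]
      rw [hv]
      congr 1
      funext i
      exact hB i
    · refine RepF.weaken hm le_rfl ⟨rfl, rfl⟩ fun i hi => ?_
      by_cases hik : i = k
      · subst hik; simp
      · simp only [VarState.set_num, Function.update_of_ne hik, VarState.setMany]
        rw [if_neg (by omega)]
  | @guessLow κ hk' g a =>
    intro k hk
    obtain ⟨c, w, T, hc⟩ := TermEval.lookup hK (a := fun i => if h : i.1 < κ then a ⟨i.1, h⟩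
      else .zero) (fun i => ht _) (Sum.inr ⟨κ, g⟩) false k hk
    refine ⟨c, w, T, fun X V b θ x y S hV hb hθ hS => ⟨_, hθ .., ?_,
      hc X V b θ x y S hV hb hθ hS⟩⟩
    simp only [RFormula.HoldsT]
    refine not_congr (Eq.congr_left (congrArg _ (funext fun i => ?_)))
    simp only [padVec]
    split_ifs <;> rfl
  | guessHigh hδ hr g a next =>
    intro k hk
    obtain ⟨c, w, T, hc⟩ := TermEval.lookup hK (fun i => ht (a i)) (Sum.inr ⟨_, g⟩) next k hk
    exact ⟨c, w, T, fun X V b θ x y S hV hb hθ hS => ⟨_, hθ .., Iff.rfl,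
      hc X V b θ x y S hV hb hθ hS⟩⟩
  | not φ ih =>
    intro k hk
    obtain ⟨c, w, T, hc⟩ := ih k hk
    refine ⟨.seq c (.ifZero k (.putOne k) (.putZero k)), w + 1, ?_⟩
    apply Exists.intro
    intro X V b θ x y S hV hb hθ hS
    have hX := X.pos
    obtain ⟨v, hv, hv', hd⟩ := hc X V b θ x y S (by omega) hb hθ hS
    refine ⟨if v = 0 then 1 else 0, by split_ifs <;> omega, ?_, ?_⟩
    · simp [RFormula.HoldsT, ← hv']
    refine hd.seq (Spec.ifZero (k := k) (S := S.set k v) (T₁ := 1 + (1 + (1 + (1 + (1 + k) + 1))))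
      (T₂ := 1 + (1 + (1 + (1 + (1 + k) + 1)))) hb (by omega) (by omega) (fun h => ?_) fun h => ?_)
    · simp only [VarState.set_num, Function.update_self] at h
      rw [if_pos h]
      simpa using hput X V b k S v 1 (by omega) hb le_rfl
    · simp only [VarState.set_num, Function.update_self] at h
      rw [if_neg h]
      simpa using hput X V b k S v 0 (by omega) hb (by omega)
  | and φ ψ ih₁ ih₂ =>
    intro k hk
    obtain ⟨c₁, w₁, T₁, hc₁⟩ := ih₁ k hk
    obtain ⟨c₂, w₂, T₂, hc₂⟩ := ih₂ k hk
    refine ⟨.seq c₁ (.ifZero k .skip c₂), w₁ + w₂ + 1, ?_⟩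
    apply Exists.intro
    intro X V b θ x y S hV hb hθ hS
    obtain ⟨v₁, hv₁, hv₁', hd₁⟩ := hc₁ X V b θ x y S (by omega) hb hθ hS
    obtain ⟨v₂, hv₂, hv₂', hd₂⟩ := hc₂ X V b θ x y (S.set k v₁) (by omega) hb hθ (hS.set hk)
    rw [VarState.set_set] at hd₂
    refine ⟨if v₁ = 0 then v₁ else v₂, by split_ifs <;> omega, ?_, ?_⟩
    · simp only [RFormula.HoldsT, ← hv₁', ← hv₂']
      by_cases h : v₁ = 0 <;> simp [h]
    refine hd₁.seq (Spec.ifZero (k := k) (S := S.set k v₁) (T₁ := 0) (T₂ := T₂)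
      hb (by omega) (by omega) (fun h => ?_) fun h => ?_)
    · simp only [VarState.set_num, Function.update_self] at h
      rw [if_pos h]
      exact Spec.skip fun _ => id
    · simp only [VarState.set_num, Function.update_self] at h
      rw [if_neg h]
      exact hd₂.pre fun m hm => Rep.mono hm (by omega)
  | or φ ψ ih₁ ih₂ =>
    intro k hk
    obtain ⟨c₁, w₁, T₁, hc₁⟩ := ih₁ k hk
    obtain ⟨c₂, w₂, T₂, hc₂⟩ := ih₂ k hk
    refine ⟨.seq c₁ (.ifZero k c₂ .skip), w₁ + w₂ + 1, ?_⟩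
    apply Exists.intro
    intro X V b θ x y S hV hb hθ hS
    obtain ⟨v₁, hv₁, hv₁', hd₁⟩ := hc₁ X V b θ x y S (by omega) hb hθ hS
    obtain ⟨v₂, hv₂, hv₂', hd₂⟩ := hc₂ X V b θ x y (S.set k v₁) (by omega) hb hθ (hS.set hk)
    rw [VarState.set_set] at hd₂
    refine ⟨if v₁ = 0 then v₂ else v₁, by split_ifs <;> omega, ?_, ?_⟩
    · simp only [RFormula.HoldsT, ← hv₁', ← hv₂']
      by_cases h : v₁ = 0 <;> simp [h]
    refine hd₁.seq (Spec.ifZero (k := k) (S := S.set k v₁) (T₁ := T₂) (T₂ := 0)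
      hb (by omega) (by omega) (fun h => ?_) fun h => ?_)
    · simp only [VarState.set_num, Function.update_self] at h
      rw [if_pos h]
      exact hd₂.pre fun m hm => Rep.mono hm (by omega)
    · simp only [VarState.set_num, Function.update_self] at h
      rw [if_neg h]
      exact Spec.skip fun _ => id

end EvalFormula

end TimeSpace

namespace TimeSpace

/-! ### Loops -/

section Loop

variable {σ : FirstOrder.Language.{u, v}} [Finite σ.Symbols] {X : FinStr σ} {b T T₁ T₂ : ℕ}

/-- The effect of `k` complete rounds of a loop, from round `i` on. -/
def LoopRel {Γ : Type*} (ρ₁ ρ₂ : ℕ → Γ → Γ → Prop) : ℕ → ℕ → Γ → Γ → Prop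
  | i, 0, g, g' => ρ₁ i g g'
  | i, k + 1, g, g' => ∃ g₁ g₂, ρ₁ i g g₁ ∧ ρ₂ i g₁ g₂ ∧ LoopRel ρ₁ ρ₂ (i + 1) k g₂ g'

/-- By `ht` the test succeeds in round `M` and in no other, so the number of rounds is the same in
all executions, and guessing affects only the state in `Γ`. -/
theorem Spec.loop {Γ : Type*} {M : ℕ} {pre body : Cmd σ} {Inv Mid : ℕ → Γ → Regs (numAcc σ) → Prop}
    {ρ₁ ρ₂ : ℕ → Γ → Γ → Prop}
    (h₁ : ∀ i ≤ M, ∀ g, Spec X b pre T₁ (Inv i g) (fun g' : {g' // ρ₁ i g g'} => Mid i g'))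
    (ht : ∀ i ≤ M, ∀ g m, Mid i g m → (m.A = m.B (acc0 σ) ↔ i = M))
    (h₂ : ∀ i < M, ∀ g, Spec X b body T₂ (Mid i g) (fun g' : {g' // ρ₂ i g g'} => Inv (i + 1) g'))
    (k i : ℕ) (hk : i + k = M) (g : Γ) :
    Spec X b (.loop pre body) ((k + 1) * (T₁ + T₂ + 2)) (Inv i g)
      (fun g' : {g' // LoopRel ρ₁ ρ₂ i k g g'} => Mid M g') := by
  induction k generalizing i g with
  | zero =>
    obtain rfl : i = M := hk
    refine fun m hm => ⟨fun t m' he => ?_, fun hb ⟨g', hg'⟩ => ?_⟩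
    · cases he with
      | loopDone e _ =>
        obtain ⟨g', hg'⟩ := (h₁ i le_rfl g m hm).1 _ _ e
        exact ⟨g', hg'⟩
      | loopStep e h _ _ =>
        obtain ⟨g', hg'⟩ := (h₁ i le_rfl g m hm).1 _ _ e
        exact (h ((ht i le_rfl _ _ hg').2 rfl)).elim
    · obtain ⟨t, htt, m', he, hq⟩ := (h₁ i le_rfl g m hm).2 hb ⟨g', hg'⟩
      exact ⟨t + 1, by omega, m', .loopDone he ((ht i le_rfl _ _ hq).2 rfl), hq⟩
  | succ k ih =>
    have hi : i < M := by omega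
    refine fun m hm => ⟨fun t m' he => ?_, fun hb ⟨g', g₁, g₂, r₁, r₂, hg'⟩ => ?_⟩
    · cases he with
      | loopDone e h =>
        obtain ⟨g', hg'⟩ := (h₁ i hi.le g m hm).1 _ _ e
        exact absurd ((ht i hi.le _ _ hg').1 h) hi.ne
      | loopStep e₁ h e₂ e₃ =>
        obtain ⟨g₁, hg₁⟩ := (h₁ i hi.le g m hm).1 _ _ e₁
        obtain ⟨g₂, hg₂⟩ := (h₂ i hi g₁ _ hg₁).1 _ _ e₂
        obtain ⟨g₃, hg₃⟩ := (ih (i + 1) (by omega) g₂ _ hg₂).1 _ _ e₃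
        exact ⟨⟨g₃, g₁, g₂, g₁.2, g₂.2, g₃.2⟩, hg₃⟩
    · obtain ⟨t₁, ht₁, m₁, e₁, q₁⟩ := (h₁ i hi.le g m hm).2 hb ⟨g₁, r₁⟩
      have hb₁ := e₁.ok_of_ok hb
      obtain ⟨t₂, ht₂, m₂, e₂, q₂⟩ := (h₂ i hi g₁ _ q₁).2 hb₁ ⟨g₂, r₂⟩
      have hb₂ := e₂.ok_of_ok hb₁
      obtain ⟨t₃, ht₃, m₃, e₃, q₃⟩ := (ih (i + 1) (by omega) g₂ _ q₂).2 hb₂ ⟨g', hg'⟩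
      refine ⟨_, ?_, m₃, .loopStep e₁ (fun h => hi.ne ((ht i hi.le _ _ q₁).1 h)) e₂ e₃, q₃⟩
      rw [Nat.succ_mul]
      omega

/-- The recursion is unrolled into two interleaved sequences: `f j` is the state before and `h j`
the state after the first half of round j. -/
theorem LoopRel.exists_seq {Γ : Type*} {ρ₁ ρ₂ : ℕ → Γ → Γ → Prop} {k : ℕ} :
    ∀ {i : ℕ} {g g' : Γ}, LoopRel ρ₁ ρ₂ i k g g' ↔ ∃ f h : ℕ → Γ, f 0 = g ∧ h k = g' ∧
      (∀ j ≤ k, ρ₁ (i + j) (f j) (h j)) ∧ ∀ j < k, ρ₂ (i + j) (h j) (f (j + 1)) := by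
  induction k with
  | zero =>
    intro i g g'
    refine ⟨fun hr => ⟨fun _ => g, fun _ => g', rfl, rfl, fun j hj => ?_, by simp⟩, ?_⟩
    · obtain rfl : j = 0 := by omega
      exact hr
    · rintro ⟨f, h, rfl, rfl, h₁, -⟩
      exact h₁ 0 le_rfl
  | succ k ih =>
    intro i g g'
    constructor
    · rintro ⟨g₁, g₂, r₁, r₂, hr⟩
      obtain ⟨f, h, rfl, rfl, h₁, h₂⟩ := ih.1 hr
      refine ⟨fun j => Nat.casesOn j g f, fun j => Nat.casesOn j g₁ h, rfl, rfl, ?_, ?_⟩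
      · rintro (_ | j) hj
        · exact r₁
        · have := h₁ j (by omega)
          rwa [add_assoc, add_comm 1 j] at this
      · rintro (_ | j) hj
        · exact r₂
        · have := h₂ j (by omega)
          rwa [add_assoc, add_comm 1 j] at this
    · rintro ⟨f, h, rfl, rfl, h₁, h₂⟩
      refine ⟨h 0, f 1, h₁ 0 (by omega), h₂ 0 (by omega), ih.2 ⟨fun j => f (j + 1),
        fun j => h (j + 1), rfl, rfl, fun j hj => ?_, fun j hj => ?_⟩⟩
      · have := h₁ (j + 1) (by omega)
        rwa [add_comm j 1, ← add_assoc, add_comm 1 j] at this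
      · have := h₂ (j + 1) (by omega)
        rwa [add_comm j 1, ← add_assoc, add_comm 1 j] at this

theorem Spec.exists_pre {α : Sort*} {β : Sort*} {c : Cmd σ} {P : β → Regs (numAcc σ) → Prop}
    {Q : α → Regs (numAcc σ) → Prop} (h : ∀ a, Spec X b c T (P a) Q) :
    Spec X b c T (fun m => ∃ a, P a m) Q := by
  rintro m ⟨a, hm⟩
  exact h a m hm

theorem Spec.pure_pre {α : Sort*} {p : Prop} {c : Cmd σ} {P : Regs (numAcc σ) → Prop}
    {Q : α → Regs (numAcc σ) → Prop} (h : p → Spec X b c T P Q) :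
    Spec X b c T (fun m => p ∧ P m) Q := by
  rintro m ⟨hp, hm⟩
  exact h hp m hm

end Loop

/-! ### Tuples of variables -/

section Tuple

variable {σ : FirstOrder.Language.{u, v}} [Finite σ.Symbols] {X : FinStr σ}
  {b V K k T₁ T₂ : ℕ} {S : VarState}

/-- Execute `c₁` if all variables of the list contain `n - 1`, and `c₂` otherwise. -/
noncomputable def Cmd.ifMax (c₁ c₂ : Cmd σ) : List ℕ → Cmd σ
  | [] => c₁
  | i :: l => .seq (.op .getSize) (.seq (.op (.copy (acc0 σ))) (.seq (.get i) (.seq (.op .incr)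
      (.ite (Cmd.ifMax c₁ c₂ l) c₂))))

/-- A bound for the time of `Cmd.ifMax`. -/
def ifMaxTime (k T₁ T₂ : ℕ) : List ℕ → ℕ
  | [] => T₁
  | _ :: l => ifMaxTime k T₁ T₂ l + T₂ + k + 9

theorem Spec.ifMax {α : Sort*} {Q : α → Regs (numAcc σ) → Prop} {c₁ c₂ : Cmd σ} {l : List ℕ}
    (hb : Fits X V K b S.size) (hk : k ≤ V) (hl : ∀ i ∈ l, i < k ∧ S.num i < X.card)
    (h₁ : (∀ i ∈ l, S.num i = X.card - 1) → Spec X b c₁ T₁ (AF (RepF X V K k S)) Q)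
    (h₂ : ¬(∀ i ∈ l, S.num i = X.card - 1) → Spec X b c₂ T₂ (AF (RepF X V K k S)) Q) :
    Spec X b (.ifMax c₁ c₂ l) (ifMaxTime k T₁ T₂ l) (AF (RepF X V K k S)) Q := by
  induction l with
  | nil => exact h₁ (by simp)
  | cons i l ih =>
    have hle := hb.le
    obtain ⟨hi, hin⟩ := hl i (by simp)
    refine Spec.mono (T := 1 + (1 + (1 + (1 + i) + 1 + (1 + (ifMaxTime k T₁ T₂ l + T₂ + 2))))) ?_
      (by simp only [ifMaxTime]; omega)
    refine (Det.getSize (by omega)).seq ((Det.copy (F' := fun B R => Rep X.card V K k S R ∧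
      B (acc0 σ) = X.card) fun B R h => ⟨h, by simp⟩).seq (Det.seq (Det.get (i := i) (k := k)
        (s := S) hb (fun _ _ h => And.left h) hi hk).ofAV ((Det.incr (by omega)).seq
          (Spec.ite (p := S.num i = X.card - 1) (fun m hm => ?_) (fun h => ?_) fun h => ?_))))
    · rw [hm.2, hm.1.2]
      omega
    · refine (ih (fun j hj => hl j (by simp [hj])) (fun h' => h₁ (by simpa [h] using h'))
        fun h' => h₂ (by simpa [h] using h')).pre fun m hm => hm.1.1
    · exact (h₂ (by simp [h])).pre fun m hm => hm.1.1

/-- Replace the tuple in the variables `i, …, i + δ - 1` by its lexicographic successor. -/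
noncomputable def Cmd.incTuple (i δ : ℕ) : Cmd σ :=
  .seqN (fun j => .ifMax (.seq (.get (i + j)) (.seq (.op .incr) (.seq (.put (i + j))
    (.ifSize (i + j) (.putZero (i + j)) .skip)))) .skip
      ((List.range (δ - (j + 1))).map fun e => i + (j + 1 + e))) δ

theorem forall_mem_map_range_iff {δ j : ℕ} {p : ℕ → Prop} {i : ℕ} :
    (∀ e ∈ (List.range (δ - j)).map (fun e => i + (j + e)), p e) ↔
      ∀ e : Fin δ, j ≤ e → p (i + e) := by
  simp only [List.mem_map, List.mem_range, forall_exists_index, and_imp]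
  constructor
  · intro h e he
    exact h (i + e) (e - j) (by omega) (by omega)
  · rintro h _ e he rfl
    exact h ⟨j + e, by omega⟩ (by simp)

/-- A component changes exactly when all later ones are n - 1. The program works from left to right,
so the later components still have their old values when they are tested. The last tuple must be
excluded because the program would turn it into zeros, while `lexSucc` fixes it. -/
theorem Det.incTuple {i δ : ℕ} (hb : Fits X V K b S.size) (hk : k ≤ V) (hi : i + δ ≤ k)
    {a : Fin δ → Fin X.card} (ha : ∀ j : Fin δ, S.num (i + j) = a j)
    (hlast : ¬ ∀ j, (a j).val = X.card - 1) :
    ∃ f : ℕ → ℕ, (∀ j : Fin δ, f j = lexSucc a j) ∧ Det X b (.incTuple i δ)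
      (δ * (δ * (k + 9) + (5 * k + 40))) (AF (RepF X V K k S))
      (AF (RepF X V K k (S.setMany i δ f))) := by
  set f : ℕ → ℕ := fun j => if h : j < δ then (lexSucc a ⟨j, h⟩).val else 0 with hf
  refine ⟨f, by simp [hf], ?_⟩
  have h₀ : ∀ m, AF (RepF X V K k S) m → AF (RepF X V K k (S.setMany i 0 f)) m := by
    refine fun m hm => RepF.weaken hm le_rfl ⟨rfl, rfl⟩ fun i hi => ?_
    simp only [VarState.setMany]
    rw [if_neg (by omega)]
  have hX := X.pos
  refine Spec.pre (Det.seqN (P := fun j => AF (RepF X V K k (S.setMany i j f))) δ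
    fun j hj => ?_) h₀
  have hnum : ∀ e : Fin δ, j ≤ e → (S.setMany i j f).num (i + e) = a e := by
    intro e he
    simp only [VarState.setMany]
    rw [if_neg (by omega), ha]
  rw [VarState.setMany_succ]
  set S' := S.setMany i j f with hS'
  have hfj : f j = (lexSucc a ⟨j, hj⟩).val := by simp [hf, hj]
  have hcond : (∀ e ∈ (List.range (δ - (j + 1))).map (fun e => i + (j + 1 + e)),
      S'.num e = X.card - 1) ↔ ∀ e : Fin δ, ⟨j, hj⟩ < e → (a e).val = X.card - 1 := by
    rw [forall_mem_map_range_iff]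
    refine forall_congr' fun e => ?_
    rw [Fin.lt_def]
    refine ⟨fun h h' => by rw [← hnum e (le_of_lt h')]; exact h h', fun h h' => by
      rw [hnum e (by omega)]; exact h h'⟩
  have htime : ∀ T l, ifMaxTime k T 0 l = l.length * (k + 9) + T := by
    intro T l
    induction l with
    | nil => simp [ifMaxTime]
    | cons a l ih => rw [ifMaxTime, ih, List.length_cons]; ring
  have haj := (a ⟨j, hj⟩).isLt
  have hnj : S'.num (i + j) = (a ⟨j, hj⟩).val := hnum ⟨j, hj⟩ le_rfl
  refine Spec.mono (Spec.ifMax (T₁ := 5 * k + 40) (T₂ := 0) (S := S') hb hk ?_ (fun h => ?_)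
    fun h => ?_) ?_
  · rw [forall_mem_map_range_iff]
    intro e he
    rw [hnum e (by omega)]
    exact ⟨by omega, (a e).isLt⟩
  · rw [hcond] at h
    have hfj' : f j = if (a ⟨j, hj⟩).val + 1 = X.card then 0 else (a ⟨j, hj⟩).val + 1 := by
      rw [hfj, lexSucc, if_neg hlast, if_pos h]
      by_cases h' : (a ⟨j, hj⟩).val = X.card - 1
      · rw [if_pos h', if_pos (by omega)]
      · rw [if_neg h', if_neg (by omega), succFin_val, if_neg (by omega)]
    have hle := hb.le
    refine Spec.mono (T := 1 + (1 + (i + j)) + 1 + (1 + (1 + (1 + (1 + (i + j)) + 1) +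
      (1 + (1 + (1 + (1 + (i + j)) + 1 + (1 + (1 + (1 + (1 + (i + j)) + 1)) + 0 + 2))))))) ?_
        (by omega)
    refine (Det.get (i := i + j) (k := k) (s := S') (F := RepF X V K k S') hb (fun _ _ h => h)
      (by omega) hk).seq ?_
    rw [hnj]
    refine (Det.incr (by omega)).seq ((Det.put (s := S') (i := i + j) (k := k) (k' := k) hb
      (fun _ _ h => h) (by omega) (by omega) (by omega) (Or.inl haj)).seq
        (Spec.ifSize (T₁ := 1 + (1 + (1 + (1 + (i + j)) + 1))) (T₂ := 0)
          (S := S'.set (i + j) ((a ⟨j, hj⟩).val + 1)) hb (by omega) hk (fun h' => ?_)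
          fun h' => Spec.skip fun m hm => ?_))
    · simp only [VarState.set_num, Function.update_self] at h'
      have := Det.putZero (S := S'.set (i + j) ((a ⟨j, hj⟩).val + 1)) (X := X) (b := b) (V := V)
        (K := K) (k := k) (k' := k) (i := i + j)
        (F := RepF X V K k (S'.set (i + j) ((a ⟨j, hj⟩).val + 1))) hb (fun _ _ h => h) (by omega)
        (by omega) (by omega)
      rw [VarState.set_set] at this
      rw [hfj', if_pos h']
      exact this
    · simp only [VarState.set_num, Function.update_self] at h'
      rw [hfj', if_neg h']
      exact hm
  · rw [hcond] at h
    refine Spec.skip fun m hm => RepF.weaken hm le_rfl ⟨rfl, rfl⟩ fun e he => ?_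
    rw [VarState.set_num]
    by_cases he' : e = i + j
    · subst he'
      rw [Function.update_self, hnj, hfj, lexSucc, if_neg hlast, if_neg h]
    · rw [Function.update_of_ne he']
  · rw [htime, List.length_map, List.length_range]
    have : (δ - (j + 1)) * (k + 9) ≤ δ * (k + 9) := Nat.mul_le_mul_right _ (by omega)
    omega

end Tuple

end TimeSpace

namespace TimeSpace

/-! ### Passes over the table -/

section Relations

variable {σ : FirstOrder.Language.{u, v}} [Finite σ.Symbols] {X : FinStr σ} {b T T₁ T₂ : ℕ}
  {Γ : Type*} {ρ R : ℕ → Γ → Γ → Prop}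

/-- The relation `R i` is the composition of the first i steps in closed form; in the applications
it says that the places with numbers below i have been treated. -/
theorem Spec.seqN_rel {c : ℕ → Cmd σ} {Inv : Γ → Regs (numAcc σ) → Prop} (k : ℕ)
    (hR₀ : ∀ g g', R 0 g g' ↔ g' = g)
    (hR : ∀ i < k, ∀ g g', R (i + 1) g g' ↔ ∃ g₁, R i g g₁ ∧ ρ i g₁ g')
    (h : ∀ i < k, ∀ g, Spec X b (c i) T (Inv g) (fun g' : {g' // ρ i g g'} => Inv g')) (g : Γ) :
    Spec X b (.seqN c k) (k * T) (Inv g) (fun g' : {g' // R k g g'} => Inv g') := by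
  induction k with
  | zero =>
    have h₀ : Det X b .skip 0 (Inv g) (Inv g) := Spec.skip fun _ => id
    refine h₀.conseq (fun _ => id) (Nat.zero_le _) (fun _ => ⟨⟨g, (hR₀ g g).2 rfl⟩, fun _ => id⟩) ?_
    rintro ⟨g', hg'⟩
    obtain rfl := (hR₀ _ _).1 hg'
    exact ⟨(), fun _ => id⟩
  | succ k ih =>
    rw [Nat.succ_mul]
    refine (Spec.seq (ih (fun i hi => hR i (by omega)) fun i hi => h i (by omega))
      (fun g' => h k (by omega) g'.1)).conseq (fun _ => id) le_rfl ?_ ?_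
    · rintro ⟨⟨g₁, h₁⟩, ⟨g₂, h₂⟩⟩
      exact ⟨⟨g₂, (hR k (by omega) _ _).2 ⟨g₁, h₁, h₂⟩⟩, fun _ => id⟩
    · rintro ⟨g₂, h₂⟩
      obtain ⟨g₁, h₁, h₂⟩ := (hR k (by omega) _ _).1 h₂
      exact ⟨⟨⟨g₁, h₁⟩, ⟨g₂, h₂⟩⟩, fun _ => id⟩

theorem exists_seq_iff_rel (k : ℕ) (hR₀ : ∀ g g', R 0 g g' ↔ g' = g)
    (hR : ∀ i < k, ∀ g g', R (i + 1) g g' ↔ ∃ g₁, R i g g₁ ∧ ρ i g₁ g') (g g' : Γ) :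
    (∃ f : ℕ → Γ, f 0 = g ∧ f k = g' ∧ ∀ i < k, ρ i (f i) (f (i + 1))) ↔ R k g g' := by
  induction k generalizing g' with
  | zero =>
    rw [hR₀]
    constructor
    · rintro ⟨f, rfl, rfl, -⟩
      rfl
    · rintro rfl
      exact ⟨fun _ => g', rfl, rfl, by simp⟩
  | succ k ih =>
    rw [hR k (by omega)]
    simp only [← ih fun i hi => hR i (by omega)]
    constructor
    · rintro ⟨f, rfl, rfl, h⟩
      exact ⟨f k, ⟨f, rfl, rfl, fun i hi => h i (by omega)⟩, h k (by omega)⟩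
    · rintro ⟨_, ⟨f, rfl, rfl, h⟩, h'⟩
      refine ⟨fun i => if i ≤ k then f i else g', by simp, by simp, fun i hi => ?_⟩
      rcases Nat.lt_succ_iff_lt_or_eq.1 hi with hi | rfl
      · simp only [if_pos hi.le, if_pos (show i + 1 ≤ k from hi)]
        exact h i hi
      · simpa using h'

theorem Spec.loop_rel {k : ℕ} {pre body : Cmd σ} {Inv Mid : ℕ → Γ → Regs (numAcc σ) → Prop}
    (hR₀ : ∀ g g', R 0 g g' ↔ g' = g)
    (hR : ∀ i < k, ∀ g g', R (i + 1) g g' ↔ ∃ g₁, R i g g₁ ∧ ρ i g₁ g')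
    (h₁ : ∀ i ≤ k, ∀ g, Det X b pre T₁ (Inv i g) (Mid i g))
    (ht : ∀ i ≤ k, ∀ g m, Mid i g m → (m.A = m.B (acc0 σ) ↔ i = k))
    (h₂ : ∀ i < k, ∀ g, Spec X b body T₂ (Mid i g) (fun g' : {g' // ρ i g g'} => Inv (i + 1) g'))
    (g : Γ) :
    Spec X b (.loop pre body) ((k + 1) * (T₁ + T₂ + 2)) (Inv 0 g)
      (fun g' : {g' // R k g g'} => Mid k g') := by
  have key : ∀ g', LoopRel (fun _ g g' => g' = g) ρ 0 k g g' ↔ R k g g' := by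
    intro g'
    rw [LoopRel.exists_seq, ← exists_seq_iff_rel k hR₀ hR]
    constructor
    · rintro ⟨f, h, h0, hk, h₁, h₂⟩
      refine ⟨f, h0, (h₁ k le_rfl).symm.trans hk, fun i hi => ?_⟩
      have := h₂ i hi
      rwa [h₁ i hi.le, zero_add] at this
    · rintro ⟨f, h0, hk, h⟩
      exact ⟨f, f, h0, hk, fun _ _ => rfl, fun i hi => by rw [zero_add]; exact h i hi⟩
  refine (Spec.loop (ρ₁ := fun _ g g' => g' = g) (ρ₂ := ρ) (M := k) (fun i hi g => ?_) ht h₂ k 0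
    (zero_add k) g).conseq (fun _ => id) le_rfl ?_ ?_
  · refine (h₁ i hi g).conseq (fun _ => id) le_rfl (fun _ => ⟨⟨g, rfl⟩, fun _ => id⟩) ?_
    rintro ⟨_, rfl⟩
    exact ⟨(), fun _ => id⟩
  · rintro ⟨g', hg'⟩
    exact ⟨⟨g', (key g').1 hg'⟩, fun _ => id⟩
  · rintro ⟨g', hg'⟩
    exact ⟨⟨g', (key g').2 hg'⟩, fun _ => id⟩

end Relations

/-! ### A pass through all records -/

section Pass

variable {σ : FirstOrder.Language.{u, v}} {G : FirstOrder.Language.{0, 0}} {s r : ℕ}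

/-- The table `θ'` results from `θ` by changes at the places `A` according to `rule`. -/
def ChangedOn {n : ℕ} (rule : G.Symbols → (Bool → ℕ) → (Bool → ℕ) → Prop)
    (A : G.Symbols → (Fin s → Fin n) → Prop) (θ θ' : Table G s n) : Prop :=
  ∀ g a, (A g a → rule g (fun b => θ g b a) (fun b => θ' g b a)) ∧
    (¬A g a → ∀ b, θ' g b a = θ g b a)

/-- Changes at disjoint sets of places are independent: the intermediate table has the new entries
on `A` and the old ones elsewhere. -/
theorem ChangedOn.comp_iff {n : ℕ} {rule : G.Symbols → (Bool → ℕ) → (Bool → ℕ) → Prop}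
    {A B C : G.Symbols → (Fin s → Fin n) → Prop} (hC : ∀ g a, C g a ↔ A g a ∨ B g a)
    (hAB : ∀ g a, A g a → ¬B g a) {θ θ'' : Table G s n} :
    ChangedOn rule C θ θ'' ↔ ∃ θ', ChangedOn rule A θ θ' ∧ ChangedOn rule B θ' θ'' := by
  classical
  constructor
  · intro h
    refine ⟨fun g b a => if A g a then θ'' g b a else θ g b a, fun g a => ⟨fun hA => ?_,
      fun hA b => by simp [hA]⟩, fun g a => ⟨fun hB => ?_, fun hB b => ?_⟩⟩
    · simpa [hA] using (h g a).1 ((hC g a).2 (Or.inl hA))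
    · have hA : ¬A g a := fun hA => hAB g a hA hB
      simpa [hA] using (h g a).1 ((hC g a).2 (Or.inr hB))
    · by_cases hA : A g a
      · simp [hA]
      · simpa [hA] using (h g a).2 (fun h => ((hC g a).1 h).elim hA hB) b
  · rintro ⟨θ', h₁, h₂⟩ g a
    refine ⟨fun h => ?_, fun h b => ?_⟩
    · rcases (hC g a).1 h with hA | hB
      · have := (h₁ g a).1 hA
        have e : (fun b => θ'' g b a) = fun b => θ' g b a :=
          funext fun b => (h₂ g a).2 (hAB g a hA) b
        rwa [e]
      · have := (h₂ g a).1 hB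
        have e : (fun b => θ' g b a) = fun b => θ g b a :=
          funext fun b => (h₁ g a).2 (fun hA => hAB g a hA hB) b
        rwa [← e]
    · rw [hC, not_or] at h
      rw [(h₂ g a).2 h.2, (h₁ g a).2 h.1]

theorem ChangedOn.of_false {n : ℕ} {rule : G.Symbols → (Bool → ℕ) → (Bool → ℕ) → Prop}
    {A : G.Symbols → (Fin s → Fin n) → Prop} (hA : ∀ g a, ¬A g a) (θ θ' : Table G s n) :
    ChangedOn rule A θ θ' ↔ θ' = θ := by
  constructor
  · intro h
    funext g b a
    exact (h g a).2 (hA g a) b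
  · rintro rfl g a
    exact ⟨fun h => (hA g a h).elim, fun _ _ => rfl⟩

/-- The data between the evaluations: a pointer to the record `p`, a pointer to the end of the
records, the components of `y`, and the records. -/
structure Main (X : FinStr σ) (V K : ℕ) (ι : G.Symbols → ℕ) (p : ℕ) (y : Fin r → Fin X.card)
    (θ : Table G s X.card) (S : VarState) : Prop where
  size : S.size = X.card ^ s
  ptr : S.num 0 = recAddr X.card V K p
  fin : S.num 1 = recAddr X.card V K (X.card ^ s)
  y : ∀ j : Fin r, S.num (2 + j) = y j
  dig : ∀ (a : Fin s → Fin X.card) (i : Fin s), S.fld (i + 1) (lexNum a) = a i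
  tab : ∀ g next a, S.fld (tabField s ι g next) (lexNum a) = θ g next a

/-- The main memory contains the data `Main`. -/
def MRep (X : FinStr σ) (V K : ℕ) (ι : G.Symbols → ℕ) (p : ℕ) (y : Fin r → Fin X.card)
    (θ : Table G s X.card) {d : ℕ} (m : Regs d) : Prop :=
  ∃ S, Main X V K ι p y θ S ∧ Rep X.card V K (2 + r) S m.R

variable {X : FinStr σ} {V K p : ℕ} {ι : G.Symbols → ℕ} {y : Fin r → Fin X.card}
  {θ : Table G s X.card} {S : VarState}

theorem Main.enc {x : Fin s → Fin X.card} (h : Main X V K ι (lexNum x) y θ S) :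
    Enc X V K ι θ x y S :=
  ⟨h.size, h.ptr, h.y, h.dig, h.tab⟩

theorem Main.le {k : ℕ} {R : ℕ → ℕ} (h : Main X V K ι p y θ S) (hR : Rep X.card V K k S R)
    (hK : ∀ g next, tabField s ι g next < K) (g : G.Symbols) (next : Bool) (a : Fin s → Fin X.card) :
    θ g next a ≤ X.card := by
  rw [← h.tab]
  exact hR.fld_le _ (h.size ▸ lexNum_lt a) _ (by simp only [tabField]; omega) (hK g next)

theorem Main.setPtr (h : Main X V K ι p y θ S) (q : ℕ) :
    Main X V K ι q y θ (S.set 0 (recAddr X.card V K q)) where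
  size := h.size
  ptr := by simp
  fin := by simpa using h.fin
  y j := by rw [VarState.set_num, Function.update_of_ne (by omega), h.y]
  dig := h.dig
  tab := h.tab

variable [Finite σ.Symbols] {b T : ℕ}

/-- Execute `c` for each record, the variable `0` being a pointer to it. -/
noncomputable def Cmd.forRec (V K : ℕ) (c : Cmd σ) : Cmd σ :=
  .seq (.seq (.sizeAdd (1 + V)) (.put 0))
    (.loop (.seq (.get 1) (.seq (.op (.copy (acc0 σ))) (.get 0)))
      (.seq c (.seq (.get 0) (.seq (.incrs K) (.put 0)))))

/-- The pointer in variable 0 is reset to the first record, whence the arbitrary `p` in the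
precondition. It then advances by the record length until it equals the end pointer in variable 1.
-/
theorem Spec.forRec {c : Cmd σ} {ρ R : ℕ → Table G s X.card → Table G s X.card → Prop}
    (hb : Fits X V K b (X.card ^ s)) (hV : 2 + r ≤ V) (hK : 0 < K)
    (hR₀ : ∀ g g', R 0 g g' ↔ g' = g)
    (hR : ∀ i < X.card ^ s, ∀ g g', R (i + 1) g g' ↔ ∃ g₁, R i g g₁ ∧ ρ i g₁ g')
    (hc : ∀ p < X.card ^ s, ∀ θ, Spec X b c T (MRep X V K ι p y θ)
      (fun θ' : {θ' // ρ p θ θ'} => MRep X V K ι p y θ'.1)) (θ : Table G s X.card) :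
    Spec X b (.forRec V K c) (1 + (1 + V) + 4 + (X.card ^ s + 1) * (T + K + 18))
      (fun m => ∃ p, MRep X V K ι p y θ m)
      (fun θ' : {θ' // R (X.card ^ s) θ θ'} => MRep X V K ι (X.card ^ s) y θ'.1) := by
  have hle := hb.le
  refine Det.seq (Q := MRep X V K ι 0 y θ) ?_ ?_
  · refine Spec.exists_pre fun p => Spec.exists_pre fun S => Spec.pure_pre fun hS => ?_
    have hb' : Fits X V K b S.size := hS.size ▸ hb
    refine Spec.post (Det.seq (Det.sizeAdd (F := RepF X V K (2 + r) S) (k := 1 + V) (by omega))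
      (Det.put (k := 2 + r) (k' := 2 + r) (i := 0) (s := S) hb' (fun _ _ h => h) (by omega)
        (by omega) (by omega) (Or.inr (by omega)))) fun _ m hm => ⟨_, hS.setPtr 0, ?_⟩
    rwa [show recAddr X.card V K 0 = X.card + (1 + V) by simp [recAddr]; ring]
  have h₁ : ∀ (i : ℕ) (θ : Table G s X.card), Det X b (.seq (.get 1) (.seq (.op (.copy (acc0 σ))) (.get 0)))
      (1 + (1 + 1) + 1 + (1 + (1 + (1 + 0) + 1))) (MRep X V K ι i y θ)
      (fun m => MRep X V K ι i y θ m ∧ m.B (acc0 σ) = recAddr X.card V K (X.card ^ s) ∧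
        m.A = recAddr X.card V K i) := by
    refine fun i θ => Spec.exists_pre fun S => Spec.pure_pre fun hS => ?_
    have hb' : Fits X V K b S.size := hS.size ▸ hb
    refine Spec.post ((Det.get (i := 1) (k := 2 + r) (s := S) (F := RepF X V K (2 + r) S) hb'
      (fun _ _ h => h) (by omega) hV).seq ((Det.copy (F' := fun B R =>
        Rep X.card V K (2 + r) S R ∧ B (acc0 σ) = S.num 1) fun B R h => ⟨h, by simp⟩).seq
          (Det.get (i := 0) (k := 2 + r) (s := S) hb' (fun _ _ h => And.left h) (by omega)
            hV).ofAV)) fun _ m hm => ⟨⟨S, hS, hm.1.1⟩, hm.1.2.trans hS.fin, hm.2.trans hS.ptr⟩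
  refine Spec.mono ((Spec.loop_rel (ρ := ρ) (T₂ := T + (1 + (1 + 0) + 1 + (K + 4))) hR₀ hR
    (fun i _ => h₁ i) ?_ ?_ θ).post fun θ' m hm => hm.1) ?_
  · rintro i hi θ m ⟨-, h₁, h₂⟩
    rw [h₁, h₂]
    constructor
    · intro h
      exact (recAddr_add_inj (i := 0) (j := 0) hK hK h).1
    · rintro rfl
      rfl
  · intro i hi θ
    refine Spec.seq_det ((hc i hi θ).pre fun m hm => hm.1) fun θ' => ?_
    refine Spec.exists_pre fun S => Spec.pure_pre fun hS => ?_
    have hb' : Fits X V K b S.size := hS.size ▸ hb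
    have hadd : recAddr X.card V K i + K = recAddr X.card V K (i + 1) := by
      simp only [recAddr]; ring
    have hbi := hb.recAddr_le (p := i) (j := K) hi.le le_rfl
    refine Spec.post (Det.seq (Det.get (i := 0) (k := 2 + r) (s := S) (F := RepF X V K (2 + r) S)
      hb' (fun _ _ h => h) (by omega) hV) (Det.seq (Det.incrs (k := K) (by rw [hS.ptr]; exact hbi))
        (Det.put (k := 2 + r) (k' := 2 + r) (i := 0) hb' (fun _ _ h => h) (by omega) (by omega)
          (by omega) (Or.inr ?_)))) fun _ m hm => ⟨_, hS.setPtr (i + 1), ?_⟩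
    · have := le_recAddr (n := X.card) (V := V) (K := K) i
      rw [hS.ptr]
      omega
    · rw [hS.ptr, hadd] at hm
      exact hm
  · exact Nat.mul_le_mul_left _ (by omega)

end Pass

end TimeSpace

namespace TimeSpace

/-! ### Replacing the entries of one record -/

section Update

variable {σ : FirstOrder.Language.{u, v}} {G : FirstOrder.Language.{0, 0}} {s r : ℕ}
  [Finite σ.Symbols] {X : FinStr σ} {V K k b p : ℕ} {ι : G.Symbols → ℕ} {y : Fin r → Fin X.card}
  {θ : Table G s X.card} {S : VarState}

/-- `A :=` some number up to `n` -/
noncomputable def Cmd.guessVal (k : ℕ) : Cmd σ :=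
  .choice (.seq (.anyPtr k) (.getFld k 1)) (.op .getSize)

/-- There is no instruction comparing numbers by size, so a value below n is obtained as the first
digit of an arbitrary record; here s ≥ 1 is needed. The value n is offered as well because for n = 1
a relation would otherwise have no nonzero entry. -/
theorem Spec.guessVal (hb : Fits X V K b S.size) (hs : 1 ≤ s) (hsize : S.size = X.card ^ s)
    (hdig : ∀ (a : Fin s → Fin X.card) (i : Fin s), S.fld (i + 1) (lexNum a) = a i)
    (hk : k < V) (hK : 1 < K) :
    Spec X b (.guessVal k) (2 * k + 23) (AF (RepF X V K k S))
      (fun v : {v // v ≤ X.card} => AV (RepF X V K k S) v.1) := by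
  have hle := hb.le
  have h₁ : Spec X b (.seq (.anyPtr k) (.getFld k 1)) (1 + (1 + k) + 10 + (1 + (1 + k) + 1 + 2))
      (AF fun _ R => Rep X.card V K k S R)
      (fun p : Fin S.size => AV (RepF X V K k S) (S.fld 1 p)) := by
    refine Spec.seq_det (Spec.anyPtr (s := S) (k := k) (k' := k + 1) hb (by omega) hk le_rfl
      (by omega)) fun p => ?_
    refine Spec.post (Det.getFld (k := k + 1) (i := k) (j := 1) (p := p)
      (s := S.set k (recAddr X.card V K p))
      (F := RepF X V K (k + 1) (S.set k (recAddr X.card V K p))) hb (fun _ _ h => h) (by omega)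
      (by omega) (by simp) p.2 le_rfl hK) fun _ m hm => ⟨?_, hm.2⟩
    refine RepF.weaken hm.1 (Nat.le_succ k) ⟨rfl, rfl⟩ fun i hi => ?_
    rw [VarState.set_num, Function.update_of_ne (by omega)]
  refine (Spec.choice (by omega) h₁ (Det.getSize (F := RepF X V K k S) (by omega))).conseq
    (fun _ => id) (by omega) ?_ ?_
  · rintro (p | _)
    · obtain ⟨a, ha⟩ := exists_lexNum_eq (p.2.trans_eq hsize)
      have := hdig a ⟨0, hs⟩
      rw [ha] at this
      exact ⟨⟨S.fld 1 p, by rw [show (1 : ℕ) = 0 + 1 from rfl, this]; exact (a _).2.le⟩,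
        fun _ => id⟩
    · exact ⟨⟨X.card, le_rfl⟩, fun _ => id⟩
  · rintro ⟨v, hv⟩
    rcases hv.lt_or_eq with hv | rfl
    · refine ⟨.inl ⟨lexNum fun _ : Fin s => (⟨v, hv⟩ : Fin X.card), hsize ▸ lexNum_lt _⟩,
        fun m hm => ?_⟩
      have := hdig (fun _ => ⟨v, hv⟩) ⟨0, hs⟩
      simp only [zero_add] at this
      simp only [Sum.elim_inl, this] at hm
      exact hm
    · exact ⟨.inr (), fun _ => id⟩

/-- The entries for `succ(y)` become those for `y`, and are replaced by arbitrary ones. -/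
def shiftRule (n : ℕ) (cond : G.Symbols → Prop) (g : G.Symbols) (e e' : Bool → ℕ) : Prop :=
  (cond g → e' false = e true ∧ e' true ≤ n) ∧ (¬cond g → e' = e)

open Classical in
omit [Finite σ.Symbols] in
theorem Main.setFld {q : ℕ} (hι : Function.Injective ι) (h : Main X V K ι p y θ S) (g : G.Symbols)
    (next : Bool) (v : ℕ) :
    Main X V K ι p y (fun g' next' a => if g' = g ∧ next' = next ∧ lexNum a = q then v else
      θ g' next' a) (S.setFld (tabField s ι g next) q v) where
  size := h.size
  ptr := h.ptr
  fin := h.fin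
  y := h.y
  dig a i := by
    rw [VarState.setFld_fld, if_neg, h.dig]
    simp only [tabField]
    omega
  tab g' next' a := by
    rw [VarState.setFld_fld, h.tab]
    congr 1
    rw [← and_assoc]
    congr 1
    simp only [tabField, eq_iff_iff]
    constructor
    · intro h
      have : ι g' = ι g ∧ next' = next := by cases next <;> cases next' <;> simp at h ⊢ <;> omega
      exact ⟨hι this.1, this.2⟩
    · rintro ⟨rfl, rfl⟩
      rfl

/-- Apply `shiftRule` to the record at the pointer in the variable `0`. -/
noncomputable def Cmd.shift (k f₀ f₁ : ℕ) (l : List ℕ) : Cmd σ :=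
  .ifMax (.seq (.getFld 0 f₁) (.seq (.putFld 0 f₀) (.seq (.guessVal k) (.putFld 0 f₁)))) .skip l

/-- In the applications `l g` is either empty, for an unconditional shift, or consists of the places
behind the prefix on which `g` depends; that prefix changes exactly when all of them are n - 1. -/
theorem Spec.shift (hι : Function.Injective ι) (hb : Fits X V K b (X.card ^ s)) (hs : 1 ≤ s)
    (hK : ∀ g next, tabField s ι g next < K) (hV : 2 + r < V) (hp : p < X.card ^ s)
    (l : G.Symbols → List (Fin r)) (g : G.Symbols) :
    Spec X b (.shift (2 + r) (tabField s ι g false) (tabField s ι g true)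
        ((l g).map fun j => 2 + j.1))
      (ifMaxTime (2 + r) (2 * r + 3 * K + 100) 0 ((l g).map fun j => 2 + j.1))
      (MRep X V K ι p y θ)
      (fun θ' : {θ' // ChangedOn (shiftRule X.card fun g => ∀ j ∈ l g, (y j).val = X.card - 1)
        (fun g' a => g' = g ∧ lexNum a = p) θ θ'} => MRep X V K ι p y θ'.1) := by
  classical
  refine Spec.exists_pre fun S => Spec.pure_pre fun hS => ?_
  have hb' : Fits X V K b S.size := hS.size ▸ hb
  have hle := hb.le
  have hX := X.pos
  have hK₀ := hK g false
  have hK₁ := hK g true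
  have htf : ∀ next, 2 ≤ tabField s ι g next := fun next => by simp only [tabField]; omega
  obtain ⟨a₀, rfl⟩ := exists_lexNum_eq hp
  have hcond : (∀ i ∈ (l g).map (fun j => 2 + j.1), S.num i = X.card - 1) ↔
      ∀ j ∈ l g, (y j).val = X.card - 1 := by
    simp only [List.mem_map, forall_exists_index, and_imp, forall_apply_eq_imp_iff₂, hS.y]
  refine Spec.ifMax (S := S) hb' hV.le ?_ (fun h => ?_) fun h => ?_
  · simp only [List.mem_map, forall_exists_index, and_imp, forall_apply_eq_imp_iff₂, hS.y]
    exact fun j _ => ⟨by omega, (y j).2⟩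
  · rw [hcond] at h
    set v₀ := S.fld (tabField s ι g true) (lexNum a₀) with hv₀
    set S₀ := S.setFld (tabField s ι g false) (lexNum a₀) v₀ with hS₀
    have hpS : lexNum a₀ < S.size := hS.size ▸ hp
    have hM₀ := hS.setFld (q := lexNum a₀) hι g false v₀
    have hv : ∀ m : Regs (numAcc σ), AF (RepF X V K (2 + r) S) m → v₀ ≤ X.card := by
      intro m hm
      rw [hv₀, hS.tab]
      exact hS.le hm hK g true a₀
    intro m hm
    have hvm := hv m hm
    refine Spec.conseq (T := 1 + (1 + 0) + 1 + (tabField s ι g true + 1) +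
      (1 + (1 + (1 + 0) + 1 + (tabField s ι g false + 1)) +
      (2 * (2 + r) + 23 + (1 + (1 + (1 + 0) + 1 + (tabField s ι g true + 1)))))) (Det.seq
      (Det.getFld (k := 2 + r) (i := 0) (j := tabField s ι g true) (p := lexNum a₀)
      (s := S) (F := RepF X V K (2 + r) S) hb' (fun _ _ h => h) (by omega) (by omega) hS.ptr hpS
      (by have := htf true; omega) hK₁) (Det.seq (Det.putFld (k := 2 + r) (i := 0)
      (j := tabField s ι g false) (p := lexNum a₀) (s := S) hb' (fun _ _ h => h) (by omega)
      (by omega) hS.ptr hpS (by have := htf false; omega) hK₀ hvm)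
      (Spec.seq_det (Spec.guessVal (k := 2 + r) (s := s) (S := S₀) hb' hs hS.size hM₀.dig hV
        (by have := htf true; omega)) fun v => Det.putFld (k := 2 + r) (i := 0)
      (j := tabField s ι g true) (p := lexNum a₀) (s := S₀) hb' (fun _ _ h => h) (by omega)
      (by omega) hS.ptr hpS (by have := htf true; omega) hK₁ v.2))) (fun _ => id) (by omega)
      ?_ ?_ m hm
    · rintro ⟨v, hvn⟩
      set θ' : Table G s X.card := fun g' next' a =>
        if g' = g ∧ next' = true ∧ lexNum a = lexNum a₀ then v else
          if g' = g ∧ next' = false ∧ lexNum a = lexNum a₀ then v₀ else θ g' next' a with hθ'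
      refine ⟨⟨θ', fun g' a => ⟨?_, fun h' next => ?_⟩⟩,
        fun m hm => ⟨_, hM₀.setFld (q := lexNum a₀) hι g true v, hm⟩⟩
      · rintro ⟨rfl, ha⟩
        obtain rfl := lexNum_injective ha
        refine ⟨fun _ => ?_, fun h' => (h' h).elim⟩
        simpa [hθ', hv₀, hS.tab] using hvn
      · simp only [hθ']
        rw [if_neg (fun e => h' ⟨e.1, e.2.2⟩), if_neg (fun e => h' ⟨e.1, e.2.2⟩)]
    · rintro ⟨θ', hθ'⟩
      have h₁ := ((hθ' g a₀).1 ⟨rfl, rfl⟩).1 h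
      refine ⟨⟨θ' g true a₀, h₁.2⟩, fun m hm => ⟨_, ?_, hm⟩⟩
      convert hM₀.setFld (q := lexNum a₀) hι g true (θ' g true a₀) using 1
      funext g' next a
      by_cases h' : g' = g ∧ lexNum a = lexNum a₀
      · obtain ⟨rfl, ha⟩ := h'
        obtain rfl := lexNum_injective ha
        cases next
        · simpa [hv₀, hS.tab] using h₁.1
        · simp
      · rw [if_neg (fun e => h' ⟨e.1, e.2.2⟩), if_neg (fun e => h' ⟨e.1, e.2.2⟩)]
        exact (hθ' g' a).2 h' next
  · rw [hcond] at h
    refine Spec.conseq (P := AF (RepF X V K (2 + r) S)) (T := 0) (α := Unit)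
      (Q := fun _ m => MRep X V K ι (lexNum a₀) y θ m)
      (Spec.skip fun m hm => ⟨S, hS, hm⟩) (fun _ => id) le_rfl ?_ ?_
    · refine fun _ => ⟨⟨θ, fun g' a => ⟨?_, fun _ _ => rfl⟩⟩, fun _ => id⟩
      rintro ⟨rfl, -⟩
      exact ⟨fun h' => (h h').elim, fun _ => rfl⟩
    · rintro ⟨θ', hθ'⟩
      refine ⟨(), fun m hm => ?_⟩
      convert hm using 1
      funext g' next a
      by_cases h' : g' = g ∧ lexNum a = lexNum a₀
      · have := ((hθ' g' a).1 h').2 (by rw [h'.1]; exact h)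
        exact congrFun this next
      · exact (hθ' g' a).2 h' next

end Update

end TimeSpace

namespace TimeSpace

/-! ### Passes that shift the table or check a formula -/

section Passes

variable {σ : FirstOrder.Language.{u, v}} {G : FirstOrder.Language.{0, 0}} {s r : ℕ}
  [Finite σ.Symbols] {X : FinStr σ} {V K b p μ : ℕ} {y : Fin r → Fin X.card}
  {θ : Table G s X.card} {S : VarState}

/-- The number of a symbol in an enumeration. -/
def symIdx (e : Fin μ ≃ G.Symbols) (g : G.Symbols) : ℕ := (e.symm g).val

theorem symIdx_injective (e : Fin μ ≃ G.Symbols) : Function.Injective (symIdx e) :=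
  fun _ _ h => e.symm.injective (Fin.ext h)

theorem symIdx_apply (e : Fin μ ≃ G.Symbols) (i : Fin μ) : symIdx e (e i) = i := by simp [symIdx]

/-- The number of fields of a record. -/
def recSize (s μ : ℕ) : ℕ := s + 1 + 2 * μ

theorem tabField_lt (e : Fin μ ≃ G.Symbols) (g : G.Symbols) (next : Bool) :
    tabField s (symIdx e) g next < recSize s μ := by
  have : symIdx e g < μ := (e.symm g).2
  simp only [tabField, recSize]
  cases next <;> simp <;> omega

theorem pass_time_le (N A B : ℕ) : A + (N + 1) * B ≤ (N + 2) * (A + B) := by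
  nlinarith [Nat.zero_le (N * A)]

/-- Apply `shiftRule` to all table entries. -/
noncomputable def Cmd.shiftAll (s r V : ℕ) (e : Fin μ ≃ G.Symbols) (l : G.Symbols → List (Fin r)) :
    Cmd σ :=
  .forRec V (recSize s μ) (.seqN (fun i => if h : i < μ then
    .shift (2 + r) (tabField s (symIdx e) (e ⟨i, h⟩) false) (tabField s (symIdx e) (e ⟨i, h⟩) true)
      ((l (e ⟨i, h⟩)).map fun j => 2 + j.1) else .skip) μ)

/-- The symbols are treated one after another within a record, and the records one after another;
both are compositions over disjoint places, as in `ChangedOn.comp_iff`. -/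
theorem Spec.shiftAll (hs : 1 ≤ s) (V : ℕ) (hV : 2 + r < V) (e : Fin μ ≃ G.Symbols)
    (l : G.Symbols → List (Fin r)) :
    ∃ T, ∀ (X : FinStr σ) (b : ℕ) (y : Fin r → Fin X.card) (θ : Table G s X.card),
      Fits X V (recSize s μ) b (X.card ^ s) →
      Spec X b (.shiftAll s r V e l) ((X.card ^ s + 2) * T)
        (fun m => ∃ p, MRep X V (recSize s μ) (symIdx e) p y θ m)
        (fun θ' : {θ' // ChangedOn (shiftRule X.card fun g => ∀ j ∈ l g, (y j).val = X.card - 1)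
          (fun _ _ => True) θ θ'} => MRep X V (recSize s μ) (symIdx e) (X.card ^ s) y θ'.1) := by
  set T₀ : ℕ → ℕ := fun i => if h : i < μ then
    ifMaxTime (2 + r) (2 * r + 3 * recSize s μ + 100) 0 ((l (e ⟨i, h⟩)).map fun j => 2 + j.1) else 0
    with hT₀
  set T₁ := ∑ i ∈ Finset.range μ, T₀ i with hT₁
  refine ⟨1 + (1 + V) + 4 + (μ * T₁ + recSize s μ + 18), fun X b y θ hb => ?_⟩
  set rule := shiftRule (G := G) X.card fun g => ∀ j ∈ l g, (y j).val = X.card - 1 with hrule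
  have key := Spec.forRec (ι := symIdx e) (y := y) (T := μ * T₁)
    (c := .seqN (fun i => if h : i < μ then
    .shift (2 + r) (tabField s (symIdx e) (e ⟨i, h⟩) false) (tabField s (symIdx e) (e ⟨i, h⟩) true)
      ((l (e ⟨i, h⟩)).map fun j => 2 + j.1) else .skip) μ)
    (ρ := fun p => ChangedOn rule fun _ a => lexNum a = p)
    (R := fun p => ChangedOn rule fun _ a => lexNum a < p) hb hV.le (by simp [recSize])
    (fun g g' => ChangedOn.of_false (by simp) _ _) (fun i _ g g' =>
      ChangedOn.comp_iff (fun g a => by omega) fun g a => by omega) (fun p hp θ => ?_) θ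
  · refine key.conseq (fun _ => id) ?_ ?_ ?_
    · exact pass_time_le _ _ _
    · rintro ⟨θ', h⟩
      refine ⟨⟨θ', fun g a => ⟨fun _ => (h g a).1 (lexNum_lt a), by simp⟩⟩, fun _ => id⟩
    · rintro ⟨θ', h⟩
      exact ⟨⟨θ', fun g a => ⟨fun _ => (h g a).1 trivial, fun h' => (h' (lexNum_lt a)).elim⟩⟩,
        fun _ => id⟩
  · refine (Spec.seqN_rel (Γ := Table G s X.card) (T := T₁)
      (Inv := fun θ => MRep X V (recSize s μ) (symIdx e) p y θ)
      (ρ := fun i => ChangedOn rule fun g a => symIdx e g = i ∧ lexNum a = p)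
      (R := fun i => ChangedOn rule fun g a => symIdx e g < i ∧ lexNum a = p) μ
      (fun g g' => ChangedOn.of_false (by simp) _ _) (fun i _ g g' =>
        ChangedOn.comp_iff (fun g a => by omega) fun g a => by omega) (fun i hi θ => ?_) θ).conseq
      (fun _ => id) le_rfl ?_ ?_
    · rw [dif_pos hi]
      refine (Spec.shift (symIdx_injective e) hb hs (tabField_lt e) hV hp l (e ⟨i, hi⟩)).conseq
        (fun _ => id) ?_ ?_ ?_
      · have := Finset.single_le_sum (f := T₀) (fun _ _ => Nat.zero_le _) (Finset.mem_range.2 hi)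
        simpa only [hT₀, dif_pos hi] using this
      all_goals
        rintro ⟨θ', h⟩
        refine ⟨⟨θ', ?_⟩, fun _ => id⟩
        convert h using 4
        rw [← (symIdx_injective e).eq_iff, symIdx_apply]
    all_goals
      rintro ⟨θ', h⟩
      refine ⟨⟨θ', ?_⟩, fun _ => id⟩
      convert h using 3
      have : ∀ g, symIdx e g < μ := fun g => (e.symm g).2
      simp [this]

/-- Evaluate a formula at all tuples, for fixed `y`. -/
theorem Spec.checkAll (V₀ : ℕ) (e : Fin μ ≃ G.Symbols) (φ : RFormula σ G s r) :
    ∃ V ≥ V₀, ∀ V' ≥ V, ∃ (c : Cmd σ) (T : ℕ), ∀ (X : FinStr σ) (b : ℕ) (y : Fin r → Fin X.card)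
      (θ : Table G s X.card), Fits X V' (recSize s μ) b (X.card ^ s) →
      Spec X b c ((X.card ^ s + 2) * T)
        (fun m => ∃ p, MRep X V' (recSize s μ) (symIdx e) p y θ m)
        (fun _ : (∀ x, φ.HoldsT X θ x y) =>
          MRep X V' (recSize s μ) (symIdx e) (X.card ^ s) y θ) := by
  obtain ⟨c, w, T₀, hc⟩ := formulaEval (G := G) (ι := symIdx e) (K := recSize s μ)
    (tabField_lt e) (by simp only [recSize]; omega) φ (2 + r) le_rfl
  refine ⟨max V₀ (2 + r + w + 1), le_max_left _ _, fun V hV => ?_⟩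
  have hV₁ : 2 + r + w + 1 ≤ V := (le_max_right _ _).trans hV
  set T₁ := T₀ + (1 + (1 + (1 + (1 + (2 + r)) + 1 + (0 + 0 + 2)))) with hT₁
  refine ⟨.forRec V (recSize s μ) (.seq c (.ifZero (2 + r) .fail .skip)),
    1 + (1 + V) + 4 + (T₁ + recSize s μ + 18), fun X b y θ hb => ?_⟩
  have key := Spec.forRec (ι := symIdx e) (y := y) (T := T₁) (V := V) (K := recSize s μ)
    (c := .seq c (.ifZero (2 + r) .fail .skip))
    (ρ := fun p (θ θ' : Table G s X.card) => θ' = θ ∧ ∀ x, lexNum x = p → φ.HoldsT X θ x y)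
    (R := fun p (θ θ' : Table G s X.card) => θ' = θ ∧ ∀ x, lexNum x < p → φ.HoldsT X θ x y)
    hb (by omega) (by simp [recSize]) (fun g g' => by simp) (fun i _ g g' => ?_)
    (fun p hp θ => ?_) θ
  · refine key.conseq (fun _ => id) (pass_time_le _ _ _) ?_ ?_
    · rintro ⟨_, rfl, h⟩
      exact ⟨fun x => h x (lexNum_lt x), fun _ => id⟩
    · intro h
      exact ⟨⟨θ, rfl, fun x _ => h x⟩, fun _ => id⟩
  · constructor
    · rintro ⟨rfl, h⟩
      exact ⟨g', ⟨rfl, fun x hx => h x (by omega)⟩, rfl, fun x hx => h x (by omega)⟩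
    · rintro ⟨_, ⟨rfl, h₁⟩, rfl, h₂⟩
      refine ⟨rfl, fun x hx => ?_⟩
      rcases Nat.lt_succ_iff_lt_or_eq.1 hx with hx | hx
      · exact h₁ x hx
      · exact h₂ x hx
  · obtain ⟨x, rfl⟩ := exists_lexNum_eq hp
    refine Spec.exists_pre fun S => Spec.pure_pre fun hS => ?_
    have hb' : Fits X V (recSize s μ) b S.size := hS.size ▸ hb
    intro m hm
    obtain ⟨v, -, hv, hd⟩ := hc X V b θ x y S (by omega) hb' (hS.le hm (tabField_lt e)) hS.enc
    refine (Spec.conseq (Det.seq hd (Q' := fun _ : φ.HoldsT X θ x y =>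
      AF (RepF X V (recSize s μ) (2 + r + 1) (S.set (2 + r) v))) (Spec.ifZero (T₁ := 0) (T₂ := 0)
        (S := S.set (2 + r) v) hb' (Nat.lt_succ_self _) (by omega) (fun h => ?_) fun h => ?_))
      (fun _ => id) le_rfl ?_ ?_) m hm
    -- If the formula is false, the program fails: there is no execution, and the type of outcomes
    -- is empty.
    · have : ¬φ.HoldsT X θ x y := fun h' => hv.2 h' (by simpa using h)
      exact fun m hm => ⟨fun k m' he => (nomatch he), fun _ h' => (this h').elim⟩
    · have : φ.HoldsT X θ x y := hv.1 (by simpa using h)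
      exact Spec.conseq (Spec.skip fun _ h => h) (fun _ => id) le_rfl (fun _ => ⟨this, fun _ => id⟩)
        fun _ => ⟨(), fun _ => id⟩
    · intro h
      refine ⟨⟨θ, rfl, fun x' hx' => by rwa [lexNum_injective hx']⟩, fun m hm =>
        ⟨S, hS, RepF.weaken hm (Nat.le_succ _) ⟨rfl, rfl⟩ fun i hi => ?_⟩⟩
      rw [VarState.set_num, Function.update_of_ne (by omega)]
    · rintro ⟨_, rfl, h⟩
      refine ⟨h x rfl, fun m hm =>
        ⟨S, hS, RepF.weaken hm (Nat.le_succ _) ⟨rfl, rfl⟩ fun i hi => ?_⟩⟩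
      rw [VarState.set_num, Function.update_of_ne (by omega)]

end Passes

end TimeSpace

namespace TimeSpace

/-! ### Initialization of the records -/

section Init

variable {σ : FirstOrder.Language.{u, v}} {G : FirstOrder.Language.{0, 0}} {s r : ℕ}
  {X : FinStr σ} {V K k b p : ℕ} {S : VarState}

theorem Fits.mono {i j : ℕ} (h : Fits X V K b j) (hi : i ≤ j) : Fits X V K b i :=
  h.recAddr_le hi le_rfl

/-- Set the fields `1, …, j` of the record `p`. -/
def VarState.setFlds (S : VarState) (p j : ℕ) (f : ℕ → ℕ) : VarState :=
  { S with fld := fun i q => if q = p ∧ 1 ≤ i ∧ i ≤ j then f (i - 1) else S.fld i q }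

theorem VarState.setFlds_succ (S : VarState) (p j : ℕ) (f : ℕ → ℕ) :
    S.setFlds p (j + 1) f = (S.setFlds p j f).setFld (j + 1) p (f j) := by
  have : (S.setFlds p (j + 1) f).fld = ((S.setFlds p j f).setFld (j + 1) p (f j)).fld := by
    funext i q
    rw [VarState.setFld_fld]
    simp only [VarState.setFlds]
    by_cases h : i = j + 1 ∧ q = p
    · obtain ⟨rfl, rfl⟩ := h
      simp
    · rw [if_neg h]
      congr 1
      simp only [eq_iff_iff]
      constructor
      · rintro ⟨rfl, h₁, h₂⟩
        refine ⟨rfl, h₁, ?_⟩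
        by_contra h₃
        exact h ⟨by omega, rfl⟩
      · rintro ⟨rfl, h₁, h₂⟩
        exact ⟨rfl, h₁, by omega⟩
  simp only [setFld, setFlds, mk.injEq, and_true, true_and] at this ⊢
  exact this

variable [Finite σ.Symbols]

/-- Copy the variables `k, …, k + s - 1` to the fields `1, …, s` of the record to which the variable
`0` points. -/
noncomputable def Cmd.putDigits (k s : ℕ) : Cmd σ :=
  .seqN (fun i => .seq (.get (k + i)) (.putFld 0 (i + 1))) s

theorem Det.putDigits {k' : ℕ} (hb : Fits X V K b S.size) (hs : s < K) (hk : k + s ≤ k')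
    (hk' : k' ≤ V) (h0 : 0 < k') (hp : S.num 0 = recAddr X.card V K p) (hps : p < S.size)
    {f : ℕ → ℕ} (hf : ∀ i < s, S.num (k + i) = f i ∧ f i ≤ X.card) :
    Det X b (.putDigits k s) (s * (k + 2 * s + 12)) (AF (RepF X V K k' S))
      (AF (RepF X V K k' (S.setFlds p s f))) := by
  have h₀ : ∀ m, AF (RepF X V K k' S) m → AF (RepF X V K k' (S.setFlds p 0 f)) m := by
    intro m hm
    have : S.setFlds p 0 f = S := by
      have : (S.setFlds p 0 f).fld = S.fld := by
        funext i q
        simp only [VarState.setFlds]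
        rw [if_neg (by omega)]
      simp only [VarState.setFlds] at this ⊢
      rw [this]
    rwa [this]
  refine Spec.pre (Det.seqN (P := fun j => AF (RepF X V K k' (S.setFlds p j f))) s
    fun i hi => ?_) h₀
  have e : (S.setFlds p i f).num (k + i) = f i := (hf i hi).1
  rw [VarState.setFlds_succ]
  have := (Det.get (i := k + i) (k := k') (s := S.setFlds p i f) (X := X) (b := b) (V := V)
    (K := K) (F := RepF X V K k' (S.setFlds p i f)) hb (fun _ _ h => h) (by omega) hk').seq
      (Det.putFld (i := 0) (j := i + 1) (p := p) (k := k') (s := S.setFlds p i f)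
        (a := (S.setFlds p i f).num (k + i)) (F := RepF X V K k' (S.setFlds p i f)) hb
        (fun _ _ h => h) h0 hk' hp hps (by omega) (by omega) (by rw [e]; exact (hf i hi).2))
  rw [e] at this
  exact this.mono (by omega)

/-- The first `N` records contain the components of the first tuples and otherwise zeros, the
variables contain the tuple `a`, and a pointer to the address of the record `p`. -/
structure InitState (X : FinStr σ) (V K s r : ℕ) (a : Fin s → Fin X.card) (N p : ℕ)
    (S : VarState) : Prop where
  size : S.size = N
  ptr : S.num 0 = recAddr X.card V K p
  cur : ∀ j : Fin s, S.num (2 + r + j) = a j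
  y : ∀ j < r, S.num (2 + j) = 0
  dig : ∀ (a' : Fin s → Fin X.card) (i : Fin s), lexNum a' < N → S.fld (i + 1) (lexNum a') = a' i
  tab : ∀ j, s + 1 ≤ j → ∀ q, S.fld j q = 0

/-- Create the records for all tuples. -/
noncomputable def Cmd.initRecs (V K s r : ℕ) : Cmd σ :=
  .seq (.seq (.sizeAdd (1 + V)) (.put 0)) (.seq (.loop
    (.seq (.newRec 0) (.seq (.putDigits (2 + r) s) (.seq (.seq (.get 0) (.seq (.incrs K) (.put 0)))
      (.ifMax (.seq (.op .setZero) (.op (.copy (acc0 σ))))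
        (.seq (.op .setZero) (.seq (.op (.copy (acc0 σ))) (.op .incr)))
        ((List.range s).map fun j => 2 + r + j)))))
    (.incTuple (2 + r) s)) (.seq (.get 0) (.put 1)))

/-- Counting with a tuple of variables produces the records in lexicographic order, so the record of
`a` gets the number `lexNum a`. The creation stands before the loop test: it takes place n^s times,
whereas the tuple is incremented n^s - 1 times. -/
theorem Det.initRecs {μ : ℕ} (hs : 1 ≤ s) (V : ℕ) (hV : 2 + r + s < V) (e : Fin μ ≃ G.Symbols) :
    ∃ T, ∀ (X : FinStr σ) (b : ℕ), Fits X V (recSize s μ) b (X.card ^ s) →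
      Det X b (.initRecs V (recSize s μ) s r) ((X.card ^ s + 2) * T)
        (fun m => m = Regs.init _)
        (fun m => ∃ p, MRep X V (recSize s μ) (symIdx e) p (fun _ : Fin r => ⟨0, X.pos⟩)
          (fun _ _ (_ : Fin s → Fin X.card) => 0) m) := by
  set K := recSize s μ with hK
  have hsK : s < K := by simp only [hK, recSize]; omega
  set L := (List.range s).map fun j => 2 + r + j with hL
  set T₁ := 1 + (1 + 0) + 1 + 2 + (s * (2 + r + 2 * s + 12) + (1 + (1 + 0) + 1 + (K + 4) +
    ifMaxTime (2 + r + s) 2 3 L)) with hT₁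
  set T₂ := s * (s * (2 + r + s + 9) + (5 * (2 + r + s) + 40)) with hT₂
  refine ⟨1 + (1 + V) + 4 + 10 + (T₁ + T₂ + 2), fun X b hb => ?_⟩
  have hle := hb.le
  have hX := X.pos
  have hN : 0 < X.card ^ s := Nat.pow_pos hX
  set Inv : ℕ → Unit → Regs (numAcc σ) → Prop := fun i _ m => ∃ a S, lexNum a = i ∧
    InitState X V K s r a i i S ∧ Rep X.card V K (2 + r + s) S m.R with hInv
  set Mid : ℕ → Unit → Regs (numAcc σ) → Prop := fun i _ m => (∃ a S, lexNum a = i ∧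
    InitState X V K s r a (i + 1) (i + 1) S ∧ Rep X.card V K (2 + r + s) S m.R) ∧
      (m.A = m.B (acc0 σ) ↔ i = X.card ^ s - 1) with hMid
  have h₁ : ∀ i ≤ X.card ^ s - 1, ∀ g, Det X b (.seq (.newRec 0) (.seq (.putDigits (2 + r) s)
      (.seq (.seq (.get 0) (.seq (.incrs K) (.put 0)))
      (.ifMax (.seq (.op .setZero) (.op (.copy (acc0 σ))))
        (.seq (.op .setZero) (.seq (.op (.copy (acc0 σ))) (.op .incr))) L)))) T₁ (Inv i g)
      (Mid i g) := by
    intro i hi g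
    refine Spec.exists_pre fun a => Spec.exists_pre fun S => Spec.pure_pre fun ha =>
      Spec.pure_pre fun hS => ?_
    subst ha
    have hbi : ∀ j ≤ lexNum a + 1, Fits X V K b j := fun j hj => hb.mono (by omega)
    have hrec := hb.recAddr_le (p := lexNum a) (j := K) (by omega) le_rfl
    set S₁ := S.push with hS₁
    have hS₁s : S₁.size = lexNum a + 1 := congrArg (· + 1) hS.size
    set f : ℕ → ℕ := fun j => if h : j < s then (a ⟨j, h⟩).val else 0 with hf
    set S₂ := S₁.setFlds (lexNum a) s f with hS₂
    set S₃ := S₂.set 0 (recAddr X.card V K (lexNum a) + K) with hS₃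
    have hI : InitState X V K s r a (lexNum a + 1) (lexNum a + 1) S₃ := by
      refine ⟨hS₁s, ?_, fun j => ?_, fun j hj => ?_, fun a' j ha' => ?_, fun j hj q => ?_⟩
      · simp only [hS₃, VarState.set_num, Function.update_self, recAddr]
        ring
      · rw [hS₃, VarState.set_num, Function.update_of_ne (by omega)]
        exact hS.cur j
      · rw [hS₃, VarState.set_num, Function.update_of_ne (by omega)]
        exact hS.y j hj
      · simp only [hS₃, hS₂, VarState.set_fld, VarState.setFlds]
        by_cases h : lexNum a' = lexNum a
        · obtain rfl := lexNum_injective h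
          rw [if_pos ⟨rfl, by omega, by omega⟩]
          simp [hf]
        · rw [if_neg (fun h' => h h'.1), hS₁]
          simp only [VarState.push, hS.size]
          rw [Function.update_of_ne h]
          exact hS.dig a' j (by omega)
      · simp only [hS₃, hS₂, VarState.set_fld, VarState.setFlds]
        rw [if_neg (by omega), hS₁]
        simp only [VarState.push]
        by_cases h : q = S.size
        · subst h; simp
        · rw [Function.update_of_ne h]
          exact hS.tab j hj q
    have hcond : (∀ i ∈ L, S₃.num i = X.card - 1) ↔ lexNum a = X.card ^ s - 1 := by
      have : lexNum a = X.card ^ s - 1 ↔ lexNum a + 1 = X.card ^ s := by omega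
      rw [this, lexNum_add_one_eq_iff]
      simp only [hL, List.mem_map, List.mem_range, forall_exists_index, and_imp]
      constructor
      · intro h j
        rw [← h _ j j.2 rfl, hI.cur]
      · rintro h _ j hj rfl
        rw [hI.cur ⟨j, hj⟩, h]
    refine Det.seq (Det.newRec (i := 0) (k := 2 + r + s) (s := S) (hS.size ▸ hbi _ (by omega))
      (by omega) (by omega) hV.le (by rw [hS.size]; exact hS.ptr)) (Det.seq (Det.putDigits
      (k := 2 + r) (k' := 2 + r + s) (S := S₁) (p := lexNum a) (f := f) (hS₁s ▸ hbi _ le_rfl) hsK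
      le_rfl hV.le (by omega) hS.ptr (by omega) (fun i hi => ?_)) (Det.seq (Q := AF (RepF X V K
        (2 + r + s) S₃)) ?_ ?_))
    · have := hS.cur ⟨i, hi⟩
      simp only at this
      simp only [hf, dif_pos hi]
      exact ⟨this, (a _).2.le⟩
    · have hp : S₂.num 0 = recAddr X.card V K (lexNum a) := hS.ptr
      refine Spec.mono (Det.seq (Det.get (i := 0) (k := 2 + r + s) (s := S₂)
        (F := RepF X V K (2 + r + s) S₂) (hS₁s ▸ hbi _ le_rfl) (fun _ _ h => h) (by omega) hV.le)
        (Det.seq (Det.incrs (k := K) (by rw [hp]; exact hrec)) (T₂ := 4) ?_)) le_rfl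
      rw [hp]
      exact Det.put (k := 2 + r + s) (k' := 2 + r + s) (i := 0) (s := S₂) (hS₁s ▸ hbi _ le_rfl)
        (fun _ _ h => h) (by omega) (by omega) (by omega)
        (Or.inr (by have := le_recAddr (n := X.card) (V := V) (K := K) (lexNum a); omega))
    · refine Spec.ifMax (S := S₃) (hS₁s ▸ hbi _ le_rfl) hV.le ?_ (fun h => ?_) fun h => ?_
      · simp only [hL, List.mem_map, List.mem_range, forall_exists_index, and_imp]
        rintro _ j hj rfl
        exact ⟨by omega, by rw [hI.cur ⟨j, hj⟩]; exact (a _).2⟩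
      · rw [hcond] at h
        refine Spec.post (Det.seq (Det.setZero (F := RepF X V K (2 + r + s) S₃)) (Det.copy
          (F' := fun B R => Rep X.card V K (2 + r + s) S₃ R ∧ B (acc0 σ) = 0)
          fun B R h => ⟨h, by simp⟩)) fun _ m hm => ⟨⟨a, S₃, rfl, hI, hm.1.1⟩, ?_⟩
        rw [hm.1.2, hm.2]
        simp [h]
      · rw [hcond] at h
        refine Spec.post (Det.seq (Det.setZero (F := RepF X V K (2 + r + s) S₃)) (Det.seq (Det.copy
          (F' := fun B R => Rep X.card V K (2 + r + s) S₃ R ∧ B (acc0 σ) = 0)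
          fun B R h => ⟨h, by simp⟩) (Det.incr (by omega)))) fun _ m hm =>
            ⟨⟨a, S₃, rfl, hI, hm.1.1⟩, ?_⟩
        rw [hm.1.2, hm.2]
        simp [h]
  have h₂ : ∀ i < X.card ^ s - 1, ∀ g, Det X b (.incTuple (2 + r) s) T₂ (Mid i g)
      (Inv (i + 1) g) := by
    intro i hi g
    refine Spec.pre ?_ fun m hm => hm.1
    refine Spec.exists_pre fun a => Spec.exists_pre fun S => Spec.pure_pre fun ha =>
      Spec.pure_pre fun hS => ?_
    subst ha
    have hlast : ¬ ∀ j, (a j).val = X.card - 1 := by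
      rw [← lexNum_add_one_eq_iff]
      omega
    obtain ⟨f, hf, hd⟩ := Det.incTuple (X := X) (b := b) (V := V) (K := K) (k := 2 + r + s)
      (S := S) (i := 2 + r) (δ := s) (a := a) (hb.mono (by rw [hS.size]; omega)) hV.le le_rfl
      hS.cur hlast
    refine hd.post fun _ m hm => ⟨lexSucc a, _, lexNum_lexSucc hlast, ?_, hm⟩
    refine ⟨hS.size, ?_, fun j => ?_, fun j hj => ?_, hS.dig, hS.tab⟩
    · simp only [VarState.setMany]
      rw [if_neg (by omega)]
      exact hS.ptr
    · simp only [VarState.setMany]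
      rw [if_pos (by omega), ← hf]
      congr 1
      omega
    · simp only [VarState.setMany]
      rw [if_neg (by omega)]
      exact hS.y j hj
  have hloop := Spec.loop_rel (Γ := Unit) (X := X) (b := b) (ρ := fun _ _ _ => True)
    (R := fun _ _ _ => True) (k := X.card ^ s - 1) (Inv := Inv) (Mid := Mid) (T₂ := T₂)
    (fun _ _ => by simp) (fun _ _ _ _ => by simp) h₁ (fun i hi g m hm => hm.2)
    (fun i hi g => (h₂ i hi g).conseq (fun _ => id) le_rfl (fun _ => ⟨⟨(), trivial⟩, fun _ => id⟩)
      fun _ => ⟨(), fun _ => id⟩) ()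
  have hstart : Det X b (.seq (.sizeAdd (1 + V)) (.put 0)) (1 + (1 + V) + 4)
      (fun m => m = Regs.init (numAcc σ)) (Inv 0 ()) := by
    obtain ⟨a₀, ha₀⟩ := exists_lexNum_eq hN
    set S₀ : VarState := ⟨fun _ => 0, fun _ _ => 0, 0⟩ with hS₀
    refine Spec.post (Spec.pre (Det.seq (Det.sizeAdd (k := 1 + V) (F := RepF X V K (2 + r + s) S₀)
      (by omega)) (Det.put (k := 2 + r + s) (k' := 2 + r + s) (i := 0) (s := S₀)
        (hb.mono (Nat.zero_le _)) (fun _ _ h => h) (by omega) (by omega) (by omega)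
        (Or.inr (by omega)))) ?_) fun _ m hm => ⟨a₀, _, ha₀, ?_, hm⟩
    · rintro m rfl
      -- The memory filled with zeros represents the state without records.
      refine ⟨fun _ _ => rfl, fun _ _ => rfl, fun _ _ => Or.inl (Nat.zero_le _), fun p hp => ?_,
        fun p hp => ?_, fun p hp => ?_, fun _ _ => rfl⟩
      all_goals simp [hS₀] at hp
    · refine ⟨rfl, ?_, fun j => ?_, fun j hj => ?_, fun a' j ha' => by simp at ha', fun _ _ _ => rfl⟩
      · simp only [VarState.set_num, Function.update_self, recAddr]
        ring
      · rw [VarState.set_num, Function.update_of_ne (by omega)]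
        exact ((lexNum_eq_zero_iff a₀).1 ha₀ j).symm
      · rw [VarState.set_num, Function.update_of_ne (by omega)]
  have hend : Det X b (.seq (.get 0) (.put 1)) (1 + (1 + 0) + 1 + 5) (Mid (X.card ^ s - 1) ())
      (fun m => ∃ p, MRep X V K (symIdx e) p (fun _ : Fin r => ⟨0, X.pos⟩)
          (fun _ _ (_ : Fin s → Fin X.card) => 0) m) := by
    refine Spec.pre ?_ fun m hm => hm.1
    refine Spec.exists_pre fun a => Spec.exists_pre fun S => Spec.pure_pre fun ha =>
      Spec.pure_pre fun hS => ?_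
    rw [Nat.sub_add_cancel hN] at hS
    have hb' : Fits X V K b S.size := hb.mono hS.size.le
    refine Spec.post (Det.seq (Det.get (i := 0) (k := 2 + r + s) (s := S)
      (F := RepF X V K (2 + r + s) S) hb' (fun _ _ h => h) (by omega) hV.le)
      (Det.put (k := 2 + r + s) (k' := 2 + r + s) (i := 1) (s := S) hb' (fun _ _ h => h) (by omega)
        (by omega) (by omega) (Or.inr (by rw [hS.ptr]; exact le_recAddr _)))) fun _ m hm =>
      ⟨X.card ^ s, S.set 1 (S.num 0), ⟨hS.size, ?_, ?_, fun j => ?_, fun a i => hS.dig a i (lexNum_lt a),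
        fun g next a => hS.tab _ ?_ _⟩, Rep.mono hm (by omega)⟩
    · rw [VarState.set_num, Function.update_of_ne (by omega)]
      exact hS.ptr
    · rw [VarState.set_num, Function.update_self, hS.ptr]
    · rw [VarState.set_num, Function.update_of_ne (by omega)]
      exact hS.y j j.2
    · simp only [tabField]
      omega
  refine Spec.mono (Det.seq hstart (Spec.conseq (Spec.seq_det hloop fun _ => hend) (fun _ => id)
    le_rfl (fun _ => ⟨(), fun _ => id⟩) fun _ => ⟨⟨(), trivial⟩, fun _ => id⟩)) ?_
  have : (X.card ^ s - 1 + 1) * (T₁ + T₂ + 2) ≤ (X.card ^ s + 1) * (T₁ + T₂ + 2) :=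
    Nat.mul_le_mul_right _ (by omega)
  have := pass_time_le (X.card ^ s) (1 + (1 + V) + 4 + 10) (T₁ + T₂ + 2)
  omega

end Init

end TimeSpace

namespace TimeSpace

/-! ### Prefixes of tuples -/

section Prefix

variable {n r δ : ℕ}

theorem lexNum_eq_sum {δ : ℕ} (a : Fin δ → Fin n) :
    lexNum a = ∑ j : Fin δ, (a j).val * n ^ (δ - 1 - j.val) := by
  induction δ with
  | zero => simp [lexNum]
  | succ δ ih =>
    rw [lexNum, ih, Fin.sum_univ_succ]
    congr 1
    refine Finset.sum_congr rfl fun j _ => ?_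
    simp only [Fin.tail, Fin.val_succ]
    congr 2
    omega

/-- The first δ components give the quotient of the number by n^(r-δ) and the other components the
remainder; the remainder is maximal when these are all n - 1. -/
theorem exists_lexNum_prefix (h : δ ≤ r) (y : Fin r → Fin n) :
    ∃ t < n ^ (r - δ), lexNum y = lexNum (fun j => y (Fin.castLE h j)) * n ^ (r - δ) + t ∧
      (t + 1 = n ^ (r - δ) ↔ ∀ j : Fin r, δ ≤ j.val → (y j).val = n - 1) := by
  obtain ⟨e, rfl⟩ := Nat.exists_eq_add_of_le h
  rw [Nat.add_sub_cancel_left]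
  refine ⟨lexNum fun j => y (Fin.natAdd δ j), lexNum_lt _, ?_, ?_⟩
  · simp only [lexNum_eq_sum, Fin.sum_univ_add, Finset.sum_mul]
    congr 1
    · refine Finset.sum_congr rfl fun j _ => ?_
      rw [mul_assoc, ← pow_add]
      congr 2
      simp only [Fin.val_castAdd]
      omega
    · refine Finset.sum_congr rfl fun j _ => ?_
      congr 2
      simp only [Fin.val_natAdd]
      omega
  · rw [lexNum_add_one_eq_iff]
    constructor
    · intro h j hj
      obtain ⟨i, rfl⟩ : ∃ i : Fin e, j = Fin.natAdd δ i := ⟨⟨j - δ, by omega⟩, Fin.ext (by simp; omega)⟩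
      exact h i
    · exact fun h j => h _ (by simp)

theorem lexNum_div (h : δ ≤ r) (y : Fin r → Fin n) :
    lexNum y / n ^ (r - δ) = lexNum (fun j => y (Fin.castLE h j)) := by
  obtain ⟨t, ht, he, -⟩ := exists_lexNum_prefix h y
  rw [he, Nat.mul_comm, Nat.mul_add_div (by omega), Nat.div_eq_of_lt ht, add_zero]

theorem dvd_lexNum_add_one_iff (h : δ ≤ r) (y : Fin r → Fin n) :
    n ^ (r - δ) ∣ lexNum y + 1 ↔ ∀ j : Fin r, δ ≤ j.val → (y j).val = n - 1 := by
  obtain ⟨t, ht, he, h'⟩ := exists_lexNum_prefix h y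
  rw [← h', he, add_assoc, Nat.dvd_add_right (Dvd.intro_left _ rfl)]
  constructor
  · exact fun hd => le_antisymm ht (Nat.le_of_dvd (Nat.succ_pos _) hd)
  · exact fun h => h ▸ dvd_rfl

/-- All places behind the prefix are full, so the carry enters the prefix. -/
theorem lexSucc_prefix (h : δ ≤ r) {y : Fin r → Fin n} (hy : ¬ ∀ j, (y j).val = n - 1)
    (hc : ∀ j : Fin r, δ ≤ j.val → (y j).val = n - 1) :
    (fun j => lexSucc y (Fin.castLE h j)) = lexSucc fun j => y (Fin.castLE h j) := by
  funext i
  have h₁ : ¬ ∀ j : Fin δ, (y (Fin.castLE h j)).val = n - 1 := by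
    intro h'
    refine hy fun j => ?_
    by_cases hj : j.val < δ
    · exact h' ⟨j, hj⟩
    · exact hc j (by omega)
  have h₂ : (∀ j, Fin.castLE h i < j → (y j).val = n - 1) ↔
      ∀ j, i < j → (y (Fin.castLE h j)).val = n - 1 := by
    constructor
    · exact fun h' j hj => h' _ hj
    · intro h' j hj
      by_cases hj' : j.val < δ
      · exact h' ⟨j, hj'⟩ hj
      · exact hc j (by omega)
  simp only [lexSucc, if_neg hy, if_neg h₁, h₂]

/-- The carry is absorbed behind the prefix. -/
theorem lexSucc_prefix_eq (h : δ ≤ r) {y : Fin r → Fin n}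
    (hc : ¬ ∀ j : Fin r, δ ≤ j.val → (y j).val = n - 1) :
    (fun j => lexSucc y (Fin.castLE h j)) = fun j => y (Fin.castLE h j) := by
  funext i
  have hy : ¬ ∀ j, (y j).val = n - 1 := fun h' => hc fun j _ => h' j
  have h' : ¬ ∀ j, Fin.castLE h i < j → (y j).val = n - 1 := by
    intro h'
    refine hc fun j hj => h' j ?_
    rw [Fin.lt_def, Fin.val_castLE]
    omega
  rw [lexSucc, if_neg hy, if_neg h']

end Prefix

/-! ### Sequences of tables -/

section Sequences

variable {σ : FirstOrder.Language.{u, v}} {G : FirstOrder.Language.{0, 0}} {s r : ℕ}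

/-- The entries `v` and `v'` of the table for `g` stand for the same value. -/
def SameVal {n : ℕ} (hn : 0 < n) (g : G.Symbols) (v v' : ℕ) : Prop :=
  match g with
  | Sum.inl _ => toFin hn v = toFin hn v'
  | Sum.inr _ => v ≠ 0 ↔ v' ≠ 0

theorem SameVal.of_eq {n : ℕ} {hn : 0 < n} {g : G.Symbols} {v v' : ℕ} (h : v = v') :
    SameVal hn g v v' := by
  subst h
  cases g
  · exact rfl
  · exact Iff.rfl

theorem SameVal.trans {n : ℕ} {hn : 0 < n} {g : G.Symbols} {v₁ v₂ v₃ : ℕ}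
    (h : SameVal hn g v₁ v₂) (h' : SameVal hn g v₂ v₃) : SameVal hn g v₁ v₃ := by
  cases g
  · exact Eq.trans h h'
  · exact Iff.trans h h'

/-- Two tables contain the same values at all entries which a formula can read. -/
structure SameTable {X : FinStr σ} (θ θ' : Table G s X.card) : Prop where
  cur : ∀ g a, (∀ i : Fin s, symArity G g ≤ i → a i = ⟨0, X.pos⟩) →
    SameVal X.pos g (θ g false a) (θ' g false a)
  next : ∀ g a, s < symArity G g → SameVal X.pos g (θ g true a) (θ' g true a)

theorem padVec_eq_zero {n k : ℕ} (hn : 0 < n) (a : Fin k → Fin n) (i : Fin s) (h : k ≤ i.val) :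
    padVec hn s a i = ⟨0, hn⟩ := by
  rw [padVec, dif_neg (by omega)]

variable {X : FinStr σ} {θ θ' : Table G s X.card}

theorem SameTable.val_eq (h : SameTable θ θ') {k : ℕ} (g : G.Functions k) (next : Bool)
    (a : Fin s → Fin X.card) (ha : ∀ i : Fin s, k ≤ i → a i = ⟨0, X.pos⟩)
    (hk : next = true → s < k) :
    toFin X.pos (θ (Sum.inl ⟨k, g⟩) next a) = toFin X.pos (θ' (Sum.inl ⟨k, g⟩) next a) := by
  cases next
  · exact h.cur (Sum.inl ⟨k, g⟩) a ha
  · exact h.next (Sum.inl ⟨k, g⟩) a (hk rfl)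

theorem SameTable.holds_iff (h : SameTable θ θ') {k : ℕ} (g : G.Relations k) (next : Bool)
    (a : Fin s → Fin X.card) (ha : ∀ i : Fin s, k ≤ i → a i = ⟨0, X.pos⟩)
    (hk : next = true → s < k) :
    θ (Sum.inr ⟨k, g⟩) next a ≠ 0 ↔ θ' (Sum.inr ⟨k, g⟩) next a ≠ 0 := by
  cases next
  · exact h.cur (Sum.inr ⟨k, g⟩) a ha
  · exact h.next (Sum.inr ⟨k, g⟩) a (hk rfl)

theorem RTerm.valT_congr (h : SameTable θ θ') (x : Fin s → Fin X.card) (y : Fin r → Fin X.card)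
    (t : RTerm σ G s r) : t.valT X θ x y = t.valT X θ' x y := by
  induction t with
  | x | y | zero => rfl
  | succ t ih => simp only [valT, ih]
  | input f a ih => simp only [valT, ih]
  | guessLow hk g a ih =>
    simp only [valT, ih]
    exact h.val_eq g false _ (fun i hi => padVec_eq_zero _ _ i hi) (by simp)
  | guessHigh hδ _ g a next ih =>
    simp only [valT, ih]
    exact h.val_eq g next _ (fun i hi => by omega) (by omega)

theorem RFormula.holdsT_congr (h : SameTable θ θ') (x : Fin s → Fin X.card)
    (y : Fin r → Fin X.card) (φ : RFormula σ G s r) : φ.HoldsT X θ x y ↔ φ.HoldsT X θ' x y := by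
  induction φ with
  | eq | input => simp only [HoldsT, RTerm.valT_congr h]
  | guessLow hk g a =>
    simp only [HoldsT, RTerm.valT_congr h]
    exact h.holds_iff g false _ (fun i hi => padVec_eq_zero _ _ i hi) (by simp)
  | guessHigh hδ _ g a next =>
    simp only [HoldsT, RTerm.valT_congr h]
    exact h.holds_iff g next _ (fun i hi => by omega) (by omega)
  | not φ ih => simp only [HoldsT, ih]
  | and φ ψ ih₁ ih₂ => simp only [HoldsT, ih₁, ih₂]
  | or φ ψ ih₁ ih₂ => simp only [HoldsT, ih₁, ih₂]

/-- If `succ(y₁, …, y_δ) = (y₁, …, y_δ)`, then both copies of the table agree. -/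
def Coherent {X : FinStr σ} (θ : Table G s X.card) (x : Fin s → Fin X.card)
    (y : Fin r → Fin X.card) : Prop :=
  ∀ g : G.Symbols, s < symArity G g →
    (∀ j : Fin r, j.val < symArity G g - s → (y j).val = X.card - 1) →
      SameVal X.pos g (θ g true x) (θ g false x)

/-- The places after the prefix on which a symbol depends. -/
noncomputable def tailPlaces (G : FirstOrder.Language.{0, 0}) (s r : ℕ) (g : G.Symbols) : List (Fin r) :=
  (List.finRange r).filter fun j => symArity G g - s ≤ j.val

/-- The transition from the table for `y` to that for the next tuple. -/
def NextTable {n : ℕ} (y : Fin r → Fin n) : Table G s n → Table G s n → Prop :=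
  ChangedOn (shiftRule n fun g => ∀ j ∈ tailPlaces G s r g, (y j).val = n - 1) fun _ _ => True

theorem forall_mem_tailPlaces {g : G.Symbols} {p : Fin r → Prop} :
    (∀ j ∈ tailPlaces G s r g, p j) ↔ ∀ j : Fin r, symArity G g - s ≤ j.val → p j := by
  simp [tailPlaces]

/-- The prefix of `y` of length `k - s`, or its successor. -/
theorem argVec_congr {n k : ℕ} (a : Fin s → Fin n) {y y' : Fin r → Fin n} {next next' : Bool}
    (hk : k ≤ s + r) (h : iterVec (δ := k - s) (by omega) y next =
      iterVec (δ := k - s) (by omega) y' next') : argVec a y next hk = argVec a y' next' hk := by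
  funext i
  simp only [argVec, h]

/-- An entry depends on y only through the prefix whose length is the arity minus s, or its
successor. The truncated subtraction gives the empty prefix for symbols of arity at most s. -/
theorem tableOf_congr {n : ℕ} (hG : ∀ q : G.Symbols, symArity G q ≤ s + r)
    (I : G.Structure (Fin n)) {y y' : Fin r → Fin n} {next next' : Bool} (g : G.Symbols)
    (h : iterVec (δ := symArity G g - s) (by have := hG g; omega) y next =
      iterVec (δ := symArity G g - s) (by have := hG g; omega) y' next') (a : Fin s → Fin n) :
    tableOf hG I y g next a = tableOf hG I y' g next' a := by
  obtain ⟨k, g⟩ | ⟨k, g⟩ := g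
  · exact congrArg (fun z => (I.funMap g z).val) (argVec_congr a (hG (Sum.inl ⟨k, g⟩)) h)
  · exact congrArg (fun z => @ite ℕ (I.RelMap g z) (Classical.propDecidable _) 1 0)
      (argVec_congr a (hG (Sum.inr ⟨k, g⟩)) h)

theorem toFin_tableOf {n : ℕ} (hn : 0 < n) (hG : ∀ q : G.Symbols, symArity G q ≤ s + r)
    (I : G.Structure (Fin n)) (y : Fin r → Fin n) (next : Bool) {k : ℕ} (g : G.Functions k)
    (hk : k ≤ s + r) (a : Fin s → Fin n) :
    toFin hn (tableOf hG I y (Sum.inl ⟨k, g⟩) next a) = I.funMap g (argVec a y next hk) :=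
  toFin_val hn _

theorem tableOf_ne_zero_iff {n : ℕ} (hG : ∀ q : G.Symbols, symArity G q ≤ s + r)
    (I : G.Structure (Fin n)) (y : Fin r → Fin n) (next : Bool) {k : ℕ} (g : G.Relations k)
    (hk : k ≤ s + r) (a : Fin s → Fin n) :
    tableOf hG I y (Sum.inr ⟨k, g⟩) next a ≠ 0 ↔ I.RelMap g (argVec a y next hk) := by
  change @ite ℕ (I.RelMap g (argVec a y next hk)) (Classical.propDecidable _) 1 0 ≠ 0 ↔ _
  split_ifs with h <;> simp [h]

theorem tableOf_le (hG : ∀ q : G.Symbols, symArity G q ≤ s + r)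
    (I : G.Structure (Fin X.card)) (y : Fin r → Fin X.card) (g : G.Symbols) (next : Bool)
    (a : Fin s → Fin X.card) : tableOf hG I y g next a ≤ X.card := by
  obtain ⟨k, g⟩ | ⟨k, g⟩ := g
  · exact (Fin.is_lt _).le
  · have := X.pos
    simp only [tableOf]
    split_ifs <;> omega

/-- If the places behind the prefix are full, the prefix of the next tuple is the successor of the
present one, so the successor entry becomes the current entry. Otherwise the prefix stays, and with
it both entries. -/
theorem nextTable_tableOf (hG : ∀ q : G.Symbols, symArity G q ≤ s + r)
    (I : G.Structure (Fin X.card)) {y : Fin r → Fin X.card} (hy : ¬ ∀ j, (y j).val = X.card - 1) :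
    NextTable y (tableOf hG I y) (tableOf hG I (lexSucc y)) := by
  refine fun g a => ⟨fun _ => ⟨fun h => ⟨?_, tableOf_le _ _ _ _ _ _⟩, fun h => ?_⟩, by simp⟩
  all_goals have hδ : symArity G g - s ≤ r := by have := hG g; omega
  · replace h := forall_mem_tailPlaces.1 h
    refine tableOf_congr hG I g ?_ a
    simpa [iterVec] using lexSucc_prefix hδ hy h
  · have e := lexSucc_prefix_eq hδ fun h' => h (forall_mem_tailPlaces.2 h')
    funext b
    refine tableOf_congr hG I g ?_ a
    cases b
    · simpa [iterVec] using e
    · simp only [iterVec, if_true]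
      exact congrArg lexSucc e

theorem coherent_tableOf (hG : ∀ q : G.Symbols, symArity G q ≤ s + r)
    (I : G.Structure (Fin X.card)) (x : Fin s → Fin X.card) (y : Fin r → Fin X.card) :
    Coherent (tableOf hG I y) x y := by
  intro g _ h
  refine SameVal.of_eq (tableOf_congr hG I g ?_ x)
  simp only [iterVec, if_true]
  exact lexSucc_of_forall fun j => h _ j.2

/-- The interpretation given by a sequence of tables. -/
abbrev seqInterp {n : ℕ} (hn : 0 < n) (Θ : ℕ → Table G s n) (r : ℕ) : G.Structure (Fin n) where
  -- A prefix shorter than r is padded by zeros, which selects the first table with that prefix.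
  funMap {k} g a := toFin hn (Θ (lexNum fun j : Fin r => padVec hn (s + r) a (Fin.natAdd s j))
    (Sum.inl ⟨k, g⟩) false (padVec hn s a))
  RelMap {k} g a := Θ (lexNum fun j : Fin r => padVec hn (s + r) a (Fin.natAdd s j))
    (Sum.inr ⟨k, g⟩) false (padVec hn s a) ≠ 0

theorem padVec_argVec {n k : ℕ} (hn : 0 < n) (hk : k ≤ s + r) (a : Fin s → Fin n)
    (ha : ∀ i : Fin s, k ≤ i → a i = ⟨0, hn⟩) (y : Fin r → Fin n) (next : Bool) :
    padVec hn s (argVec a y next hk) = a := by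
  funext i
  by_cases h : i.val < k
  · simp [padVec, argVec, h]
  · rw [padVec, dif_neg h, ha i (by omega)]

/-- The index of a table from which `seqInterp` takes the value for the arguments `(a, y)`. -/
theorem sameVal_tableOf_seqInterp {n : ℕ} (hn : 0 < n) (hG : ∀ q : G.Symbols, symArity G q ≤ s + r)
    (Θ : ℕ → Table G s n) (y : Fin r → Fin n) (next : Bool) (g : G.Symbols) (a : Fin s → Fin n)
    (ha : ∀ i : Fin s, symArity G g ≤ i → a i = ⟨0, hn⟩) :
    ∃ y' : Fin r → Fin n,
      (fun j => y' (Fin.castLE (by have := hG g; omega) j)) =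
        iterVec (δ := symArity G g - s) (by have := hG g; omega) y next ∧
      SameVal hn g (tableOf hG (seqInterp hn Θ r) y g next a) (Θ (lexNum y') g false a) := by
  obtain ⟨k, g⟩ | ⟨k, g⟩ := g
  · have hk : k ≤ s + r := hG (Sum.inl ⟨k, g⟩)
    refine ⟨fun j : Fin r => padVec hn (s + r) (argVec a y next hk) (Fin.natAdd s j), ?_, ?_⟩
    · funext ⟨j, hj⟩
      have hj' : j < k - s := hj
      simp only [padVec, Fin.val_natAdd, Fin.val_castLE, argVec]
      rw [dif_pos (by omega), dif_neg (by omega)]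
      congr 1
      exact Fin.ext (by simp)
    · refine (toFin_tableOf hn hG _ y next g hk a).trans ?_
      unfold seqInterp
      simp only [FirstOrder.Language.Structure.funMap]
      rw [padVec_argVec hn hk a ha]
  · have hk : k ≤ s + r := hG (Sum.inr ⟨k, g⟩)
    refine ⟨fun j : Fin r => padVec hn (s + r) (argVec a y next hk) (Fin.natAdd s j), ?_, ?_⟩
    · funext ⟨j, hj⟩
      have hj' : j < k - s := hj
      simp only [padVec, Fin.val_natAdd, Fin.val_castLE, argVec]
      rw [dif_pos (by omega), dif_neg (by omega)]
      congr 1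
      exact Fin.ext (by simp)
    · refine (tableOf_ne_zero_iff hG _ y next g hk a).trans ?_
      unfold seqInterp
      simp only [FirstOrder.Language.Structure.RelMap]
      rw [padVec_argVec hn hk a ha]

/-- While the prefix of a symbol does not change, `shiftRule` keeps its entries. So an entry equals
that of the first table with the same prefix, whose index is the largest multiple of n^(r-δ) up to
i, with δ the length of the prefix. -/
theorem seq_const {n : ℕ} {Θ : ℕ → Table G s n}
    (hG : ∀ q : G.Symbols, symArity G q ≤ s + r) (hΘ : ∀ i < n ^ r - 1, ∀ y : Fin r → Fin n,
      lexNum y = i → NextTable y (Θ i) (Θ (i + 1))) (g : G.Symbols) (a : Fin s → Fin n)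
    (b : Bool) : ∀ i < n ^ r, Θ i g b a =
      Θ (i / n ^ (r - (symArity G g - s)) * n ^ (r - (symArity G g - s))) g b a := by
  set B := n ^ (r - (symArity G g - s)) with hB
  intro i
  induction i with
  | zero => simp
  | succ i ih =>
    intro hi
    obtain ⟨y, hy⟩ := exists_lexNum_eq (n := n) (δ := r) (p := i) (by omega)
    have hδ : symArity G g - s ≤ r := by have := hG g; omega
    by_cases hd : B ∣ i + 1
    · rw [Nat.div_mul_cancel hd]
    · have h := ((hΘ i (by omega) y hy g a).1 trivial).2 fun h' => hd (by
        rw [← hy]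
        exact (dvd_lexNum_add_one_iff hδ y).2 (forall_mem_tailPlaces.1 h'))
      rw [Nat.succ_div_of_not_dvd hd, ← ih (by omega)]
      exact congrFun h b

/-- An interpretation yields the sequence of its tables. Conversely, tables with the same prefix
agree on a symbol, so the copies `false` define an interpretation. The copy `true` at y agrees with
it because at the next change of the prefix it becomes the copy `false`. After the last prefix there
is no such change, and `Coherent` takes its place. -/
theorem satisfies_iff_exists_tables (φ : ESO σ s r) (X : FinStr σ) :
    X.Satisfies φ ↔ ∃ Θ : ℕ → Table φ.guessed s X.card, (∀ g b a, Θ 0 g b a ≤ X.card) ∧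
      (∀ i < X.card ^ r - 1, ∀ y : Fin r → Fin X.card, lexNum y = i →
        NextTable y (Θ i) (Θ (i + 1))) ∧
      ∀ i ≤ X.card ^ r - 1, ∀ y, lexNum y = i → ∀ x, φ.matrix.HoldsT X (Θ i) x y ∧
        Coherent (Θ i) x y := by
  have hG := φ.arity_le
  have hN : 0 < X.card ^ r := Nat.pow_pos X.pos
  constructor
  · rintro ⟨I, hI⟩
    set Y : ℕ → Fin r → Fin X.card := fun i =>
      if h : i < X.card ^ r then (lexEquiv X.card r).symm ⟨i, h⟩ else fun _ => ⟨0, X.pos⟩ with hY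
    have hYl : ∀ y, Y (lexNum y) = y := by
      intro y
      simp only [hY, dif_pos (lexNum_lt y)]
      rw [Equiv.symm_apply_eq]
      rfl
    refine ⟨fun i => tableOf hG I (Y i), fun g b a => tableOf_le _ _ _ _ _ _, ?_, ?_⟩
    · rintro i hi y rfl
      have hy : ¬ ∀ j, (y j).val = X.card - 1 := by
        rw [← lexNum_add_one_eq_iff]
        omega
      rw [← lexNum_lexSucc hy]
      simp only [hYl]
      exact nextTable_tableOf hG I hy
    · rintro i hi y rfl x
      simp only [hYl]
      exact ⟨(RFormula.holdsT_tableOf _ _ _ _ _ _).2 (hI x y), coherent_tableOf _ _ _ _⟩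
  · rintro ⟨Θ, -, hn, hh⟩
    refine ⟨seqInterp X.pos Θ r, fun x y => ?_⟩
    have hy : lexNum y ≤ X.card ^ r - 1 := by have := lexNum_lt y; omega
    rw [← RFormula.holdsT_tableOf X hG, ← RFormula.holdsT_congr (θ := Θ (lexNum y))]
    · exact (hh _ hy y rfl x).1
    have hcur : ∀ (g : φ.guessed.Symbols) (a : Fin s → Fin X.card) (y y' : Fin r → Fin X.card),
        (fun j => y' (Fin.castLE (show symArity _ g - s ≤ r by have := hG g; omega) j)) =
          (fun j => y (Fin.castLE (by have := hG g; omega) j)) → ∀ b,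
        Θ (lexNum y') g b a = Θ (lexNum y) g b a := by
      intro g a y y' h b
      have hδ : symArity _ g - s ≤ r := by have := hG g; omega
      rw [seq_const hG hn g a b _ (lexNum_lt y), seq_const hG hn g a b _ (lexNum_lt y'),
        lexNum_div hδ, lexNum_div hδ, h]
    have hfalse : ∀ g a, (∀ i : Fin s, symArity φ.guessed g ≤ i → a i = ⟨0, X.pos⟩) →
        SameVal X.pos g (Θ (lexNum y) g false a)
          (tableOf hG (seqInterp X.pos Θ r) y g false a) := by
      intro g a ha
      obtain ⟨y', h₁, h₂⟩ := sameVal_tableOf_seqInterp X.pos hG Θ y false g a ha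
      simp only [iterVec, Bool.false_eq_true, if_false] at h₁
      rw [hcur g a y y' h₁] at h₂
      cases g
      · exact Eq.symm h₂
      · exact Iff.symm h₂
    refine ⟨hfalse, fun g a hg => ?_⟩
    have hδ : symArity _ g - s ≤ r := by have := hG g; omega
    -- The last prefix is its own successor, and only for it is coherence needed.
    by_cases hl : ∀ j : Fin r, j.val < symArity _ g - s → (y j).val = X.card - 1
    · refine (((hh _ hy y rfl a).2 g hg hl).trans (hfalse g a fun i hi => by omega)).trans
        (SameVal.of_eq (tableOf_congr hG _ g ?_ a))
      simp only [iterVec, if_true]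
      exact (lexSucc_of_forall fun j => hl _ j.2).symm
    · obtain ⟨y', h₁, h₂⟩ := sameVal_tableOf_seqInterp X.pos hG Θ y true g a fun i hi => by omega
      have hl' : ¬ ∀ j : Fin (symArity φ.guessed g - s), (y (Fin.castLE hδ j)).val = X.card - 1 :=
        fun h => hl fun j hj => h ⟨j, hj⟩
      set B := X.card ^ (r - (symArity φ.guessed g - s)) with hB
      have hBpos : 0 < B := Nat.pow_pos X.pos
      simp only [iterVec, if_true] at h₁
      have e₁ : lexNum y' / B = lexNum y / B + 1 := by
        rw [lexNum_div hδ, lexNum_div hδ, h₁, lexNum_lexSucc hl']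
      set q := lexNum y / B with hq
      have hi : (q + 1) * B - 1 + 1 = (q + 1) * B := Nat.sub_add_cancel (by nlinarith)
      have hle : (q + 1) * B ≤ lexNum y' := by rw [← e₁]; exact Nat.div_mul_le_self _ _
      have hlt := lexNum_lt y'
      -- `z` is the last tuple with the prefix of `y`; in the step after it the copy `true` becomes
      -- the copy `false`.
      obtain ⟨z, hz⟩ := exists_lexNum_eq (n := X.card) (δ := r) (p := (q + 1) * B - 1) (by omega)
      have hz' : lexNum z / B = q := by
        rw [hz]
        refine Nat.div_eq_of_lt_le ?_ ?_
        · rw [Nat.succ_mul]; omega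
        · omega
      have h₃ := ((hn _ (by omega) z hz g a).1 trivial).1
        (forall_mem_tailPlaces.2 ((dvd_lexNum_add_one_iff hδ z).1 (by
          rw [hz, hi]
          exact Dvd.intro_left _ rfl)))
      have e₂ : Θ (lexNum y) g true a = Θ ((q + 1) * B - 1) g true a := by
        rw [seq_const hG hn g a true _ (lexNum_lt y), ← hz,
          seq_const hG hn g a true _ (lexNum_lt z), ← hB, hz']
      have e₃ : Θ (lexNum y') g false a = Θ ((q + 1) * B) g false a := by
        rw [seq_const hG hn g a false _ (lexNum_lt y'), ← hB, e₁]
      have e₄ : Θ ((q + 1) * B - 1 + 1) g false a = Θ ((q + 1) * B - 1) g true a := h₃.1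
      rw [hi] at e₄
      rw [e₃, e₄, ← e₂] at h₂
      cases g
      · exact Eq.symm h₂
      · exact Iff.symm h₂

end Sequences

end TimeSpace

namespace TimeSpace

/-! ### Coherence as a restricted formula -/

section Coherence

variable {σ : FirstOrder.Language.{u, v}} {G : FirstOrder.Language.{0, 0}} {s r : ℕ}

/-- The conjunction of a list of formulas. -/
def RFormula.conj : List (RFormula σ G s r) → RFormula σ G s r
  | [] => .eq .zero .zero
  | φ :: l => .and φ (RFormula.conj l)

theorem RFormula.holdsT_conj {X : FinStr σ} {θ : Table G s X.card} {x : Fin s → Fin X.card}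
    {y : Fin r → Fin X.card} (l : List (RFormula σ G s r)) :
    (RFormula.conj l).HoldsT X θ x y ↔ ∀ φ ∈ l, φ.HoldsT X θ x y := by
  induction l with
  | nil => simp [conj, HoldsT]
  | cons φ l ih => simp [conj, HoldsT, ih]

theorem succFin_eq_self_iff {n : ℕ} (a : Fin n) : succFin a = a ↔ a.val = n - 1 := by
  have := a.2
  rw [Fin.ext_iff, succFin_val]
  split_ifs <;> omega

/-- The premise is expressed by the equations succ(y_j) = y_j, the conclusion by comparing the
applications of g to (x, succ(y₁…y_δ)) and (x, y₁…y_δ). So coherence can be checked in the same pass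
as the matrix. -/
theorem exists_coherenceFormula_symbol (σ : FirstOrder.Language.{u, v}) (s r : ℕ) (g : G.Symbols)
    (hg : symArity G g ≤ s + r) :
    ∃ χ : RFormula σ G s r, ∀ (X : FinStr σ) (θ : Table G s X.card) (x : Fin s → Fin X.card)
      (y : Fin r → Fin X.card), χ.HoldsT X θ x y ↔ (s < symArity G g →
        (∀ j : Fin r, j.val < symArity G g - s → (y j).val = X.card - 1) →
          SameVal X.pos g (θ g true x) (θ g false x)) := by
  by_cases hs : s < symArity G g
  swap
  · exact ⟨.eq .zero .zero, fun X θ x y => by simp [RFormula.HoldsT, hs]⟩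
  simp only [hs, true_imp_iff]
  set l : List (RFormula σ G s r) := (List.finRange r).map fun j =>
    if j.val < symArity G g - s then .eq (.succ (.y j)) (.y j) else .eq .zero .zero with hl
  have hconj : ∀ (X : FinStr σ) (θ : Table G s X.card) (x : Fin s → Fin X.card)
      (y : Fin r → Fin X.card), (RFormula.conj l).HoldsT X θ x y ↔
        ∀ j : Fin r, j.val < symArity G g - s → (y j).val = X.card - 1 := by
    intro X θ x y
    rw [RFormula.holdsT_conj]
    simp only [hl, List.mem_map, List.mem_finRange, true_and, forall_exists_index,
      forall_apply_eq_imp_iff]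
    refine forall_congr' fun j => ?_
    split_ifs with hj
    · simp only [RFormula.HoldsT, RTerm.valT, succFin_eq_self_iff, hj, true_imp_iff]
    · simp [RFormula.HoldsT, hj]
  suffices h : ∃ χ : RFormula σ G s r, ∀ (X : FinStr σ) (θ : Table G s X.card)
      (x : Fin s → Fin X.card) (y : Fin r → Fin X.card), χ.HoldsT X θ x y ↔
        SameVal X.pos g (θ g true x) (θ g false x) by
    obtain ⟨χ, hχ⟩ := h
    refine ⟨.or (.not (RFormula.conj l)) χ, fun X θ x y => ?_⟩
    simp only [RFormula.HoldsT, hconj, hχ]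
    tauto
  clear hconj hl
  clear l
  obtain ⟨k, g⟩ | ⟨k, g⟩ := g <;> simp only [symArity] at hs hg <;>
    obtain ⟨δ, rfl⟩ := Nat.exists_eq_add_of_lt hs <;> rw [add_assoc] at hg
  · exact ⟨.eq (.guessHigh (δ := δ + 1) (by omega) (by omega) g (fun i => .x i) true)
      (.guessHigh (δ := δ + 1) (by omega) (by omega) g (fun i => .x i) false),
      fun X θ x y => Iff.rfl⟩
  · refine ⟨.or (.and (.guessHigh (δ := δ + 1) (by omega) (by omega) g (fun i => .x i) true)
      (.guessHigh (δ := δ + 1) (by omega) (by omega) g (fun i => .x i) false)) (.and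
      (.not (.guessHigh (δ := δ + 1) (by omega) (by omega) g (fun i => .x i) true))
      (.not (.guessHigh (δ := δ + 1) (by omega) (by omega) g (fun i => .x i) false))),
      fun X θ x y => ?_⟩
    exact iff_iff_and_or_not_and_not.symm

theorem exists_coherenceFormula (σ : FirstOrder.Language.{u, v}) {s r μ : ℕ}
    (e : Fin μ ≃ G.Symbols) (hG : ∀ q : G.Symbols, symArity G q ≤ s + r) :
    ∃ χ : RFormula σ G s r, ∀ (X : FinStr σ) (θ : Table G s X.card) (x : Fin s → Fin X.card)
      (y : Fin r → Fin X.card), χ.HoldsT X θ x y ↔ Coherent θ x y := by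
  choose χ hχ using fun g => exists_coherenceFormula_symbol σ s r g (hG g)
  refine ⟨RFormula.conj ((List.finRange μ).map fun i => χ (e i)), fun X θ x y => ?_⟩
  rw [RFormula.holdsT_conj]
  simp only [List.mem_map, List.mem_finRange, true_and, forall_exists_index,
    forall_apply_eq_imp_iff, hχ]
  exact ⟨fun h g => by simpa using h (e.symm g), fun h i => h (e i)⟩

end Coherence

/-! ### The program for a formula -/

section Program

variable {σ : FirstOrder.Language.{u, v}} [Finite σ.Symbols] {s r : ℕ}

/-- The main loop checks the table for all n^r tuples y before its test and changes table and tuple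
n^r - 1 times after it. Each round costs O(n^s). By `satisfies_iff_exists_tables` an execution can
be completed exactly when the formula holds, so the truth of the formula serves as the type of
outcomes. -/
theorem exists_program (hs : 1 ≤ s) (φ : ESO σ s r) :
    ∃ (c : Cmd σ) (V K T : ℕ), ∀ (X : FinStr σ) (b : ℕ), Fits X V K b (X.card ^ s) →
      Spec X b c (X.card ^ (s + r) * T) (fun m => m = Regs.init _)
        (fun _ : X.Satisfies φ => fun _ => True) := by
  have := φ.finite
  obtain ⟨μ, ⟨e'⟩⟩ := Finite.exists_equiv_fin φ.guessed.Symbols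
  set e := e'.symm
  obtain ⟨χ, hχ⟩ := exists_coherenceFormula σ e φ.arity_le
  obtain ⟨V, hV, hc⟩ := Spec.checkAll (2 + r + s + 1) e (.and φ.matrix χ)
  obtain ⟨c, Tc, hc⟩ := hc V le_rfl
  set K := recSize s μ with hK
  obtain ⟨Ti, hi⟩ := Det.initRecs (σ := σ) (r := r) hs V (by omega) e
  obtain ⟨T₀, h₀⟩ := Spec.shiftAll (σ := σ) hs V (by omega) e (fun _ => ([] : List (Fin r)))
  obtain ⟨T₁, h₁⟩ := Spec.shiftAll (σ := σ) hs V (by omega) e (tailPlaces φ.guessed s r)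
  set L := (List.range r).map fun j => 2 + j with hL
  set Tf := ifMaxTime (2 + r) 2 3 L with hTf
  set Tu := r * (r * (2 + r + 9) + (5 * (2 + r) + 40)) with hTu
  refine ⟨.seq (.initRecs V K s r) (.seq (.seq (.shiftAll s r V e fun _ => [])
    (.shiftAll s r V e fun _ => [])) (.loop (.seq c (.ifMax
      (.seq (.op .setZero) (.op (.copy (acc0 σ))))
        (.seq (.op .setZero) (.seq (.op (.copy (acc0 σ))) (.op .incr))) L))
      (.seq (.shiftAll s r V e (tailPlaces φ.guessed s r)) (.incTuple 2 r)))), V, K,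
    3 * Ti + (3 * T₀ + 3 * T₀) + ((3 * Tc + Tf) + (3 * T₁ + Tu) + 2), fun X b hb => ?_⟩
  have hle := hb.le
  have hX := X.pos
  have hNs : 0 < X.card ^ s := Nat.pow_pos hX
  have hNr : 0 < X.card ^ r := Nat.pow_pos hX
  set y₀ : Fin r → Fin X.card := fun _ => ⟨0, hX⟩ with hy₀
  set θ₀ : Table φ.guessed s X.card := fun _ _ _ => 0 with hθ₀
  set Le : Table φ.guessed s X.card → Prop := fun θ => ∀ g b a, θ g b a ≤ X.card with hLe
  set Inv : ℕ → Table φ.guessed s X.card → Regs (numAcc σ) → Prop := fun i θ m =>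
    ∃ y : Fin r → Fin X.card, lexNum y = i ∧ ∃ p, MRep X V K (symIdx e) p y θ m with hInv
  set Mid : ℕ → Table φ.guessed s X.card → Regs (numAcc σ) → Prop := fun i θ m =>
    (∃ y : Fin r → Fin X.card, lexNum y = i ∧ ∃ p, MRep X V K (symIdx e) p y θ m) ∧
      (m.A = m.B (acc0 σ) ↔ i = X.card ^ r - 1) with hMid
  set ρ₁ : ℕ → Table φ.guessed s X.card → Table φ.guessed s X.card → Prop := fun i θ θ' =>
    θ' = θ ∧ ∀ y : Fin r → Fin X.card, lexNum y = i → ∀ x, φ.matrix.HoldsT X θ x y ∧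
      Coherent θ x y with hρ₁
  set ρ₂ : ℕ → Table φ.guessed s X.card → Table φ.guessed s X.card → Prop := fun i θ θ' =>
    ∀ y : Fin r → Fin X.card, lexNum y = i → NextTable y θ θ' with hρ₂
  -- the initial tables are arbitrary
  have hstart : Spec X b (.seq (.shiftAll s r V e fun _ => []) (.shiftAll s r V e fun _ => []))
      ((X.card ^ s + 2) * T₀ + (X.card ^ s + 2) * T₀)
      (fun m => ∃ p, MRep X V K (symIdx e) p y₀ θ₀ m) (fun θ : {θ // Le θ} => Inv 0 θ.1) := by
    have hl₀ : lexNum y₀ = 0 := (lexNum_eq_zero_iff y₀).2 fun _ => rfl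
    refine (Spec.seq (h₀ X b y₀ θ₀ hb) fun θ => (h₀ X b y₀ θ.1 hb).pre fun m hm =>
      ⟨_, hm⟩).conseq (fun _ => id) le_rfl ?_ ?_
    · rintro ⟨⟨θ₁, r₁⟩, ⟨θ₂, r₂⟩⟩
      have e₁ := fun g a => ((r₁ g a).1 trivial).1 (by simp)
      have e₂ := fun g a => ((r₂ g a).1 trivial).1 (by simp)
      simp only at e₁ e₂
      refine ⟨⟨θ₂, fun g b a => ?_⟩, fun m hm => ⟨y₀, hl₀, _, hm⟩⟩
      cases b
      · rw [(e₂ g a).1]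
        exact (e₁ g a).2
      · exact (e₂ g a).2
    · rintro ⟨θ, hθ⟩
      -- Two shifts reach any initial table: the first guesses the entries which the second moves to
      -- the copy `false`, and the second guesses the copy `true`.
      refine ⟨⟨⟨fun g b a => if b then θ g false a else 0, fun g a =>
        ⟨fun _ => ⟨fun _ => ?_, fun h => (h (by simp)).elim⟩, by simp⟩⟩, ⟨θ, fun g a =>
        ⟨fun _ => ⟨fun _ => ?_, fun h => (h (by simp)).elim⟩, by simp⟩⟩⟩,
        fun m hm => ⟨y₀, hl₀, _, hm⟩⟩
      · simpa [hθ₀] using hθ g false a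
      · simpa using hθ g true a
  have hpre : ∀ i ≤ X.card ^ r - 1, ∀ θ, Spec X b (.seq c (.ifMax
      (.seq (.op .setZero) (.op (.copy (acc0 σ))))
        (.seq (.op .setZero) (.seq (.op (.copy (acc0 σ))) (.op .incr))) L))
      ((X.card ^ s + 2) * Tc + Tf) (Inv i θ) (fun θ' : {θ' // ρ₁ i θ θ'} => Mid i θ') := by
    intro i hi θ
    refine Spec.exists_pre fun y => Spec.pure_pre fun hy => ?_
    have hflag : Det X b (.ifMax (.seq (.op .setZero) (.op (.copy (acc0 σ))))
        (.seq (.op .setZero) (.seq (.op (.copy (acc0 σ))) (.op .incr))) L) Tf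
        (MRep X V K (symIdx e) (X.card ^ s) y θ) (Mid i θ) := by
      refine Spec.exists_pre fun S => Spec.pure_pre fun hS => ?_
      have hcond : (∀ i ∈ L, S.num i = X.card - 1) ↔ i = X.card ^ r - 1 := by
        have : i = X.card ^ r - 1 ↔ lexNum y + 1 = X.card ^ r := by omega
        rw [this, lexNum_add_one_eq_iff]
        simp only [hL, List.mem_map, List.mem_range, forall_exists_index, and_imp]
        constructor
        · intro h j
          rw [← h _ j j.2 rfl, hS.y]
        · rintro h _ j hj rfl
          rw [hS.y ⟨j, hj⟩, h]
      refine Spec.ifMax (S := S) (V := V) (K := K) (k := 2 + r) (hb.mono hS.size.le) (by omega)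
        ?_ (fun h => ?_) fun h => ?_
      · simp only [hL, List.mem_map, List.mem_range, forall_exists_index, and_imp]
        rintro _ j hj rfl
        exact ⟨by omega, by rw [hS.y ⟨j, hj⟩]; exact (y _).2⟩
      · rw [hcond] at h
        refine Spec.post (Det.seq (Det.setZero (F := RepF X V K (2 + r) S)) (Det.copy
          (F' := fun B R => Rep X.card V K (2 + r) S R ∧ B (acc0 σ) = 0)
          fun B R h => ⟨h, by simp⟩)) fun _ m hm => ⟨⟨y, hy, _, S, hS, hm.1.1⟩, ?_⟩
        rw [hm.1.2, hm.2]
        simp [h]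
      · rw [hcond] at h
        refine Spec.post (Det.seq (Det.setZero (F := RepF X V K (2 + r) S)) (Det.seq (Det.copy
          (F' := fun B R => Rep X.card V K (2 + r) S R ∧ B (acc0 σ) = 0)
          fun B R h => ⟨h, by simp⟩) (Det.incr (by omega)))) fun _ m hm =>
            ⟨⟨y, hy, _, S, hS, hm.1.1⟩, ?_⟩
        rw [hm.1.2, hm.2]
        simp [h]
    refine (Spec.seq_det (hc X b y θ hb) fun _ => hflag).conseq (fun _ => id) le_rfl ?_ ?_
    · intro h
      refine ⟨⟨θ, rfl, fun y' hy' x => ?_⟩, fun _ => id⟩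
      obtain rfl := lexNum_injective (hy'.trans hy.symm)
      exact ⟨(h x).1, (hχ _ _ _ _).1 (h x).2⟩
    · rintro ⟨_, rfl, h⟩
      exact ⟨fun x => ⟨(h y hy x).1, (hχ _ _ _ _).2 (h y hy x).2⟩, fun _ => id⟩
  have hbody : ∀ i < X.card ^ r - 1, ∀ θ, Spec X b
      (.seq (.shiftAll s r V e (tailPlaces φ.guessed s r)) (.incTuple 2 r))
      ((X.card ^ s + 2) * T₁ + Tu) (Mid i θ)
      (fun θ' : {θ' // ρ₂ i θ θ'} => Inv (i + 1) θ') := by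
    intro i hi θ
    refine Spec.pre ?_ fun m hm => hm.1
    refine Spec.exists_pre fun y => Spec.pure_pre fun hy => ?_
    have hinc : ∀ θ' : Table φ.guessed s X.card, Det X b (.incTuple 2 r) Tu
        (MRep X V K (symIdx e) (X.card ^ s) y θ') (Inv (i + 1) θ') := by
      intro θ'
      refine Spec.exists_pre fun S => Spec.pure_pre fun hS => ?_
      have hlast : ¬ ∀ j, (y j).val = X.card - 1 := by
        rw [← lexNum_add_one_eq_iff]
        omega
      obtain ⟨f, hf, hd⟩ := Det.incTuple (X := X) (b := b) (V := V) (K := K) (k := 2 + r)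
        (S := S) (i := 2) (δ := r) (a := y) (hb.mono hS.size.le) (by omega) le_rfl hS.y hlast
      refine hd.post fun _ m hm => ⟨lexSucc y, by rw [lexNum_lexSucc hlast, hy], X.card ^ s, _,
        ?_, hm⟩
      refine ⟨hS.size, ?_, ?_, fun j => ?_, hS.dig, hS.tab⟩
      · simp only [VarState.setMany]
        rw [if_neg (by omega)]
        exact hS.ptr
      · simp only [VarState.setMany]
        rw [if_neg (by omega)]
        exact hS.fin
      · simp only [VarState.setMany]
        rw [if_pos (by omega), ← hf]
        congr 1
        omega
    refine (Spec.seq_det (h₁ X b y θ hb) fun θ' => hinc θ'.1).conseq (fun _ => id) le_rfl ?_ ?_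
    · rintro ⟨θ', h⟩
      refine ⟨⟨θ', fun y' hy' => ?_⟩, fun _ => id⟩
      obtain rfl := lexNum_injective (hy'.trans hy.symm)
      exact h
    · rintro ⟨θ', h⟩
      exact ⟨⟨θ', h y hy⟩, fun _ => id⟩
  have hloop := fun θ : {θ // Le θ} => Spec.loop (M := X.card ^ r - 1) hpre
    (fun i _ θ m hm => hm.2) hbody (X.card ^ r - 1) 0 (zero_add _) θ.1
  have key : X.Satisfies φ ↔ ∃ (θ : {θ // Le θ}) (θ' : _),
      LoopRel ρ₁ ρ₂ 0 (X.card ^ r - 1) θ.1 θ' := by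
    rw [satisfies_iff_exists_tables]
    constructor
    · rintro ⟨Θ, h0, hn, hh⟩
      refine ⟨⟨Θ 0, h0⟩, Θ (X.card ^ r - 1), LoopRel.exists_seq.2 ⟨Θ, Θ, rfl, rfl,
        fun j hj => ⟨rfl, ?_⟩, fun j hj => ?_⟩⟩
      · rw [zero_add]
        exact hh j hj
      · rw [zero_add]
        exact hn j hj
    · rintro ⟨⟨θ, hθ⟩, θ', h⟩
      obtain ⟨f, f', h0, -, hh, hn⟩ := LoopRel.exists_seq.1 h
      simp only [zero_add] at hh hn
      refine ⟨f, fun g b a => ?_, fun i hi => ?_, fun i hi => (hh i hi).2⟩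
      · rw [h0]
        exact hθ g b a
      · have := hn i hi
        rwa [(hh i hi.le).1] at this
  refine (Det.seq (hi X b hb) (Spec.seq hstart hloop)).conseq (fun _ => id) ?_ ?_ ?_
  · have e₁ : X.card ^ r - 1 + 1 = X.card ^ r := Nat.sub_add_cancel hNr
    rw [e₁, pow_add]
    have h₁ : ∀ T, (X.card ^ s + 2) * T ≤ X.card ^ s * X.card ^ r * (3 * T) := by
      intro T
      have : X.card ^ s + 2 ≤ X.card ^ s * X.card ^ r * 3 := by nlinarith
      calc _ ≤ X.card ^ s * X.card ^ r * 3 * T := Nat.mul_le_mul_right _ this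
        _ = _ := by ring
    have h₂ : X.card ^ r * ((X.card ^ s + 2) * Tc + Tf + ((X.card ^ s + 2) * T₁ + Tu) + 2) ≤
        X.card ^ s * X.card ^ r * (3 * Tc + Tf + (3 * T₁ + Tu) + 2) := by
      rw [mul_comm (X.card ^ s), mul_assoc]
      refine Nat.mul_le_mul_left _ ?_
      have : X.card ^ s + 2 ≤ X.card ^ s * 3 := by omega
      have h₃ := Nat.mul_le_mul_right Tc this
      have h₄ := Nat.mul_le_mul_right T₁ this
      have h₅ := Nat.mul_le_mul_right (Tf + Tu + 2) hNs
      linarith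
    have h₃ := h₁ Ti
    have h₄ := h₁ T₀
    linarith
  · rintro ⟨θ, θ', h⟩
    exact ⟨key.2 ⟨θ, θ', h⟩, fun _ _ => trivial⟩
  · intro h
    obtain ⟨θ, θ', h⟩ := key.1 h
    exact ⟨⟨θ, θ', h⟩, fun _ _ => trivial⟩

/-- Every problem defined by a formula of `ESO(s,r)` belongs to `NTISP(n^{s+r}, n^s)`. -/
theorem mem_NTISP_of_ESO (hs : 1 ≤ s) (P : Problem σ) (φ : ESO σ s r)
    (hφ : ∀ X : FinStr σ, X ∈ P ↔ X.Satisfies φ) :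
    P ∈ NTISP σ (fun n => n ^ (s + r)) (fun n => n ^ s) := by
  obtain ⟨c, V, K, T, h⟩ := exists_program hs φ
  -- `T + 1` covers the time including `accept`. The remaining summand covers the numbers, because n
  -- ≤ n^s by s ≥ 1 and 1 ≤ n^s.
  refine mem_NTISP_of_cmd c (T + 1 + (2 + V + 2 * K)) (fun n => n + 1 + V + K * n ^ s + K)
    (fun n hn => ?_) (fun X k m he => ?_) fun X hX => ?_
  · have h₁ : n ≤ n ^ s := Nat.le_self_pow (by omega) n
    have h₂ : 0 < n ^ s := Nat.pow_pos hn
    nlinarith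
  · obtain ⟨h, -⟩ := (h X _ le_rfl _ rfl).1 k m he
    exact (hφ X).2 h
  · have hl : (Regs.init (numAcc σ)).Le (recAddr X.card V K (X.card ^ s) + K) :=
      ⟨Nat.zero_le _, fun _ => Nat.zero_le _, fun _ => Nat.zero_le _⟩
    obtain ⟨k, hk, m, he, -⟩ := (h X _ le_rfl _ rfl).2 hl ((hφ X).1 hX)
    refine ⟨k, m, ?_, he⟩
    have : 0 < X.card ^ (s + r) := Nat.pow_pos X.pos
    nlinarith

end Program

end TimeSpace

namespace TimeSpace

/-! ### Numbers as tuples -/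

section Numbers

variable {σ : FirstOrder.Language.{u, v}} {J : Type} {C s r : ℕ}

theorem mul_pow_add_lexNum_inj {n k k' : ℕ} {a a' : Fin s → Fin n}
    (h : k * n ^ s + lexNum a = k' * n ^ s + lexNum a') : k = k' ∧ a = a' := by
  have h₁ := lexNum_lt a
  have h₂ := lexNum_lt a'
  have h₃ : k = k' := by
    have := congrArg (· / n ^ s) h
    simpa [Nat.mul_comm _ (n ^ s), Nat.mul_add_div (show 0 < n ^ s by omega),
      Nat.div_eq_of_lt h₁, Nat.div_eq_of_lt h₂] using this
  subst h₃
  exact ⟨rfl, lexNum_injective (by omega)⟩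

theorem exists_mul_pow_add_lexNum {n v : ℕ} (hv : v < C * n ^ s) :
    ∃ (k : Fin C) (a : Fin s → Fin n), v = k * n ^ s + lexNum a := by
  have hn : 0 < n ^ s := Nat.pos_of_ne_zero fun h => by simp [h] at hv
  obtain ⟨a, ha⟩ := exists_lexNum_eq (Nat.mod_lt v hn)
  refine ⟨⟨v / n ^ s, Nat.div_lt_of_lt_mul (by rwa [mul_comm])⟩, a, ?_⟩
  rw [ha]
  exact (Nat.div_add_mod' v _).symm

theorem mul_pow_add_lexNum_lt {n : ℕ} (k : Fin C) (a : Fin s → Fin n) :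
    k * n ^ s + lexNum a < C * n ^ s := by
  have h₁ := lexNum_lt a
  have h₂ : (k.val + 1) * n ^ s ≤ C * n ^ s := Nat.mul_le_mul_right _ k.2
  rw [Nat.succ_mul] at h₂
  omega

/-- A language for functions `F j`, for `j : J`, which map pairs of numbers less than `C * n ^ s`
and `n ^ r` to numbers less than `C * n ^ s`: for each leading digit `k < C` of the first argument,
functions for the other digits of the value and relations for its leading digit. -/
def certLang (J : Type) (C s r : ℕ) : FirstOrder.Language.{0, 0} where
  Functions k := {_p : J × Fin C × Fin s // k = s + r}
  Relations k := {_p : J × Fin C × Fin C // k = s + r}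

instance [Finite J] : Finite (certLang J C s r).Symbols := by
  refine Finite.of_injective (β := (J × Fin C × Fin s) ⊕ (J × Fin C × Fin C))
    (fun q => match q with
      | Sum.inl ⟨_, p⟩ => Sum.inl p.1
      | Sum.inr ⟨_, p⟩ => Sum.inr p.1) ?_
  rintro (⟨k, p, rfl⟩ | ⟨k, p, rfl⟩) (⟨k', p', rfl⟩ | ⟨k', p', rfl⟩) h <;> simp at h <;> subst h <;>
    rfl

theorem symArity_certLang (q : (certLang J C s r).Symbols) :
    symArity (certLang J C s r) q ≤ s + r := by
  obtain ⟨k, p, h⟩ | ⟨k, p, h⟩ := q <;> exact h.le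

/-- The least `k` for which `b k` is true, and `0` if there is none. -/
def IsOut (b : Fin C → Prop) (k : Fin C) : Prop :=
  (b k ∧ ∀ k' < k, ¬b k') ∨ (k.val = 0 ∧ ∀ k', ¬b k')

/-- Together with `IsOut.exists` this makes every interpretation of the relations determine exactly
one leading digit, so the formula need not demand it. -/
theorem IsOut.unique {b : Fin C → Prop} {k k' : Fin C} (h : IsOut b k) (h' : IsOut b k') :
    k = k' := by
  rcases h with ⟨h₁, h₂⟩ | ⟨h₁, h₂⟩ <;> rcases h' with ⟨h₃, h₄⟩ | ⟨h₃, h₄⟩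
  · exact le_antisymm (not_lt.1 fun h => h₂ _ h h₃) (not_lt.1 fun h => h₄ _ h h₁)
  · exact (h₄ _ h₁).elim
  · exact (h₂ _ h₃).elim
  · exact Fin.ext (h₁.trans h₃.symm)

theorem IsOut.exists (hC : 0 < C) (b : Fin C → Prop) : ∃ k, IsOut b k := by
  by_cases h : ∃ k, b k
  · obtain ⟨k, hk, hm⟩ := WellFounded.has_min (wellFounded_lt (α := Fin C)) {k | b k} h
    exact ⟨k, Or.inl ⟨hk, fun k' hk' hb => hm k' hb hk'⟩⟩
  · exact ⟨⟨0, hC⟩, Or.inr ⟨rfl, fun k hk => h ⟨k, hk⟩⟩⟩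

/-- The relations which give the leading digit of a value. -/
def leadBits {n : ℕ} (I : (certLang J C s r).Structure (Fin n)) (j : J) (k : Fin C)
    (x : Fin s → Fin n) (y : Fin r → Fin n) (k' : Fin C) : Prop :=
  I.RelMap (⟨(j, k, k'), rfl⟩ : (certLang J C s r).Relations (s + r)) (Fin.append x y)

/-- The other digits of a value. -/
def valDigits {n : ℕ} (I : (certLang J C s r).Structure (Fin n)) (j : J) (k : Fin C)
    (x : Fin s → Fin n) (y : Fin r → Fin n) (i : Fin s) : Fin n :=
  I.funMap (⟨(j, k, i), rfl⟩ : (certLang J C s r).Functions (s + r)) (Fin.append x y)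

/-- The structure `I` represents the functions `F`. -/
def Decodes {n : ℕ} (I : (certLang J C s r).Structure (Fin n)) (F : J → ℕ → ℕ → ℕ) : Prop :=
  ∀ (j : J) (k : Fin C) (x : Fin s → Fin n) (y : Fin r → Fin n) (k' : Fin C),
    IsOut (leadBits I j k x y) k' →
      F j (k * n ^ s + lexNum x) (lexNum y) = k' * n ^ s + lexNum (valDigits I j k x y)

/-- The range of the values is built into the representation and need not be enforced by a formula.
-/
theorem Decodes.lt {n : ℕ} {I : (certLang J C s r).Structure (Fin n)} {F : J → ℕ → ℕ → ℕ}
    (h : Decodes I F) (j : J) {v w : ℕ} (hv : v < C * n ^ s) (hw : w < n ^ r) :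
    F j v w < C * n ^ s := by
  obtain ⟨k, x, rfl⟩ := exists_mul_pow_add_lexNum hv
  obtain ⟨y, rfl⟩ := exists_lexNum_eq hw
  obtain ⟨k', hk'⟩ := IsOut.exists k.pos (leadBits I j k x y)
  rw [h j k x y k' hk']
  exact mul_pow_add_lexNum_lt _ _

/-- The digits of an argument are unique, so the prescribed values cannot conflict; arguments out of
range get the value 0. -/
theorem exists_decodes {n : ℕ} (I : (certLang J C s r).Structure (Fin n)) :
    ∃ F : J → ℕ → ℕ → ℕ, Decodes I F := by
  classical
  refine ⟨fun j v w => if h : ∃ (k : Fin C) (x : Fin s → Fin n) (y : Fin r → Fin n) (k' : Fin C),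
      IsOut (leadBits I j k x y) k' ∧ v = k * n ^ s + lexNum x ∧ w = lexNum y then
      h.choose_spec.choose_spec.choose_spec.choose * n ^ s +
        lexNum (valDigits I j h.choose h.choose_spec.choose h.choose_spec.choose_spec.choose)
    else 0, fun j k x y k' hk' => ?_⟩
  have h : ∃ (k₁ : Fin C) (x₁ : Fin s → Fin n) (y₁ : Fin r → Fin n) (k' : Fin C),
      IsOut (leadBits I j k₁ x₁ y₁) k' ∧ k * n ^ s + lexNum x = k₁ * n ^ s + lexNum x₁ ∧
        lexNum y = lexNum y₁ := ⟨k, x, y, k', hk', rfl, rfl⟩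
  simp only
  rw [dif_pos h]
  obtain ⟨h₁, h₂, h₃⟩ := h.choose_spec.choose_spec.choose_spec.choose_spec
  generalize h.choose_spec.choose_spec.choose_spec.choose = k₂ at *
  generalize h.choose_spec.choose_spec.choose = y₁ at *
  generalize h.choose_spec.choose = x₁ at *
  generalize h.choose = k₁ at *
  obtain ⟨e₁, rfl⟩ := mul_pow_add_lexNum_inj h₂
  obtain rfl := Fin.ext e₁
  obtain rfl := lexNum_injective h₃
  obtain rfl := h₁.unique hk'
  rfl

/-- Division of a value by n^s yields the leading digit as quotient, below C by the bound on F, and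
the other digits from the remainder. -/
theorem exists_structure {n : ℕ} (hn : 0 < n) (F : J → ℕ → ℕ → ℕ)
    (hF : ∀ j, ∀ v < C * n ^ s, ∀ w < n ^ r, F j v w < C * n ^ s) :
    ∃ I : (certLang J C s r).Structure (Fin n), Decodes I F := by
  have hN : 0 < n ^ s := Nat.pow_pos hn
  set val : J → Fin C → (Fin (s + r) → Fin n) → ℕ := fun j k a =>
    F j (k * n ^ s + lexNum fun i => a (Fin.castAdd r i)) (lexNum fun i => a (Fin.natAdd s i))
  let I : (certLang J C s r).Structure (Fin n) := ⟨fun g a => (lexEquiv n s).symm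
    ⟨val g.1.1 g.1.2.1 (fun i => a (Fin.cast g.2.symm i)) % n ^ s, Nat.mod_lt _ hN⟩ g.1.2.2,
    fun g a => val g.1.1 g.1.2.1 (fun i => a (Fin.cast g.2.symm i)) / n ^ s = g.1.2.2⟩
  refine ⟨I, fun j k x y k' hk' => ?_⟩
  have hv : val j k (Fin.append x y) = F j (k * n ^ s + lexNum x) (lexNum y) := by simp [val]
  have h₁ : ∀ k', leadBits I j k x y k' ↔ F j (k * n ^ s + lexNum x) (lexNum y) / n ^ s = k' := by
    intro k'
    rw [← hv]
    rfl
  have h₂ : valDigits I j k x y = (lexEquiv n s).symm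
      ⟨F j (k * n ^ s + lexNum x) (lexNum y) % n ^ s, Nat.mod_lt _ hN⟩ := by
    simp only [← hv]
    rfl
  rw [h₂, lexNum_lexEquiv_symm]
  have hlt := hF j _ (mul_pow_add_lexNum_lt k x) _ (lexNum_lt y)
  rw [mul_comm C] at hlt
  have : F j (k * n ^ s + lexNum x) (lexNum y) / n ^ s = k' := by
    rcases hk' with ⟨h, -⟩ | ⟨-, h⟩
    · exact (h₁ k').1 h
    · exact (h ⟨_, Nat.div_lt_of_lt_mul hlt⟩ ((h₁ _).2 rfl)).elim
  rw [← this]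
  exact (Nat.div_add_mod' _ _).symm

end Numbers

/-! ### Definable numbers and properties -/

section Definable

variable {σ : FirstOrder.Language.{u, v}} {J : Type} {C s r : ℕ}

/-- A structure with the represented functions and values of the variables. -/
structure Env (σ : FirstOrder.Language.{u, v}) (J : Type) (C s r : ℕ) where
  X : FinStr σ
  I : (certLang J C s r).Structure (Fin X.card)
  F : J → ℕ → ℕ → ℕ
  dec : Decodes I F
  x : Fin s → Fin X.card
  y : Fin r → Fin X.card

/-- A term which may occur in the definitions. -/
abbrev CTerm (σ : FirstOrder.Language.{u, v}) (J : Type) (C s r : ℕ) :=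
  RTerm σ (certLang J C s r) s r

/-- A formula which may occur in the definitions. -/
abbrev CFormula (σ : FirstOrder.Language.{u, v}) (J : Type) (C s r : ℕ) :=
  RFormula σ (certLang J C s r) s r

abbrev Env.holds (e : Env σ J C s r) (φ : CFormula σ J C s r) : Prop := φ.Holds e.X e.I e.x e.y

/-- The number with leading digit `k` and other digits `τ`. -/
noncomputable def Env.num (e : Env σ J C s r) (k : Fin C) (τ : Fin s → CTerm σ J C s r) : ℕ :=
  k * e.X.card ^ s + lexNum fun i => (τ i).val e.X e.I e.x e.y

/-- Under the assumption `Q`, the property `P` is expressed by a formula. -/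
def LDef (Q P : Env σ J C s r → Prop) : Prop :=
  ∃ φ : CFormula σ J C s r, ∀ e, Q e → (e.holds φ ↔ P e)

/-- Under the assumption `Q`, the number `g` is given by a definition by cases. -/
def LNum (Q : Env σ J C s r → Prop) (g : Env σ J C s r → ℕ) : Prop :=
  ∃ L : List (CFormula σ J C s r × Fin C × (Fin s → CTerm σ J C s r)), ∀ e, Q e →
    (∃ c ∈ L, e.holds c.1) ∧ ∀ c ∈ L, e.holds c.1 → g e = e.num c.2.1 c.2.2

variable {Q Q' P P' : Env σ J C s r → Prop} {g h : Env σ J C s r → ℕ}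

theorem LDef.mono (hP : LDef Q P) (hQ : ∀ e, Q' e → Q e) : LDef Q' P := by
  obtain ⟨φ, hφ⟩ := hP
  exact ⟨φ, fun e he => hφ e (hQ e he)⟩

theorem LDef.congr (hP : LDef Q P) (h : ∀ e, Q e → (P e ↔ P' e)) : LDef Q P' := by
  obtain ⟨φ, hφ⟩ := hP
  exact ⟨φ, fun e he => (hφ e he).trans (h e he)⟩

theorem LDef.const (Q : Env σ J C s r → Prop) (p : Prop) : LDef Q (fun _ => p) := by
  by_cases h : p
  · exact ⟨.eq .zero .zero, fun e _ => by simp [Env.holds, RFormula.Holds, h]⟩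
  · exact ⟨.not (.eq .zero .zero), fun e _ => by simp [Env.holds, RFormula.Holds, h]⟩

theorem LDef.not (h : LDef Q P) : LDef Q (fun e => ¬P e) := by
  obtain ⟨φ, hφ⟩ := h
  exact ⟨.not φ, fun e he => not_congr (hφ e he)⟩

theorem LDef.and (h : LDef Q P) (h' : LDef Q P') : LDef Q (fun e => P e ∧ P' e) := by
  obtain ⟨φ, hφ⟩ := h
  obtain ⟨φ', hφ'⟩ := h'
  exact ⟨.and φ φ', fun e he => and_congr (hφ e he) (hφ' e he)⟩

theorem LDef.or (h : LDef Q P) (h' : LDef Q P') : LDef Q (fun e => P e ∨ P' e) := by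
  obtain ⟨φ, hφ⟩ := h
  obtain ⟨φ', hφ'⟩ := h'
  exact ⟨.or φ φ', fun e he => or_congr (hφ e he) (hφ' e he)⟩

/-- The conclusion has to be definable only where the premise holds; this admits numbers such as t +
1 that are defined only below a bound. -/
theorem LDef.imp (h : LDef Q P) (h' : LDef (fun e => Q e ∧ P e) P') :
    LDef Q (fun e => P e → P' e) := by
  obtain ⟨φ, hφ⟩ := h
  obtain ⟨φ', hφ'⟩ := h'
  refine ⟨.or (.not φ) φ', fun e he => ?_⟩
  by_cases hp : P e
  · have h₁ := (hφ e he).2 hp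
    have h₂ := hφ' e ⟨he, hp⟩
    simp only [Env.holds] at h₁ h₂
    simp [Env.holds, RFormula.Holds, h₁, h₂, hp]
  · have h₁ := mt (hφ e he).1 hp
    simp only [Env.holds] at h₁
    simp [Env.holds, RFormula.Holds, h₁, hp]

theorem LDef.all_list {α : Type*} {p : α → Env σ J C s r → Prop} (h : ∀ a, LDef Q (p a))
    (l : List α) : LDef Q (fun e => ∀ a ∈ l, p a e) := by
  induction l with
  | nil => exact (LDef.const Q True).congr fun _ _ => by simp
  | cons a l ih => exact ((h a).and ih).congr fun _ _ => by simp

theorem LDef.all {α : Type*} [Finite α] {p : α → Env σ J C s r → Prop} (h : ∀ a, LDef Q (p a)) :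
    LDef Q (fun e => ∀ a, p a e) := by
  have := Fintype.ofFinite α
  exact (LDef.all_list h Finset.univ.toList).congr fun _ _ => by simp

theorem LDef.ex {α : Type*} [Finite α] {p : α → Env σ J C s r → Prop} (h : ∀ a, LDef Q (p a)) :
    LDef Q (fun e => ∃ a, p a e) :=
  (LDef.all fun a => (h a).not).not.congr fun _ _ => by simp

theorem LDef.term_eq (t t' : CTerm σ J C s r) : LDef Q (fun e =>
    t.val e.X e.I e.x e.y = t'.val e.X e.I e.x e.y) :=
  ⟨.eq t t', fun _ _ => Iff.rfl⟩

theorem LDef.term_zero (t : CTerm σ J C s r) : LDef Q (fun e =>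
    (t.val e.X e.I e.x e.y).val = 0) :=
  (LDef.term_eq t .zero).congr fun e _ => by simp [RTerm.val, Fin.ext_iff]

theorem LDef.term_max (t : CTerm σ J C s r) : LDef Q (fun e =>
    (t.val e.X e.I e.x e.y).val = e.X.card - 1) :=
  (LDef.term_eq (.succ t) t).congr fun e _ => by simp only [RTerm.val, succFin_eq_self_iff]

/-- In each case of the definition of `g` its digits are given by fixed terms. The formula is the
disjunction, over the cases, of the case condition with the formula that is valid for these terms.
-/
theorem LDef.bind (hg : LNum Q g)
    (hP : ∀ k τ, LDef (fun e => Q e ∧ g e = e.num k τ) P) : LDef Q P := by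
  obtain ⟨L, hL⟩ := hg
  choose φ hφ using hP
  have key : ∀ l : List (CFormula σ J C s r × Fin C × (Fin s → CTerm σ J C s r)),
      ∃ ψ : CFormula σ J C s r, ∀ e : Env σ J C s r, e.holds ψ ↔ ∃ c ∈ l, e.holds c.1 ∧
        e.holds (φ c.2.1 c.2.2) := by
    intro l
    induction l with
    | nil => exact ⟨.not (.eq .zero .zero), fun e => by simp [Env.holds, RFormula.Holds]⟩
    | cons c l ih =>
      obtain ⟨ψ, hψ⟩ := ih
      refine ⟨.or (.and c.1 (φ c.2.1 c.2.2)) ψ, fun e => ?_⟩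
      simp only [List.mem_cons, exists_eq_or_imp, ← hψ]
      rfl
  obtain ⟨ψ, hψ⟩ := key L
  refine ⟨ψ, fun e he => ?_⟩
  rw [hψ]
  obtain ⟨⟨c, hc, hc'⟩, h₂⟩ := hL e he
  constructor
  · rintro ⟨c, hc, h₃, h₄⟩
    exact (hφ _ _ e ⟨he, h₂ c hc h₃⟩).1 h₄
  · exact fun hp => ⟨c, hc, hc', (hφ _ _ e ⟨he, h₂ c hc hc'⟩).2 hp⟩

theorem LNum.mono (hg : LNum Q g) (hQ : ∀ e, Q' e → Q e) : LNum Q' g := by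
  obtain ⟨L, hL⟩ := hg
  exact ⟨L, fun e he => hL e (hQ e he)⟩

theorem LNum.congr (hg : LNum Q g) (hh : ∀ e, Q e → g e = h e) : LNum Q h := by
  obtain ⟨L, hL⟩ := hg
  exact ⟨L, fun e he => ⟨(hL e he).1, fun c hc hc' => (hh e he).symm.trans ((hL e he).2 c hc hc')⟩⟩

theorem LNum.num (k : Fin C) (τ : Fin s → CTerm σ J C s r) : LNum Q (fun e => e.num k τ) :=
  ⟨[(.eq .zero .zero, k, τ)], fun e _ => by simp [Env.holds, RFormula.Holds]⟩

theorem LNum.bind (hg : LNum Q g)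
    (hh : ∀ k τ, LNum (fun e => Q e ∧ g e = e.num k τ) h) : LNum Q h := by
  obtain ⟨L, hL⟩ := hg
  choose L' hL' using hh
  refine ⟨L.flatMap fun c => (L' c.2.1 c.2.2).map fun c' => (.and c.1 c'.1, c'.2), fun e he => ?_⟩
  obtain ⟨⟨c, hc, hc'⟩, h₂⟩ := hL e he
  constructor
  · obtain ⟨⟨d, hd, hd'⟩, -⟩ := hL' _ _ e ⟨he, h₂ c hc hc'⟩
    exact ⟨_, List.mem_flatMap.2 ⟨c, hc, List.mem_map.2 ⟨d, hd, rfl⟩⟩, hc', hd'⟩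
  · rintro _ hm hh
    obtain ⟨c, hc, hm⟩ := List.mem_flatMap.1 hm
    obtain ⟨d, hd, rfl⟩ := List.mem_map.1 hm
    exact (hL' _ _ e ⟨he, h₂ c hc hh.1⟩).2 d hd hh.2

theorem LNum.ite [∀ e, Decidable (P e)] (hP : LDef Q P) (hg : LNum (fun e => Q e ∧ P e) g)
    (hh : LNum (fun e => Q e ∧ ¬P e) h) : LNum Q (fun e => if P e then g e else h e) := by
  obtain ⟨φ, hφ⟩ := hP
  obtain ⟨L, hL⟩ := hg
  obtain ⟨L', hL'⟩ := hh
  refine ⟨L.map (fun c => (.and φ c.1, c.2)) ++ L'.map (fun c => (.and (.not φ) c.1, c.2)),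
    fun e he => ?_⟩
  simp only [List.mem_append, List.mem_map]
  by_cases hp : P e
  · obtain ⟨⟨c, hc, hc'⟩, h₂⟩ := hL e ⟨he, hp⟩
    refine ⟨⟨_, Or.inl ⟨c, hc, rfl⟩, (hφ e he).2 hp, hc'⟩, ?_⟩
    rintro _ (⟨c, hc, rfl⟩ | ⟨c, hc, rfl⟩) hh
    · rw [if_pos hp]
      exact h₂ c hc hh.2
    · exact (hh.1 ((hφ e he).2 hp)).elim
  · obtain ⟨⟨c, hc, hc'⟩, h₂⟩ := hL' e ⟨he, hp⟩
    refine ⟨⟨_, Or.inr ⟨c, hc, rfl⟩, fun h => hp ((hφ e he).1 h), hc'⟩, ?_⟩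
    rintro _ (⟨c, hc, rfl⟩ | ⟨c, hc, rfl⟩) hh
    · exact (hp ((hφ e he).1 hh.1)).elim
    · rw [if_neg hp]
      exact h₂ c hc hh.2

theorem LDef.eq (hg : LNum Q g) (hh : LNum Q h) : LDef Q (fun e => g e = h e) := by
  refine LDef.bind hg fun k τ => LDef.bind (hh.mono fun e he => he.1) fun k' τ' => ?_
  refine ((LDef.const _ (k = k')).and (LDef.all fun i => LDef.term_eq (τ i) (τ' i))).congr ?_
  rintro e ⟨⟨-, h₁⟩, h₂⟩
  rw [h₁, h₂]
  constructor
  · rintro ⟨rfl, h⟩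
    simp only [Env.num, h]
  · intro h
    obtain ⟨h₁, h₂⟩ := mul_pow_add_lexNum_inj h
    exact ⟨Fin.ext h₁, fun i => congrFun h₂ i⟩

theorem LNum.zero (hC : 0 < C) : LNum Q (fun _ => 0) :=
  (LNum.num ⟨0, hC⟩ fun _ => .zero).congr fun e _ => by
    simp [Env.num, RTerm.val, lexNum_eq_zero_iff]

/-- The application of a function symbol to `(a, y)`, or `(a, succ(y))`. -/
noncomputable def appTerm (p : J × Fin C × Fin s) (a : Fin s → CTerm σ J C s r) (next : Bool) :
    CTerm σ J C s r :=
  -- For r = 0 there is no vector y, and the symbol of arity s + 0 has to be applied as one of low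
  -- arity.
  if hr : 1 ≤ r then .guessHigh hr le_rfl ⟨p, rfl⟩ a next
  else .guessLow (k := s + r) (by omega) ⟨p, rfl⟩ fun i => a ⟨i, by omega⟩

/-- The application of a relation symbol to `(a, y)`, or `(a, succ(y))`. -/
noncomputable def appFormula (p : J × Fin C × Fin C) (a : Fin s → CTerm σ J C s r) (next : Bool) :
    CFormula σ J C s r :=
  if hr : 1 ≤ r then .guessHigh hr le_rfl ⟨p, rfl⟩ a next
  else .guessLow (k := s + r) (by omega) ⟨p, rfl⟩ fun i => a ⟨i, by omega⟩

/-- The tuple `y`, or its successor. -/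
noncomputable def Env.yNext (e : Env σ J C s r) (next : Bool) : Fin r → Fin e.X.card :=
  if next then lexSucc e.y else e.y

theorem append_of_eq_zero {n : ℕ} (hr : r = 0) (a : Fin s → Fin n) (y : Fin r → Fin n) :
    Fin.append a y = fun i : Fin (s + r) => a ⟨i, by omega⟩ := by
  subst hr
  funext i
  exact (Fin.append_left a y ⟨i, by omega⟩)

theorem val_appTerm (e : Env σ J C s r) (j : J) (k : Fin C) (i : Fin s)
    (a : Fin s → CTerm σ J C s r) (next : Bool) : (appTerm (j, k, i) a next).val e.X e.I e.x e.y =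
      valDigits e.I j k (fun i => (a i).val e.X e.I e.x e.y) (e.yNext next) i := by
  rw [appTerm]
  split_ifs with hr
  · rfl
  · simp only [RTerm.val, valDigits]
    have hr0 : r = 0 := by omega
    rw [append_of_eq_zero hr0]

theorem holds_appFormula (e : Env σ J C s r) (j : J) (k k' : Fin C)
    (a : Fin s → CTerm σ J C s r) (next : Bool) : e.holds (appFormula (j, k, k') a next) ↔
      leadBits e.I j k (fun i => (a i).val e.X e.I e.x e.y) (e.yNext next) k' := by
  rw [appFormula]
  split_ifs with hr
  · rfl
  · simp only [Env.holds, RFormula.Holds, leadBits]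
    have hr0 : r = 0 := by omega
    rw [append_of_eq_zero hr0]

/-- The cases are the possible leading digits of the value; which of them is the right one is a
Boolean combination of applications of the relations. In each case the other digits are applications
of the functions. -/
theorem LNum.app (hg : LNum Q g) (j : J) (next : Bool) :
    LNum Q (fun e => e.F j (g e) (lexNum (e.yNext next))) := by
  refine LNum.bind hg fun k τ => ?_
  have hout : ∀ k' : Fin C, ∃ φ : CFormula σ J C s r, ∀ e : Env σ J C s r, (e.holds φ ↔
      IsOut (leadBits e.I j k (fun i => (τ i).val e.X e.I e.x e.y) (e.yNext next)) k') := by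
    intro k'
    have hb : ∀ k', LDef (fun _ => True) (fun e : Env σ J C s r =>
        leadBits e.I j k (fun i => (τ i).val e.X e.I e.x e.y) (e.yNext next) k') := fun k' =>
      ⟨appFormula (j, k, k') τ next, fun e _ => holds_appFormula e j k k' τ next⟩
    obtain ⟨φ, hφ⟩ := ((hb k').and (LDef.all fun k'' => (LDef.const _ (k'' < k')).imp
      ((hb k'').not.mono fun _ _ => trivial))).or ((LDef.const _ (k'.val = 0)).and (LDef.all fun k'' => (hb k'').not))
    exact ⟨φ, fun e => hφ e trivial⟩
  choose φ hφ using hout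
  refine ⟨(List.finRange C).map fun k' => (φ k', k', fun i => appTerm (j, k, i) τ next),
    fun e he => ⟨?_, ?_⟩⟩
  · obtain ⟨k', hk'⟩ := IsOut.exists k.pos
      (leadBits e.I j k (fun i => (τ i).val e.X e.I e.x e.y) (e.yNext next))
    exact ⟨_, List.mem_map.2 ⟨k', List.mem_finRange _, rfl⟩, (hφ k' e).2 hk'⟩
  · rintro _ hc hh
    obtain ⟨k', -, rfl⟩ := List.mem_map.1 hc
    have := e.dec j k _ _ k' ((hφ k' e).1 hh)
    simp only [he.2, Env.num, val_appTerm]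
    exact this

theorem lexSucc_eq_of_max {n : ℕ} {a : Fin s → Fin n} {i : Fin s} (hi : (a i).val ≠ n - 1)
    (h : ∀ j, i < j → (a j).val = n - 1) : lexSucc a = fun j => if j < i then a j else
      if j = i then succFin (a i) else ⟨0, (a j).pos⟩ := by
  funext j
  have h₀ : ¬ ∀ j, (a j).val = n - 1 := fun h => hi (h i)
  rw [lexSucc, if_neg h₀]
  rcases lt_trichotomy j i with hj | rfl | hj
  · rw [if_neg (fun h => hi (h i hj)), if_pos hj]
  · rw [if_pos h, if_neg hi, if_neg (lt_irrefl _), if_pos rfl]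
  · rw [if_pos (fun j' hj' => h j' (hj.trans hj')), if_pos (h j hj), if_neg hj.not_gt,
      if_neg hj.ne']

theorem exists_last_not_max {n : ℕ} {a : Fin s → Fin n} (h : ¬ ∀ j, (a j).val = n - 1) :
    ∃ i, (a i).val ≠ n - 1 ∧ ∀ j, i < j → (a j).val = n - 1 := by
  push Not at h
  obtain ⟨i, hi, hm⟩ := WellFounded.has_min (wellFounded_gt (α := Fin s))
    {i | (a i).val ≠ n - 1} h
  exact ⟨i, hi, fun j hj => by_contra fun h => hm j h hj⟩

/-- Case distinction by the last component different from n - 1. If there is none, the constant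
leading digit is raised, or the number is the largest one and stays fixed. -/
theorem LNum.succ (hg : LNum Q g) :
    LNum Q (fun e => min (g e + 1) (C * e.X.card ^ s - 1)) := by
  classical
  refine LNum.bind hg fun k τ => ?_
  have hmax : ∀ Q : Env σ J C s r → Prop, LDef Q (fun e =>
      ∀ i, ((τ i).val e.X e.I e.x e.y).val = e.X.card - 1) := fun Q =>
    LDef.all fun i => LDef.term_max (τ i)
  set succTuple : Fin s → Fin s → CTerm σ J C s r := fun i j =>
    if j < i then τ j else if j = i then .succ (τ i) else .zero with hst
  have hnot : LNum (fun e => (Q e ∧ g e = e.num k τ) ∧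
      ¬ ∀ i, ((τ i).val e.X e.I e.x e.y).val = e.X.card - 1) (fun e => g e + 1) := by
    choose φ hφ using fun i => (LDef.term_max (Q := fun _ => True) (τ i)).not.and (LDef.all fun j =>
      (LDef.const _ (i < j)).imp (LDef.term_max (τ j)))
    refine ⟨(List.finRange s).map fun i => (φ i, k, succTuple i), fun e he => ⟨?_, ?_⟩⟩
    · obtain ⟨i, hi⟩ := exists_last_not_max he.2
      exact ⟨_, List.mem_map.2 ⟨i, List.mem_finRange _, rfl⟩, (hφ i e trivial).2 hi⟩
    · rintro _ hc hh
      obtain ⟨i, -, rfl⟩ := List.mem_map.1 hc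
      obtain ⟨h₁, h₂⟩ := (hφ i e trivial).1 hh
      simp only [he.1.2, Env.num]
      rw [add_assoc, ← lexNum_lexSucc he.2, lexSucc_eq_of_max h₁ h₂]
      congr 3
      funext j
      simp only [hst]
      split_ifs <;> simp [RTerm.val]
  have hfull : LNum (fun e => (Q e ∧ g e = e.num k τ) ∧
      ∀ i, ((τ i).val e.X e.I e.x e.y).val = e.X.card - 1)
      (fun e => min (g e + 1) (C * e.X.card ^ s - 1)) := by
    by_cases hk : k.val + 1 < C
    · refine (LNum.num ⟨k.val + 1, hk⟩ fun _ => .zero).congr ?_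
      rintro e ⟨⟨-, h⟩, hm⟩
      have h₁ := (lexNum_add_one_eq_iff fun i => (τ i).val e.X e.I e.x e.y).2 hm
      have h₂ : g e + 1 = (k + 1) * e.X.card ^ s := by
        rw [h, Env.num, add_assoc, h₁]
        ring
      have h₃ : (k.val + 1 + 1) * e.X.card ^ s ≤ C * e.X.card ^ s := Nat.mul_le_mul_right _ hk
      have h₄ : 0 < e.X.card ^ s := Nat.pow_pos e.X.pos
      rw [h₂, min_eq_left (by rw [Nat.succ_mul] at h₃; omega)]
      simp [Env.num, RTerm.val, lexNum_eq_zero_iff]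
    · refine (LNum.num k τ).congr ?_
      rintro e ⟨⟨-, h⟩, hm⟩
      have h₁ := (lexNum_add_one_eq_iff fun i => (τ i).val e.X e.I e.x e.y).2 hm
      have h₂ : g e + 1 = C * e.X.card ^ s := by
        have hk' : C * e.X.card ^ s = (k.val + 1) * e.X.card ^ s :=
          congrArg (· * _) (show C = k.val + 1 by omega)
        rw [h, Env.num, add_assoc, h₁, hk']
        ring
      rw [← h, h₂]
      omega
  refine ((LNum.ite (hmax _) hfull hnot)).congr ?_
  rintro e ⟨-, h⟩
  split_ifs with hm
  · rfl
  · refine (min_eq_left ?_).symm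
    have h₁ := lexNum_lexSucc hm
    have h₂ := mul_pow_add_lexNum_lt k (lexSucc fun i => (τ i).val e.X e.I e.x e.y)
    rw [h₁] at h₂
    rw [h, Env.num]
    omega

/-- Iterated successor of 0, since for small n the number m may need several digits. The cut-off is
not reached because m < C ≤ C·n^s. -/
theorem LNum.const {m : ℕ} (hm : m < C) : LNum Q (fun _ => m) := by
  induction m with
  | zero => exact LNum.zero hm
  | succ m ih =>
    refine (LNum.succ (ih (by omega))).congr fun e _ => ?_
    have : C * 1 ≤ C * e.X.card ^ s := Nat.mul_le_mul_left _ (Nat.pow_pos e.X.pos)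
    omega

theorem LNum.bindFin {m : ℕ} {b : Fin m → Env σ J C s r → ℕ} (hb : ∀ i, LNum Q (b i))
    (hh : ∀ (κ : Fin m → Fin C) (τ : Fin m → Fin s → CTerm σ J C s r),
      LNum (fun e => Q e ∧ ∀ i, b i e = e.num (κ i) (τ i)) h) : LNum Q h := by
  induction m generalizing Q with
  | zero => exact (hh Fin.elim0 Fin.elim0).mono fun e he => ⟨he, fun i => i.elim0⟩
  | succ m ih =>
    refine LNum.bind (hb 0) fun k₀ τ₀ => ih (b := fun i => b i.succ)
      (fun i => (hb i.succ).mono fun e he => he.1) fun κ τ =>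
        (hh (Fin.cons k₀ κ) (Fin.cons τ₀ τ)).mono ?_
    rintro e ⟨⟨h₁, h₂⟩, h₃⟩
    exact ⟨h₁, Fin.cases h₂ h₃⟩

theorem lexNum_lt_iff {n : ℕ} (hs : 1 ≤ s) (a : Fin s → Fin n) :
    lexNum a < n ↔ ∀ i : Fin s, i.val + 1 < s → (a i).val = 0 := by
  obtain ⟨t, ht, he, -⟩ := exists_lexNum_prefix (δ := s - 1) (r := s) (by omega) a
  have h₁ : s - (s - 1) = 1 := by omega
  rw [h₁, pow_one] at ht he
  have h₂ : lexNum a < n ↔ lexNum (fun j => a (Fin.castLE (Nat.sub_le s 1) j)) = 0 := by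
    rw [he]
    constructor
    · intro h
      by_contra h'
      have : 1 * n ≤ lexNum (fun j => a (Fin.castLE (Nat.sub_le s 1) j)) * n :=
        Nat.mul_le_mul_right _ (Nat.pos_of_ne_zero h')
      omega
    · intro h
      rw [h]
      omega
  rw [h₂, lexNum_eq_zero_iff]
  exact ⟨fun h i hi => h ⟨i, by omega⟩, fun h j => h _ (by simp only [Fin.val_castLE]; omega)⟩

theorem lexNum_eq_last {n : ℕ} (hs : 1 ≤ s) (a : Fin s → Fin n)
    (h : ∀ i : Fin s, i.val + 1 < s → (a i).val = 0) : lexNum a = a ⟨s - 1, by omega⟩ := by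
  rw [lexNum_eq_sum, Finset.sum_eq_single ⟨s - 1, by omega⟩]
  · simp
  · intro i _ hi
    rw [h i (by have := i.2; have : i.val ≠ s - 1 := fun h => hi (Fin.ext h); omega), zero_mul]
  · simp

/-- The number with leading digit `k` and other digits `a` is less than `n`. -/
theorem mul_pow_add_lexNum_lt_iff {n k : ℕ} (hs : 1 ≤ s) (a : Fin s → Fin n) :
    k * n ^ s + lexNum a < n ↔ k = 0 ∧ ∀ i : Fin s, i.val + 1 < s → (a i).val = 0 := by
  rw [← lexNum_lt_iff hs]
  constructor
  · intro h
    have : k = 0 := by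
      by_contra h'
      have h₁ : 1 * n ^ s ≤ k * n ^ s := Nat.mul_le_mul_right _ (Nat.pos_of_ne_zero h')
      have h₂ : n ≤ n ^ s := Nat.le_self_pow (by omega) n
      omega
    subst this
    simpa using h
  · rintro ⟨rfl, h⟩
    simpa using h

theorem LNum.digit (hC : 0 < C) (hs : 1 ≤ s) (t : CTerm σ J C s r) :
    LNum Q (fun e => (t.val e.X e.I e.x e.y).val) := by
  refine (LNum.num ⟨0, hC⟩ fun i => if i.val + 1 = s then t else .zero).congr fun e _ => ?_
  simp only [Env.num, zero_mul, zero_add]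
  rw [lexNum_eq_last hs]
  · simp only
    rw [if_pos (by omega)]
  · intro i hi
    rw [if_neg (by omega)]
    rfl

theorem LDef.lt_card (hs : 1 ≤ s) (k : Fin C) (τ : Fin s → CTerm σ J C s r) :
    LDef Q (fun e => e.num k τ < e.X.card) :=
  ((LDef.const _ (k.val = 0)).and (LDef.all fun i : Fin s => (LDef.const _ (i.val + 1 < s)).imp
    (LDef.term_zero (τ i)))).congr fun _ _ => (mul_pow_add_lexNum_lt_iff hs _).symm

theorem Env.num_eq (hs : 1 ≤ s) {e : Env σ J C s r} {k : Fin C} {τ : Fin s → CTerm σ J C s r}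
    (h : e.num k τ < e.X.card) :
    e.num k τ = (τ ⟨s - 1, by omega⟩).val e.X e.I e.x e.y := by
  obtain ⟨h₁, h₂⟩ := (mul_pow_add_lexNum_lt_iff hs _).1 h
  rw [Env.num, h₁, zero_mul, zero_add, lexNum_eq_last hs _ h₂]

/-- An argument below n equals its last digit, so the input symbol is applied to the terms for the
last digits. Otherwise the register contains 0. -/
theorem LNum.readFun (hC : 0 < C) (hs : 1 ≤ s) {m : ℕ} (f : σ.Functions m)
    {b : Fin m → Env σ J C s r → ℕ} (hb : ∀ i, LNum Q (b i)) :
    LNum Q (fun e => e.X.readFun f fun i => b i e) := by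
  classical
  refine LNum.bindFin hb fun κ τ => ?_
  refine (LNum.ite (P := fun e => ∀ i, e.num (κ i) (τ i) < e.X.card)
    (LDef.all fun i => LDef.lt_card hs _ _)
    (LNum.digit hC hs (.input f fun i => τ i ⟨s - 1, by omega⟩)) (LNum.zero hC)).congr ?_
  rintro e ⟨-, h⟩
  simp only [FinStr.readFun, h]
  by_cases hl : ∀ i, e.num (κ i) (τ i) < e.X.card
  · rw [if_pos hl, dif_pos hl]
    simp only [RTerm.val]
    congr 2
    funext i
    exact Fin.ext (Env.num_eq hs (hl i)).symm
  · rw [if_neg hl, dif_neg hl]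

theorem LNum.readRel (hC : 1 < C) (hs : 1 ≤ s) {m : ℕ} (R : σ.Relations m)
    {b : Fin m → Env σ J C s r → ℕ} (hb : ∀ i, LNum Q (b i)) :
    LNum Q (fun e => e.X.readRel R fun i => b i e) := by
  classical
  refine LNum.bindFin hb fun κ τ => ?_
  refine (LNum.ite (P := fun e => (∀ i, e.num (κ i) (τ i) < e.X.card) ∧
    e.X.str.RelMap R (fun i => (τ i ⟨s - 1, by omega⟩).val e.X e.I e.x e.y))
    ((LDef.all fun i => LDef.lt_card hs _ _).and
      ⟨.input R fun i => τ i ⟨s - 1, by omega⟩, fun e _ => Iff.rfl⟩)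
    (LNum.const hC) (LNum.zero (by omega))).congr ?_
  rintro e ⟨-, h⟩
  simp only [FinStr.readRel, h]
  congr 1
  simp only [eq_iff_iff]
  have key : ∀ hl : ∀ i, e.num (κ i) (τ i) < e.X.card,
      (fun i => (⟨e.num (κ i) (τ i), hl i⟩ : Fin e.X.card)) =
        fun i => (τ i ⟨s - 1, by omega⟩).val e.X e.I e.x e.y := fun hl =>
    funext fun i => Fin.ext (Env.num_eq hs (hl i))
  constructor
  · rintro ⟨hl, h⟩
    exact ⟨hl, by rwa [key hl]⟩
  · rintro ⟨hl, h⟩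
    exact ⟨hl, by rwa [key hl] at h⟩

/-- For s = 1 the number n is the leading digit 1 followed by 0. For s > 1 it has the digit 1 in the
last place but one; for n = 1 this digit does not exist, but then n = n^s. -/
theorem LNum.card (hC : 1 < C) (hs : 1 ≤ s) : LNum Q (fun e => e.X.card) := by
  have hone : ∀ Q : Env σ J C s r → Prop, LNum Q (fun e => e.X.card ^ s) := fun Q =>
    (LNum.num ⟨1, hC⟩ fun _ => .zero).congr fun e _ => by
      simp [Env.num, RTerm.val, lexNum_eq_zero_iff]
  rcases hs.eq_or_lt with h | h
  · exact (hone Q).congr fun e _ => by simp [← h]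
  · have hcard : LDef Q (fun e => e.X.card = 1) := (LDef.term_max .zero).congr fun e _ => by
      have := e.X.pos
      simp only [RTerm.val]
      omega
    refine (LNum.ite hcard (hone _) (LNum.num ⟨0, by omega⟩ fun i =>
      if i.val + 2 = s then .succ .zero else .zero)).congr fun e _ => ?_
    split_ifs with h₁
    · simp [h₁]
    · have hpos := e.X.pos
      simp only [Env.num, zero_mul, zero_add]
      rw [lexNum_eq_sum, Finset.sum_eq_single ⟨s - 2, by omega⟩]
      · have h₂ : s - 2 + 2 = s := by omega
        have h₃ : s - 1 - (s - 2) = 1 := by omega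
        have h₄ : 0 + 1 < e.X.card := by omega
        simp [h₂, h₃, RTerm.val, succFin, h₄]
      · intro i _ hi
        have : i.val + 2 ≠ s := fun h => hi (Fin.ext (by simp only; omega))
        simp [this, RTerm.val]
      · simp

theorem LNum.succ_of_lt (hg : LNum Q g) (h : ∀ e, Q e → g e + 1 < C * e.X.card ^ s) :
    LNum Q (fun e => g e + 1) :=
  hg.succ.congr fun e he => by
    have := h e he
    omega

/-- The cut-off successor differs from h + 1 only at the largest number, which it fixes; requiring g
≠ h removes this case. -/
theorem LDef.eq_succ (hg : LNum Q g) (hh : LNum Q h) : LDef Q (fun e => g e = h e + 1) := by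
  refine LDef.bind hg fun k τ => LDef.bind (hh.mono fun e he => he.1) fun k' τ' => ?_
  refine ((LDef.eq (LNum.num k τ) (LNum.num k' τ').succ).and
    (LDef.eq (LNum.num k τ) (LNum.num k' τ')).not).congr fun e he => ?_
  have h₁ := mul_pow_add_lexNum_lt k fun i => (τ i).val e.X e.I e.x e.y
  have h₂ := mul_pow_add_lexNum_lt k' fun i => (τ' i).val e.X e.I e.x e.y
  rw [he.2, he.1.2]
  simp only [Env.num]
  omega

theorem LNum.apply (hg : LNum Q g) (j : J) : LNum Q (fun e => e.F j (g e) (lexNum e.y)) :=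
  hg.app j false

theorem LNum.apply_next (hg : LNum Q g) (j : J) (hy : ∀ e, Q e → lexNum e.y + 1 ≠ e.X.card ^ r) :
    LNum Q (fun e => e.F j (g e) (lexNum e.y + 1)) :=
  (hg.app j true).congr fun e he => by
    have h₁ := hy e he
    have h₂ := lexNum_lt e.y
    simp only [Env.yNext, if_true]
    rw [lexNum_lexSucc_eq, min_eq_left (by omega)]

theorem LDef.y_zero : LDef Q (fun e => lexNum e.y = 0) :=
  (LDef.all fun j => LDef.term_zero (.y j)).congr fun e _ => (lexNum_eq_zero_iff e.y).symm

theorem LDef.y_last : LDef Q (fun e => lexNum e.y + 1 = e.X.card ^ r) :=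
  (LDef.all fun j => LDef.term_max (.y j)).congr fun e _ => (lexNum_add_one_eq_iff e.y).symm

end Definable

end TimeSpace

namespace TimeSpace

/-! ### Chains of memory accesses -/

section Chains

variable {N : ℕ} {A W pv nx fs ls : ℕ → ℕ} {mem : ℕ → ℕ → ℕ}

/-- The times `0, …, N-1`, at which the addresses `A t` are accessed, are linked by pointers to the
previous (`pv`) and next (`nx`) access of the same address; `fs` and `ls` give the first and last
access of an address. -/
structure Chained (N : ℕ) (A pv nx fs ls : ℕ → ℕ) : Prop where
  addr_lt : ∀ t < N, A t < N
  last_lt : ∀ a < N, ls a < N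
  prev : ∀ t < N, pv t = t ∧ fs (A t) = t ∨ pv t < t ∧ A (pv t) = A t ∧ nx (pv t) = t
  last : ∀ t < N, A (ls (A t)) = A t
  next : ∀ a < N, A (ls a) = a → nx (ls a) = ls a

/-- Descent along `pv` stays at the same address and ends only in `fs (A t)`. -/
theorem Chained.first_le (h : Chained N A pv nx fs ls) {t : ℕ} (ht : t < N) : fs (A t) ≤ t := by
  induction t using Nat.strong_induction_on with
  | _ t ih =>
    rcases h.prev t ht with ⟨-, h₁⟩ | ⟨h₁, h₂, -⟩
    · exact h₁.le
    · rw [← h₂]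
      exact (ih _ h₁ (h₁.trans ht)).trans h₁.le

/-- Let t be the first access of the address after q. By `ih` its predecessor `pv t` is at least q
and different from t, and nothing lies between; so `pv t = q`, whence `nx q = t ≤ t'`. -/
theorem Chained.next_mem (h : Chained N A pv nx fs ls) {q t' : ℕ} (ht' : t' < N)
    (ih : ∀ t ≤ t', ∀ u < t, A u = A t → pv t ≠ t ∧ u ≤ pv t) (hq : q < t') (hA : A q = A t') :
    q < nx q ∧ nx q ≤ t' := by
  classical
  have hex : ∃ t, q < t ∧ A t = A q := ⟨t', hq, hA.symm⟩
  obtain ⟨h₁, h₂⟩ := Nat.find_spec hex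
  have h₃ : Nat.find hex ≤ t' := Nat.find_min' hex ⟨hq, hA.symm⟩
  have hmin := fun t (ht : t < Nat.find hex) => Nat.find_min hex ht
  generalize Nat.find hex = t at *
  obtain ⟨h₄, h₅⟩ := ih t h₃ q h₁ h₂.symm
  rcases h.prev t (h₃.trans_lt ht') with ⟨h₆, -⟩ | ⟨h₆, h₇, h₈⟩
  · exact (h₄ h₆).elim
  · have : pv t = q := by
      by_contra hne
      exact hmin _ h₆ ⟨by omega, h₇.trans h₂⟩
    rw [this] at h₈
    exact ⟨by omega, by omega⟩

/-- No access is skipped: if one lay strictly between `pv t` and t, then `next_mem` would give `nx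
(pv t) < t`, whereas `nx (pv t) = t`. If `pv t = t`, then t is `fs` of its address, which by
`first_le` is at most every access of it. -/
theorem Chained.le_prev (h : Chained N A pv nx fs ls) {t : ℕ} (ht : t < N) :
    ∀ t' < t, A t' = A t → pv t ≠ t ∧ t' ≤ pv t := by
  induction t using Nat.strong_induction_on with
  | _ t ih =>
    intro t' ht' hA
    rcases h.prev t ht with ⟨-, h₁⟩ | ⟨h₁, h₂, h₃⟩
    · have := h.first_le (ht'.trans ht)
      rw [hA, h₁] at this
      omega
    · refine ⟨h₁.ne, not_lt.1 fun hlt => ?_⟩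
      have := h.next_mem (ht'.trans ht) (fun u hu => ih u (by omega) (by omega)) hlt
        (h₂.trans hA.symm)
      omega

/-- An access after `ls (A t)` would force `nx` to move forward there, whereas it is a fixed point
of `nx`. -/
theorem Chained.le_last (h : Chained N A pv nx fs ls) {t : ℕ} (ht : t < N) : t ≤ ls (A t) := by
  refine not_lt.1 fun hlt => ?_
  have := h.next_mem ht (fun u hu => h.le_prev (by omega)) hlt (h.last t ht)
  rw [h.next _ (h.addr_lt t ht) (h.last t ht)] at this
  omega

theorem eq_of_forall_ne (hm : ∀ t < N, mem (t + 1) = Function.update (mem t) (A t) (W t))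
    {t₁ t₂ a : ℕ} (h : t₁ ≤ t₂) (h₂ : t₂ ≤ N) (ha : ∀ t, t₁ ≤ t → t < t₂ → A t ≠ a) :
    mem t₂ a = mem t₁ a := by
  induction t₂, h using Nat.le_induction with
  | base => rfl
  | succ t ht ih =>
    rw [hm t h₂, Function.update_of_ne (ha t ht t.lt_succ_self).symm,
      ih (by omega) fun u hu hu' => ha u hu (by omega)]

/-- By `le_prev` the address is not written between `pv t` and t, or not at all before t. -/
theorem Chained.mem_prev (h : Chained N A pv nx fs ls)
    (hm : ∀ t < N, mem (t + 1) = Function.update (mem t) (A t) (W t)) {t : ℕ} (ht : t < N) :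
    (pv t = t → mem t (A t) = mem 0 (A t)) ∧ (pv t ≠ t → mem t (A t) = W (pv t)) := by
  refine ⟨fun hp => eq_of_forall_ne hm t.zero_le ht.le fun u _ hu hA =>
    (h.le_prev ht u hu hA).1 hp, fun hp => ?_⟩
  obtain ⟨h₁, -⟩ | ⟨h₁, h₂, -⟩ := h.prev t ht
  · exact (hp h₁).elim
  · rw [eq_of_forall_ne hm (t₁ := pv t + 1) h₁ ht.le fun u hu hu' hA => ?_, hm _ (h₁.trans ht), h₂,
      Function.update_self]
    have := (h.le_prev ht u hu' hA).2
    omega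

theorem Chained.mem_last (h : Chained N A pv nx fs ls)
    (hm : ∀ t < N, mem (t + 1) = Function.update (mem t) (A t) (W t)) {a : ℕ} (ha : a < N) :
    (A (ls a) = a → mem N a = W (ls a)) ∧ (A (ls a) ≠ a → mem N a = mem 0 a) := by
  constructor
  · intro hl
    rw [eq_of_forall_ne hm (t₁ := ls a + 1) (h.last_lt a ha) le_rfl fun u hu hu' hA => ?_,
      hm _ (h.last_lt a ha), hl, Function.update_self]
    have := h.le_last hu'
    rw [hA] at this
    omega
  · intro hl
    refine eq_of_forall_ne hm N.zero_le le_rfl fun u _ hu' hA => hl ?_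
    have := h.last u hu'
    rwa [hA] at this

theorem exists_greatest_lt {p : ℕ → Prop} {b : ℕ} (h : ∃ x < b, p x) :
    ∃ x < b, p x ∧ ∀ y, x < y → y < b → ¬p y := by
  induction b with
  | zero => exact (by simp at h)
  | succ b ih =>
    by_cases hb : p b
    · exact ⟨b, b.lt_succ_self, hb, fun y h₁ h₂ => by omega⟩
    · obtain ⟨x, hx, hp⟩ := h
      obtain ⟨y, hy, hp', hy'⟩ := ih ⟨x, by
        have : x ≠ b := fun h => hb (h ▸ hp)
        omega, hp⟩
      refine ⟨y, by omega, hp', fun z h₁ h₂ => ?_⟩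
      rcases Nat.lt_succ_iff_lt_or_eq.1 h₂ with h₂ | rfl
      exacts [hy' z h₁ h₂, hb]

theorem exists_chained (hN : 0 < N) (hA : ∀ t < N, A t < N) :
    ∃ pv nx fs ls : ℕ → ℕ, Chained N A pv nx fs ls ∧
      ∀ t < N, pv t < N ∧ nx t < N ∧ fs t < N ∧ ls t < N := by
  classical
  have hpv : ∀ t, ∃ p, (p = t ∧ ∀ u < t, A u ≠ A t) ∨
      (p < t ∧ A p = A t ∧ ∀ u, p < u → u < t → A u ≠ A t) := by
    intro t
    by_cases h : ∃ u < t, A u = A t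
    · obtain ⟨p, h₁, h₂, h₃⟩ := exists_greatest_lt h
      exact ⟨p, Or.inr ⟨h₁, h₂, h₃⟩⟩
    · exact ⟨t, Or.inl ⟨rfl, fun u hu hA => h ⟨u, hu, hA⟩⟩⟩
  have hnx : ∀ t, ∃ p, (p = t ∧ ∀ u, t < u → u < N → A u ≠ A t) ∨
      (t < p ∧ p < N ∧ A p = A t ∧ ∀ u, t < u → u < p → A u ≠ A t) := by
    intro t
    by_cases h : ∃ u, t < u ∧ u < N ∧ A u = A t
    · obtain ⟨h₁, h₂, h₃⟩ := Nat.find_spec h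
      exact ⟨_, Or.inr ⟨h₁, h₂, h₃, fun u hu hu' hA =>
        Nat.find_min h hu' ⟨hu, hu'.trans h₂, hA⟩⟩⟩
    · exact ⟨t, Or.inl ⟨rfl, fun u hu hu' hA => h ⟨u, hu, hu', hA⟩⟩⟩
  have hfs : ∀ a, ∃ t < N, ∀ u < N, A u = a → A t = a ∧ t ≤ u := by
    intro a
    by_cases h : ∃ u, u < N ∧ A u = a
    · obtain ⟨h₁, h₂⟩ := Nat.find_spec h
      exact ⟨_, h₁, fun u hu hA => ⟨h₂, Nat.find_min' h ⟨hu, hA⟩⟩⟩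
    · exact ⟨0, hN, fun u hu hA => (h ⟨u, hu, hA⟩).elim⟩
  have hls : ∀ a, ∃ t < N, ∀ u < N, A u = a → A t = a ∧ u ≤ t := by
    intro a
    by_cases h : ∃ u < N, A u = a
    · obtain ⟨p, h₁, h₂, h₃⟩ := exists_greatest_lt h
      exact ⟨p, h₁, fun u hu hA => ⟨h₂, not_lt.1 fun hlt => h₃ u hlt hu hA⟩⟩
    · exact ⟨0, hN, fun u hu hA => (h ⟨u, hu, hA⟩).elim⟩
  choose pv hpv using hpv
  choose nx hnx using hnx
  choose fs hfs₁ hfs using hfs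
  choose ls hls₁ hls using hls
  refine ⟨pv, nx, fs, ls, ⟨hA, fun a _ => hls₁ a, fun t ht => ?_, fun t ht => (hls _ t ht rfl).1,
    fun a ha hl => ?_⟩, fun t ht => ⟨?_, ?_, hfs₁ t, hls₁ t⟩⟩
  · rcases hpv t with ⟨h₁, h₂⟩ | ⟨h₁, h₂, h₃⟩
    · obtain ⟨h₃, h₄⟩ := hfs (A t) t ht rfl
      refine Or.inl ⟨h₁, h₄.antisymm (not_lt.1 fun hlt => h₂ _ hlt h₃)⟩
    · refine Or.inr ⟨h₁, h₂, ?_⟩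
      rcases hnx (pv t) with ⟨h₄, h₅⟩ | ⟨h₄, h₅, h₆, h₇⟩
      · exact (h₅ t h₁ ht h₂.symm).elim
      · rcases lt_trichotomy (nx (pv t)) t with hlt | heq | hgt
        · exact (h₃ _ h₄ hlt (h₆.trans h₂)).elim
        · exact heq
        · exact (h₇ t h₁ hgt h₂.symm).elim
  · rcases hnx (ls a) with ⟨h₄, -⟩ | ⟨h₄, h₅, h₆, -⟩
    · exact h₄
    · have := (hls a _ h₅ (h₆.trans hl)).2
      omega
  · rcases hpv t with ⟨h₁, -⟩ | ⟨h₁, -⟩ <;> omega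
  · rcases hnx t with ⟨h₁, -⟩ | ⟨-, h₁, -⟩ <;> omega

end Chains

/-! ### Comparing numbers by their digits -/

section Digits

variable {N : ℕ} {d₁ d₂ P₁ P₂ q : ℕ → ℕ}

/-- The entry `c` of the table `P₁, P₂` of pairs witnesses that `p` is less than `t`, where these
numbers have the digits `d₁` and `d₂`. -/
def Less (d₁ d₂ P₁ P₂ : ℕ → ℕ) (c p t : ℕ) : Prop :=
  (P₁ c = d₁ p ∧ P₂ c = d₁ t) ∨ (d₁ p = d₁ t ∧ P₁ c = d₂ p ∧ P₂ c = d₂ t)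

/-- Descent along `q` keeps the first component and lowers the second by one, until the second is
the successor of the first. -/
theorem lt_of_pairs (hq : ∀ c < N, q c < N)
    (hP : ∀ c < N, P₂ c = P₁ c + 1 ∨ P₁ (q c) = P₁ c ∧ P₂ c = P₂ (q c) + 1) {c : ℕ} (hc : c < N) :
    P₁ c < P₂ c := by
  generalize hm : P₂ c = m
  induction m using Nat.strong_induction_on generalizing c with
  | _ m ih =>
    rcases hP c hc with h | ⟨h₁, h₂⟩
    · omega
    · have := ih (P₂ (q c)) (by omega) (hq c hc) rfl
      omega

/-- For soundness `d₁, d₂` need not be true digits: by `hd` the pairs (d₁, d₂) are lexicographically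
nondecreasing, so a strictly smaller pair belongs to an earlier time. -/
theorem Less.lt (hd : ∀ t, t + 1 < N → d₁ (t + 1) = d₁ t + 1 ∨
      d₁ (t + 1) = d₁ t ∧ d₂ (t + 1) = d₂ t + 1)
    (hP : ∀ c < N, P₁ c < P₂ c) {c p t : ℕ} (hc : c < N) (hp : p < N)
    (h : Less d₁ d₂ P₁ P₂ c p t) : p < t := by
  by_contra hlt
  have hmono : ∀ u, t ≤ u → u < N → d₁ t < d₁ u ∨ d₁ t = d₁ u ∧ d₂ t ≤ d₂ u := by
    intro u hu
    induction u, hu using Nat.le_induction with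
    | base => exact fun _ => Or.inr ⟨rfl, le_rfl⟩
    | succ u hu ih =>
      intro hu'
      have := ih (by omega)
      have := hd u hu'
      omega
  have h₁ := hmono p (not_lt.1 hlt) hp
  have h₂ := hP c hc
  unfold Less at h
  omega

theorem div_mod_of_eq {m x a b : ℕ} (hb : b < m) (hx : x = m * a + b) : x / m = a ∧ x % m = b := by
  subst hx
  exact ⟨by rw [Nat.mul_add_div (by omega), Nat.div_eq_of_lt hb, add_zero],
    by rw [Nat.mul_add_mod, Nat.mod_eq_of_lt hb]⟩

/-- Let m = ⌊√N⌋. Since N < (m + 1)², base m + 1 gives two digits up to m, and the pairs u < v ≤ m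
are numbered by m·u + (v - 1) < m² ≤ N. The assumption N ≥ 2 makes m < N. -/
theorem exists_digits (hN : 2 ≤ N) : ∃ d₁ d₂ P₁ P₂ q : ℕ → ℕ,
    (∀ t < N, d₁ t < N ∧ d₂ t < N ∧ P₁ t < N ∧ P₂ t < N ∧ q t < N) ∧
    (∀ t, d₁ (t + 1) = d₁ t + 1 ∨ d₁ (t + 1) = d₁ t ∧ d₂ (t + 1) = d₂ t + 1) ∧
    (∀ c, P₂ c = P₁ c + 1 ∨ P₁ (q c) = P₁ c ∧ P₂ c = P₂ (q c) + 1) ∧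
    ∀ p t, p < t → t < N → ∃ c < N, Less d₁ d₂ P₁ P₂ c p t := by
  set m := Nat.sqrt N with hm
  have hm₀ : 0 < m := Nat.sqrt_pos.2 (by omega)
  have hm₁ : m < N := Nat.sqrt_lt_self (by omega)
  have hm₂ : m * m ≤ N := Nat.sqrt_le N
  have hm₃ : N < (m + 1) * (m + 1) := Nat.lt_succ_sqrt N
  have hpair : ∀ u v, u < v → v ≤ m → ∃ c < N, c / m = u ∧ c % m + 1 = v := by
    intro u v huv hv
    have h := div_mod_of_eq (a := u) (b := v - 1) (m := m) (by omega) rfl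
    refine ⟨m * u + (v - 1), ?_, h.1, by omega⟩
    have : m * (u + 1) ≤ m * m := Nat.mul_le_mul_left _ (by omega)
    rw [Nat.mul_succ] at this
    omega
  have hdig : ∀ t < N, t / (m + 1) ≤ m ∧ t % (m + 1) ≤ m := fun t ht =>
    ⟨Nat.lt_succ_iff.1 (Nat.div_lt_of_lt_mul (ht.trans hm₃)),
      Nat.lt_succ_iff.1 (Nat.mod_lt _ m.succ_pos)⟩
  -- Numbers c that encode no pair u < v get the pair (0, 1). The map `c - 1` lowers v by one.
  refine ⟨fun t => t / (m + 1), fun t => t % (m + 1), fun c => if c / m ≤ c % m then c / m else 0,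
    fun c => if c / m ≤ c % m then c % m + 1 else 1, fun c => c - 1, fun t ht => ?_, fun t => ?_,
    fun c => ?_, fun p t hp ht => ?_⟩
  · have h₁ := hdig t ht
    have h₂ := Nat.mod_lt t hm₀
    refine ⟨h₁.1.trans_lt hm₁, h₁.2.trans_lt hm₁, ?_, ?_, ?_⟩ <;> simp only <;> (try split_ifs) <;>
      omega
  · have h₁ := Nat.div_add_mod t (m + 1)
    have h₂ : t % (m + 1) < m + 1 := Nat.mod_lt t m.succ_pos
    simp only
    rcases Nat.lt_or_ge (t % (m + 1)) m with h | h
    · exact Or.inr (div_mod_of_eq (Nat.succ_lt_succ h) (by omega))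
    · refine Or.inl (div_mod_of_eq (m := m + 1) (b := 0) (by omega) ?_).1
      rw [Nat.mul_succ]
      omega
  · have h₃ := Nat.div_add_mod c m
    have h₅ := Nat.mod_lt c hm₀
    have h₆ := Nat.zero_le (c / m)
    simp only
    split_ifs with h₁ h₂ h₂
    · rcases h₁.eq_or_lt with h | h
      · exact Or.inl (by omega)
      · have h₄ := div_mod_of_eq (x := c - 1) (a := c / m) (b := c % m - 1) (m := m) (by omega)
          (by omega)
        exact Or.inr ⟨h₄.1, by omega⟩
    · rcases h₁.eq_or_lt with h | h
      · exact Or.inl (by omega)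
      · have h₄ := div_mod_of_eq (x := c - 1) (a := c / m) (b := c % m - 1) (m := m) (by omega)
          (by omega)
        exact (h₂ (by omega)).elim
    · exact Or.inl rfl
    · exact Or.inl rfl
  · have h₁ := Nat.div_add_mod p (m + 1)
    have h₂ := Nat.div_add_mod t (m + 1)
    have h₃ := hdig p (hp.trans ht)
    have h₄ := hdig t ht
    have h₅ : p / (m + 1) ≤ t / (m + 1) := Nat.div_le_div_right hp.le
    rcases h₅.eq_or_lt with h | h
    · have h₅ : p % (m + 1) < t % (m + 1) := by
        rw [h] at h₁
        omega
      obtain ⟨c, hc, hc₁, hc₂⟩ := hpair _ _ h₅ h₄.2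
      have h₆ : c / m ≤ c % m := Nat.lt_succ_iff.1 (hc₁.trans_lt (h₅.trans_eq hc₂.symm))
      refine ⟨c, hc, Or.inr ⟨h, ?_⟩⟩
      simp only [if_pos h₆]
      exact ⟨hc₁, hc₂⟩
    · obtain ⟨c, hc, hc₁, hc₂⟩ := hpair _ _ h h₄.1
      have h₆ : c / m ≤ c % m := Nat.lt_succ_iff.1 (hc₁.trans_lt (h.trans_eq hc₂.symm))
      refine ⟨c, hc, Or.inl ?_⟩
      simp only [if_pos h₆]
      exact ⟨hc₁, hc₂⟩

end Digits

end TimeSpace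

namespace TimeSpace

/-! ### Certificates for accepting computations -/

section Certificates

variable {σ : FirstOrder.Language.{u, v}}

/-- The functions which make up a certificate. At the time `t` of the block `w`, these are the
contents `acc`, `arg b` of the accumulators, the line `line`, the content of the register with the
address `acc` before (`load`) and after (`write`) the step, the content `mem` of the register `t` at
the beginning of the block, the pointers of `Chained`, and the tables of `Less`. -/
inductive CertSym (d : ℕ)
  | acc
  | arg (b : Fin d)
  | line
  | load
  | write
  | mem
  | prev
  | next
  | first
  | last
  | digit₁
  | digit₂
  | pair₁
  | pair₂
  | pred
  | witness

instance (d : ℕ) : Finite (CertSym d) := by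
  refine Finite.of_surjective (α := Fin d ⊕ Fin 15) (fun x => match x with
    | Sum.inl b => .arg b
    | Sum.inr i => (![.acc, .line, .load, .write, .mem, .prev, .next, .first, .last, .digit₁,
        .digit₂, .pair₁, .pair₂, .pred, .witness] : Fin 15 → CertSym d) i) ?_
  rintro (_ | b | _ | _ | _ | _ | _ | _ | _ | _ | _ | _ | _ | _ | _ | _)
  exacts [⟨Sum.inr 0, rfl⟩, ⟨Sum.inl b, rfl⟩, ⟨Sum.inr 1, rfl⟩, ⟨Sum.inr 2, rfl⟩,
    ⟨Sum.inr 3, rfl⟩, ⟨Sum.inr 4, rfl⟩, ⟨Sum.inr 5, rfl⟩, ⟨Sum.inr 6, rfl⟩, ⟨Sum.inr 7, rfl⟩,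
    ⟨Sum.inr 8, rfl⟩, ⟨Sum.inr 9, rfl⟩, ⟨Sum.inr 10, rfl⟩, ⟨Sum.inr 11, rfl⟩, ⟨Sum.inr 12, rfl⟩,
    ⟨Sum.inr 13, rfl⟩, ⟨Sum.inr 14, rfl⟩]

variable [Finite σ.Symbols]

/-- The effect of an instruction on the accumulators, the register with address `A` (which contains
`V` before and `W` after the instruction) and the program counter. An accepting computation stays
in the line of `accept`. -/
def Instr.Local {len : ℕ} (I : Instr σ len) (X : FinStr σ) (i A V W A' i' : ℕ)
    (B B' : Fin (numAcc σ) → ℕ) : Prop :=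
  match I with
  | .getSize => A' = X.card ∧ (∀ c, B' c = B c) ∧ W = V ∧ i' = i + 1
  | .setZero => A' = 0 ∧ (∀ c, B' c = B c) ∧ W = V ∧ i' = i + 1
  | .incr => A' = A + 1 ∧ (∀ c, B' c = B c) ∧ W = V ∧ i' = i + 1
  | .decr => (A = A' + 1 ∨ A = 0 ∧ A' = 0) ∧ (∀ c, B' c = B c) ∧ W = V ∧ i' = i + 1
  | .guess => True ∧ (∀ c, B' c = B c) ∧ W = V ∧ i' = i + 1
  | .getFun f => A' = X.readFun f (fun c => B (Fin.castLE (fun_le_numAcc f) c)) ∧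
      (∀ c, B' c = B c) ∧ W = V ∧ i' = i + 1
  | .getRel Q => A' = X.readRel Q (fun c => B (Fin.castLE (rel_le_numAcc Q) c)) ∧
      (∀ c, B' c = B c) ∧ W = V ∧ i' = i + 1
  | .load => A' = V ∧ (∀ c, B' c = B c) ∧ W = V ∧ i' = i + 1
  | .copy b => A' = A ∧ (∀ c, (c = b → B' c = A) ∧ (c ≠ b → B' c = B c)) ∧ W = V ∧ i' = i + 1
  | .store b => A' = A ∧ (∀ c, B' c = B c) ∧ W = B b ∧ i' = i + 1
  | .branch b i₀ i₁ => A' = A ∧ (∀ c, B' c = B c) ∧ W = V ∧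
      (A = B b → i' = i₀) ∧ (A ≠ B b → i' = i₁)
  | .accept => A' = A ∧ (∀ c, B' c = B c) ∧ W = V ∧ i' = i
  | .reject => False

/-- An instruction changes the memory at most at the address in A. So every step counts as a write
to that address, possibly of the old value, and every step is an access in the chains. -/
theorem Instr.local_of_effect {len : ℕ} {I : Instr σ len} {X : FinStr σ} {i j : Fin (len + 1)}
    {m m' : Regs (numAcc σ)} (h : I.Effect X m m') (h' : I.Next i m j) :
    I.Local X i m.A (m.R m.A) (m'.R m.A) m'.A j m.B m'.B ∧
      m'.R = Function.update m.R m.A (m'.R m.A) := by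
  cases I with
  | getSize | setZero | incr | getFun | getRel | load =>
    obtain rfl := h
    exact ⟨⟨rfl, fun _ => rfl, rfl, h'⟩, by simp⟩
  | decr =>
    obtain rfl := h
    exact ⟨⟨by simp only; omega, fun _ => rfl, rfl, h'⟩, by simp⟩
  | guess =>
    obtain ⟨a, rfl⟩ := h
    exact ⟨⟨trivial, fun _ => rfl, rfl, h'⟩, by simp⟩
  | copy b =>
    obtain rfl := h
    exact ⟨⟨rfl, fun c => ⟨fun hc => by simp [hc], fun hc => by simp [hc]⟩, rfl, h'⟩, by simp⟩
  | store b =>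
    obtain rfl := h
    exact ⟨⟨rfl, fun _ => rfl, by simp, h'⟩, by simp⟩
  | branch b i₀ i₁ =>
    obtain rfl := h
    refine ⟨⟨rfl, fun _ => rfl, rfl, fun hA => ?_, fun hA => ?_⟩, by simp⟩
    · exact congrArg Fin.val (h'.trans (if_pos hA))
    · exact congrArg Fin.val (h'.trans (if_neg hA))
  | accept => exact h.elim
  | reject => exact h.elim

theorem Instr.Local.effect {len : ℕ} {I : Instr σ len} {X : FinStr σ} {i j : Fin (len + 1)}
    {m : Regs (numAcc σ)} {W A' : ℕ} {B' : Fin (numAcc σ) → ℕ}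
    (h : I.Local X i m.A (m.R m.A) W A' j m.B B') (hI : I ≠ .accept) :
    I.Effect X m ⟨A', B', Function.update m.R m.A W⟩ ∧ I.Next i m j := by
  cases I with
  | getSize | setZero | incr | getFun | getRel | load =>
    obtain ⟨rfl, hB, rfl, hj⟩ := h
    obtain rfl := funext hB
    exact ⟨by simp [Instr.Effect], hj⟩
  | decr =>
    obtain ⟨hA, hB, rfl, hj⟩ := h
    obtain rfl := funext hB
    have : A' = m.A - 1 := by omega
    exact ⟨by simp [Instr.Effect, this], hj⟩
  | guess =>
    obtain ⟨-, hB, rfl, hj⟩ := h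
    obtain rfl := funext hB
    exact ⟨⟨A', by simp⟩, hj⟩
  | copy b =>
    obtain ⟨rfl, hB, rfl, hj⟩ := h
    have : B' = Function.update m.B b m.A := by
      funext c
      by_cases hc : c = b
      · rw [(hB c).1 hc, hc, Function.update_self]
      · rw [(hB c).2 hc, Function.update_of_ne hc]
    exact ⟨by simp [Instr.Effect, this], hj⟩
  | store b =>
    obtain ⟨rfl, hB, rfl, hj⟩ := h
    obtain rfl := funext hB
    exact ⟨rfl, hj⟩
  | branch b i₀ i₁ =>
    obtain ⟨rfl, hB, rfl, h₀, h₁⟩ := h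
    obtain rfl := funext hB
    refine ⟨by simp [Instr.Effect], ?_⟩
    simp only [Instr.Next]
    split_ifs with hA
    · exact Fin.ext (h₀ hA)
    · exact Fin.ext (h₁ hA)
  | accept => exact (hI rfl).elim
  | reject => exact h.elim

/-- The relation between the certificate at two successive times. -/
def LocalStep (M : NRAM σ) (X : FinStr σ) (f f' : CertSym (numAcc σ) → ℕ) : Prop :=
  ∃ i : Fin (M.len + 1), f .line = i ∧ (M.prog i).Local X i (f .acc) (f .load) (f .write)
    (f' .acc) (f' .line) (fun b => f (.arg b)) (fun b => f' (.arg b))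

/-- The configuration in a certificate, if the main memory contains `R`. -/
def configOf (M : NRAM σ) (f : CertSym (numAcc σ) → ℕ) (R : ℕ → ℕ) : Config M :=
  ⟨Fin.ofNat _ (f .line), ⟨f .acc, fun b => f (.arg b), R⟩⟩

theorem LocalStep.step {M : NRAM σ} {X : FinStr σ} {f f' : CertSym (numAcc σ) → ℕ} {R : ℕ → ℕ}
    (h : LocalStep M X f f') (hf : f .line ≠ M.len) (hf' : f' .line ≤ M.len)
    (hR : f .load = R (f .acc)) :
    M.Step X (configOf M f R) (configOf M f' (Function.update R (f .acc) (f .write))) := by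
  obtain ⟨i, hi, h⟩ := h
  have h₁ : Fin.ofNat (M.len + 1) (f .line) = i := Fin.ext (by
    rw [hi, Fin.val_ofNat, Nat.mod_eq_of_lt i.2])
  have h₂ : (Fin.ofNat (M.len + 1) (f' .line)).val = f' .line :=
    Nat.mod_eq_of_lt (Nat.lt_succ_of_le hf')
  rw [hR, ← h₂] at h
  have hacc : M.prog i ≠ .accept := fun h => hf (by rw [hi, (M.accept_iff i).1 h]; rfl)
  simp only [NRAM.Step, configOf, h₁]
  exact Instr.Local.effect (m := ⟨f .acc, fun b => f (.arg b), R⟩) h hacc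

/-- The conditions on a certificate at the time `t` of the block `w`, if there are `Y` blocks of
`N` times. -/
structure Cert (M : NRAM σ) (X : FinStr σ) (N Y : ℕ) (F : CertSym (numAcc σ) → ℕ → ℕ → ℕ)
    (t w : ℕ) : Prop where
  start : t = 0 → w = 0 → F .acc t w = 0 ∧ F .line t w = 0 ∧ ∀ b, F (.arg b) t w = 0
  clear : w = 0 → F .mem t w = 0
  step : t + 1 ≠ N → LocalStep M X (F · t w) (F · (t + 1) w)
  step_block : t + 1 = N → w + 1 ≠ Y → LocalStep M X (F · t w) (F · 0 (w + 1))
  halt : t + 1 = N → w + 1 = Y → F .line t w = M.len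
  prev : F .prev t w = t ∧ F .first (F .acc t w) w = t ∧ F .load t w = F .mem (F .acc t w) w ∨
    F .prev t w ≠ t ∧
      Less (F .digit₁ · w) (F .digit₂ · w) (F .pair₁ · w) (F .pair₂ · w) (F .witness t w)
        (F .prev t w) t ∧
      F .acc (F .prev t w) w = F .acc t w ∧ F .next (F .prev t w) w = t ∧
      F .load t w = F .write (F .prev t w) w
  last : F .acc (F .last (F .acc t w) w) w = F .acc t w
  next : F .acc (F .last t w) w = t → F .next (F .last t w) w = F .last t w
  mem : w + 1 ≠ Y → (F .acc (F .last t w) w = t → F .mem t (w + 1) = F .write (F .last t w) w) ∧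
    (F .acc (F .last t w) w ≠ t → F .mem t (w + 1) = F .mem t w)
  digits : t + 1 ≠ N → F .digit₁ (t + 1) w = F .digit₁ t w + 1 ∨
    F .digit₁ (t + 1) w = F .digit₁ t w ∧ F .digit₂ (t + 1) w = F .digit₂ t w + 1
  pairs : F .pair₂ t w = F .pair₁ t w + 1 ∨ F .pair₁ (F .pred t w) w = F .pair₁ t w ∧
    F .pair₂ t w = F .pair₂ (F .pred t w) w + 1

variable {M : NRAM σ} {X : FinStr σ} {N Y : ℕ} {F : CertSym (numAcc σ) → ℕ → ℕ → ℕ}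

/-- The order between an access and its predecessor is the one condition that `Cert` does not state
directly; it comes from the witness by `Less.lt`. -/
theorem chained_of_cert (hF : ∀ j, ∀ t < N, ∀ w < Y, F j t w < N)
    (h : ∀ t < N, ∀ w < Y, Cert M X N Y F t w) {w : ℕ} (hw : w < Y) :
    Chained N (F .acc · w) (F .prev · w) (F .next · w) (F .first · w) (F .last · w) where
  addr_lt t ht := hF _ t ht w hw
  last_lt t ht := hF _ t ht w hw
  prev t ht := by
    rcases (h t ht w hw).prev with ⟨h₁, h₂, -⟩ | ⟨-, h₁, h₂, h₃, -⟩
    · exact Or.inl ⟨h₁, h₂⟩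
    · exact Or.inr ⟨h₁.lt (fun u hu => (h u (by omega) w hw).digits (by omega))
        (fun c hc => lt_of_pairs (q := (F .pred · w)) (fun c hc => hF _ c hc w hw)
          (fun c hc => (h c hc w hw).pairs) hc) (hF _ t ht w hw) (hF _ t ht w hw), h₂, h₃⟩
  last t ht := (h t ht w hw).last
  next t ht := (h t ht w hw).next

/-- A certificate gives an accepting computation. -/
theorem exists_run_of_cert (hN : 0 < N) (hY : 0 < Y) (hF : ∀ j, ∀ t < N, ∀ w < Y, F j t w < N)
    (h : ∀ t < N, ∀ w < Y, Cert M X N Y F t w) : ∃ t C, M.AcceptingRun X t C := by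
  classical
  -- The time τ = N·w + t is the time t of the block w.
  set G : ℕ → CertSym (numAcc σ) → ℕ := fun τ j => F j (τ % N) (τ / N) with hG
  have hGF : ∀ w, ∀ t < N, G (N * w + t) = fun j => F j t w := by
    intro w t ht
    obtain ⟨h₁, h₂⟩ := div_mod_of_eq ht (rfl : N * w + t = N * w + t)
    simp only [hG, h₁, h₂]
  have hcases : ∀ τ < N * Y, ∃ w < Y, ∃ t < N, τ = N * w + t := fun τ hτ =>
    ⟨τ / N, Nat.div_lt_of_lt_mul hτ, τ % N, Nat.mod_lt _ hN, (Nat.div_add_mod _ _).symm⟩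
  -- The certificate stores the memory only at the beginnings of blocks; the full memory is rebuilt
  -- from the writes, and the chains show that the loaded values agree with it.
  let mem : ℕ → ℕ → ℕ := fun τ => Nat.rec (fun _ => 0)
    (fun τ m => Function.update m (G τ .acc) (G τ .write)) τ
  have hmem : ∀ τ, mem (τ + 1) = Function.update (mem τ) (G τ .acc) (G τ .write) := fun τ => rfl
  have hblock : ∀ w, ∀ t < N, mem (N * w + (t + 1)) =
      Function.update (mem (N * w + t)) (F .acc t w) (F .write t w) := by
    intro w t ht
    rw [← add_assoc, hmem, hGF w t ht]
  have hstart : ∀ w < Y, ∀ a < N, mem (N * w) a = F .mem a w := by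
    intro w
    induction w with
    | zero => exact fun hw a ha => ((h a ha 0 hw).clear rfl).symm
    | succ w ih =>
      intro hw a ha
      have h₁ := (chained_of_cert hF h (show w < Y by omega)).mem_last
        (mem := fun t => mem (N * w + t)) (hblock w) ha
      have h₂ := (h a ha w (by omega)).mem (by omega)
      rw [Nat.mul_succ]
      by_cases hl : F .acc (F .last a w) w = a
      · exact (h₁.1 hl).trans (h₂.1 hl).symm
      · exact (h₁.2 hl).trans ((ih (by omega) a ha).trans (h₂.2 hl).symm)
  have hload : ∀ τ < N * Y, G τ .load = mem τ (G τ .acc) := by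
    intro τ hτ
    obtain ⟨w, hw, t, ht, rfl⟩ := hcases τ hτ
    have h₁ := (chained_of_cert hF h hw).mem_prev (mem := fun t => mem (N * w + t)) (hblock w) ht
    rw [hGF w t ht]
    rcases (h t ht w hw).prev with ⟨h₂, -, h₃⟩ | ⟨h₂, -, -, -, h₃⟩
    · exact h₃.trans ((h₁.1 h₂).trans (hstart w hw _ (hF _ t ht w hw))).symm
    · exact h₃.trans (h₁.2 h₂).symm
  have hstep : ∀ τ, τ + 1 < N * Y → LocalStep M X (G τ) (G (τ + 1)) := by
    intro τ hτ
    obtain ⟨w, hw, t, ht, rfl⟩ := hcases τ (by omega)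
    rw [hGF w t ht]
    by_cases htN : t + 1 = N
    · have hw' : w + 1 ≠ Y := by
        rintro rfl
        rw [Nat.mul_succ] at hτ
        omega
      have : N * w + t + 1 = N * (w + 1) + 0 := by
        rw [Nat.mul_succ]
        omega
      rw [this, hGF (w + 1) 0 hN]
      exact (h t ht w hw).step_block htN hw'
    · rw [add_assoc, hGF w (t + 1) (by omega)]
      exact (h t ht w hw).step htN
  have hpos : 0 < N * Y := Nat.mul_pos hN hY
  have hhalt : G (N * Y - 1) .line = M.len := by
    have : N * Y - 1 = N * (Y - 1) + (N - 1) := by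
      obtain ⟨Y, rfl⟩ : ∃ Y', Y = Y' + 1 := ⟨Y - 1, by omega⟩
      rw [Nat.mul_succ, Nat.add_sub_cancel]
      omega
    rw [this, hGF _ _ (by omega)]
    exact (h _ (by omega) _ (by omega)).halt (by omega) (by omega)
  have hline : ∀ τ < N * Y, G τ .line ≤ M.len := by
    intro τ hτ
    by_cases hl : τ + 1 < N * Y
    · obtain ⟨i, hi, -⟩ := hstep τ hl
      rw [hi]
      exact Nat.lt_succ_iff.1 i.2
    · rw [show τ = N * Y - 1 by omega, hhalt]
  -- The run ends at the first arrival in the line of `accept`; the idling afterwards is no step of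
  -- the machine.
  have hex : ∃ τ, τ < N * Y ∧ G τ .line = M.len := ⟨_, by omega, hhalt⟩
  obtain ⟨h₁, h₂⟩ := Nat.find_spec hex
  refine ⟨Nat.find hex, fun τ => configOf M (G τ) (mem τ), ?_, fun τ hτ => ?_, ?_⟩
  · have h₃ : G 0 = fun j => F j 0 0 := hGF 0 0 hN
    obtain ⟨h₄, h₅, h₆⟩ := (h 0 hN 0 hY).start rfl rfl
    simp only [configOf, Config.start, Regs.init, h₃, h₄, h₅, h₆]
    rfl
  · have h₃ := Nat.find_min hex hτ
    simp only [hmem]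
    exact (hstep τ (by omega)).step (fun h => h₃ ⟨by omega, h⟩) (hline _ (by omega))
      (hload τ (by omega))
  · refine (M.accept_iff _).2 (Fin.ext ?_)
    simp only [configOf, h₂]
    exact Nat.mod_eq_of_lt M.len.lt_succ_self

/-- An accepting computation gives a certificate. -/
theorem exists_cert_of_run {T : ℕ} {C : ℕ → Config M} (hN : 2 ≤ N) (hlen : M.len < N)
    (hC : M.AcceptingRun X T C) (hT : T + 1 ≤ N * Y)
    (hb : ∀ i ≤ T, (C i).regs.A < N ∧ (∀ j, (C i).regs.B j < N) ∧ ∀ x, (C i).regs.R x < N) :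
    ∃ F : CertSym (numAcc σ) → ℕ → ℕ → ℕ, (∀ j, ∀ t < N, ∀ w < Y, F j t w < N) ∧
      ∀ t < N, ∀ w < Y, Cert M X N Y F t w := by
  obtain ⟨hC₀, hC₁, hC₂⟩ := hC
  -- The accepting configuration is repeated until the n^r blocks are full.
  set D : ℕ → Config M := fun τ => C (min τ T) with hD
  have hDb : ∀ τ, (D τ).regs.A < N ∧ (∀ j, (D τ).regs.B j < N) ∧ ∀ x, (D τ).regs.R x < N :=
    fun τ => hb _ (min_le_right _ _)
  have hstep : ∀ τ, (M.prog (D τ).pc).Local X (D τ).pc (D τ).regs.A ((D τ).regs.R (D τ).regs.A)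
      ((D (τ + 1)).regs.R (D τ).regs.A) (D (τ + 1)).regs.A (D (τ + 1)).pc (D τ).regs.B
      (D (τ + 1)).regs.B ∧ (D (τ + 1)).regs.R =
        Function.update (D τ).regs.R (D τ).regs.A ((D (τ + 1)).regs.R (D τ).regs.A) := by
    intro τ
    rcases Nat.lt_or_ge τ T with h | h
    · simp only [hD, min_eq_left h.le, min_eq_left (Nat.succ_le_of_lt h)]
      exact Instr.local_of_effect (hC₁ τ h).1 (hC₁ τ h).2
    · simp only [hD, min_eq_right h, min_eq_right (h.trans τ.le_succ), hC₂]
      exact ⟨⟨rfl, fun _ => rfl, rfl, rfl⟩, (Function.update_eq_self _ _).symm⟩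
  choose pv nx fs ls hch hbd using fun w : ℕ => exists_chained
    (A := fun t => (D (N * w + t)).regs.A) (show 0 < N by omega) fun t _ => (hDb _).1
  obtain ⟨d₁, d₂, P₁, P₂, q, hdb, hd, hP, hless⟩ := exists_digits hN
  have hwit : ∀ w t, ∃ c < N, pv w t < t → t < N → Less d₁ d₂ P₁ P₂ c (pv w t) t := by
    intro w t
    by_cases h : pv w t < t ∧ t < N
    · obtain ⟨c, hc, hl⟩ := hless _ _ h.1 h.2
      exact ⟨c, hc, fun _ _ => hl⟩
    · exact ⟨0, by omega, fun h₁ h₂ => (h ⟨h₁, h₂⟩).elim⟩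
  choose wit hwit₁ hwit₂ using hwit
  refine ⟨fun j t w => match j with
    | .acc => (D (N * w + t)).regs.A
    | .arg b => (D (N * w + t)).regs.B b
    | .line => (D (N * w + t)).pc
    | .load => (D (N * w + t)).regs.R (D (N * w + t)).regs.A
    | .write => (D (N * w + t + 1)).regs.R (D (N * w + t)).regs.A
    | .mem => (D (N * w)).regs.R t
    | .prev => pv w t
    | .next => nx w t
    | .first => fs w t
    | .last => ls w t
    | .digit₁ => d₁ t
    | .digit₂ => d₂ t
    | .pair₁ => P₁ t
    | .pair₂ => P₂ t
    | .pred => q t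
    | .witness => wit w t, fun j t ht w hw => ?_, fun t ht w hw => ?_⟩
  · have h₁ := hbd w t ht
    have h₂ := hdb t ht
    cases j with
    | acc => exact (hDb _).1
    | arg b => exact (hDb _).2.1 b
    | line => exact (Nat.lt_succ_iff.1 (D (N * w + t)).pc.2).trans_lt hlen
    | load => exact (hDb _).2.2 _
    | write => exact (hDb _).2.2 _
    | mem => exact (hDb _).2.2 _
    | prev => exact h₁.1
    | next => exact h₁.2.1
    | first => exact h₁.2.2.1
    | last => exact h₁.2.2.2
    | digit₁ => exact h₂.1
    | digit₂ => exact h₂.2.1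
    | pair₁ => exact h₂.2.2.1
    | pair₂ => exact h₂.2.2.2.1
    | pred => exact h₂.2.2.2.2
    | witness => exact hwit₁ w t
  have hm : ∀ t < N, (D (N * w + (t + 1))).regs.R = Function.update (D (N * w + t)).regs.R
      (D (N * w + t)).regs.A ((D (N * w + t + 1)).regs.R (D (N * w + t)).regs.A) :=
    fun t _ => (hstep (N * w + t)).2
  have hprev := (hch w).mem_prev (mem := fun t => (D (N * w + t)).regs.R)
    (W := fun t => (D (N * w + t + 1)).regs.R (D (N * w + t)).regs.A) hm ht
  have hlast := (hch w).mem_last (mem := fun t => (D (N * w + t)).regs.R)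
    (W := fun t => (D (N * w + t + 1)).regs.R (D (N * w + t)).regs.A) hm ht
  have hD₀ : D 0 = Config.start M := by simp only [hD, Nat.zero_min, hC₀]
  constructor
  · rintro rfl rfl
    simp only [Nat.mul_zero, Nat.add_zero, hD₀]
    exact ⟨rfl, rfl, fun _ => rfl⟩
  · rintro rfl
    simp only [Nat.mul_zero, hD₀]
    rfl
  · exact fun _ => ⟨_, rfl, (hstep (N * w + t)).1⟩
  · intro htN _
    refine ⟨_, rfl, ?_⟩
    have : N * (w + 1) + 0 = N * w + t + 1 := by
      rw [Nat.mul_succ]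
      omega
    simp only [this]
    exact (hstep (N * w + t)).1
  · intro htN hwY
    -- This is the last time, N·Y - 1, which is not before T.
    have : min (N * w + t) T = T := by
      rw [← hwY, Nat.mul_succ] at hT
      omega
    simp only [hD, this]
    exact congrArg Fin.val ((M.accept_iff _).1 hC₂)
  · rcases (hch w).prev t ht with ⟨h₁, h₂⟩ | ⟨h₁, h₂, h₃⟩
    · exact Or.inl ⟨h₁, h₂, hprev.1 h₁⟩
    · exact Or.inr ⟨h₁.ne, hwit₂ w t h₁ ht, h₂, h₃, hprev.2 h₁.ne⟩
  · exact (hch w).last t ht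
  · exact (hch w).next t ht
  · intro _
    simp only [Nat.mul_succ]
    exact hlast
  · exact fun _ => hd t
  · exact hP t

end Certificates

end TimeSpace

namespace TimeSpace

/-! ### The formula for certificates -/

section CertFormula

variable {σ : FirstOrder.Language.{u, v}} [Finite σ.Symbols] {C s r : ℕ} {J : Type}

/-- The bound `len + 1 < C` makes all line numbers, including `i + 1`, available through
`LNum.const`. -/
theorem LDef.instr_local (hs : 1 ≤ s) {len : ℕ} (hC : len + 1 < C) (I : Instr σ len)
    (i : Fin (len + 1)) {Q : Env σ J C s r → Prop} {A V W A' i' : Env σ J C s r → ℕ}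
    {B B' : Fin (numAcc σ) → Env σ J C s r → ℕ} (hA : LNum Q A) (hV : LNum Q V) (hW : LNum Q W)
    (hA' : LNum Q A') (hi' : LNum Q i') (hB : ∀ b, LNum Q (B b)) (hB' : ∀ b, LNum Q (B' b)) :
    LDef Q (fun e => I.Local e.X i (A e) (V e) (W e) (A' e) (i' e) (fun b => B b e)
      (fun b => B' b e)) := by
  have hargs : LDef Q (fun e => ∀ c, B' c e = B c e) := LDef.all fun c => LDef.eq (hB' c) (hB c)
  have hnext : LDef Q (fun e => i' e = i + 1) := LDef.eq hi' (LNum.const (by omega))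
  have hrest := hargs.and ((LDef.eq hW hV).and hnext)
  have hzero : ∀ Q : Env σ J C s r → Prop, LNum Q (fun _ => 0) := fun Q => LNum.zero (by omega)
  cases I with
  | getSize => exact (LDef.eq hA' (LNum.card (by omega) hs)).and hrest
  | setZero => exact (LDef.eq hA' (hzero _)).and hrest
  | incr => exact (LDef.eq_succ hA' hA).and hrest
  | decr =>
    exact ((LDef.eq_succ hA hA').or ((LDef.eq hA (hzero _)).and (LDef.eq hA' (hzero _)))).and hrest
  | guess => exact (LDef.const _ True).and hrest
  | getFun f => exact (LDef.eq hA' (LNum.readFun (by omega) hs f fun c => hB _)).and hrest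
  | getRel R => exact (LDef.eq hA' (LNum.readRel (by omega) hs R fun c => hB _)).and hrest
  | load => exact (LDef.eq hA' hV).and hrest
  | copy b =>
    exact (LDef.eq hA' hA).and ((LDef.all fun c =>
      ((LDef.const _ (c = b)).imp (LDef.eq ((hB' c).mono fun e he => he.1)
        (hA.mono fun e he => he.1))).and
      ((LDef.const _ (c ≠ b)).imp (LDef.eq ((hB' c).mono fun e he => he.1)
        ((hB c).mono fun e he => he.1)))).and ((LDef.eq hW hV).and hnext))
  | store b => exact (LDef.eq hA' hA).and (hargs.and ((LDef.eq hW (hB b)).and hnext))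
  | branch b i₀ i₁ =>
    have hline : ∀ (j : Fin (len + 1)) (P : Env σ J C s r → Prop),
        LDef (fun e => Q e ∧ P e) (fun e => i' e = j) := fun j P =>
      LDef.eq (hi'.mono fun e he => he.1) (LNum.const (by omega))
    exact (LDef.eq hA' hA).and (hargs.and ((LDef.eq hW hV).and
      (((LDef.eq hA (hB b)).imp (hline i₀ _)).and ((LDef.eq hA (hB b)).not.imp (hline i₁ _)))))
  | accept =>
    exact (LDef.eq hA' hA).and (hargs.and ((LDef.eq hW hV).and
      (LDef.eq hi' (LNum.const (by omega)))))
  | reject => exact LDef.const _ False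

theorem LDef.local_step (hs : 1 ≤ s) (M : NRAM σ) (hC : M.len + 1 < C) {Q : Env σ J C s r → Prop}
    {f f' : CertSym (numAcc σ) → Env σ J C s r → ℕ} (hf : ∀ j, LNum Q (f j))
    (hf' : ∀ j, LNum Q (f' j)) : LDef Q (fun e => LocalStep M e.X (f · e) (f' · e)) :=
  LDef.ex fun i => (LDef.eq (hf .line) (LNum.const (by omega))).and
    (LDef.instr_local hs hC (M.prog i) i (hf _) (hf _) (hf _) (hf' _) (hf' _) (fun _ => hf _)
      fun _ => hf' _)

/-- Each condition looks at the block w or, unless w is the last, at w + 1, which is what the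
vectors y and succ(y) allow. Nested applications are harmless because the first s arguments may be
arbitrary terms. -/
theorem LDef.cert (hs : 1 ≤ s) (M : NRAM σ) (hC : M.len + 1 < C)
    {g : Env σ (CertSym (numAcc σ)) C s r → ℕ} (hg : ∀ Q, LNum Q g)
    (hlt : ∀ e, g e < C * e.X.card ^ s) :
    LDef (fun _ => True) (fun e => Cert M e.X (C * e.X.card ^ s) (e.X.card ^ r) e.F (g e)
      (lexNum e.y)) := by
  have hzero : ∀ Q : Env σ (CertSym (numAcc σ)) C s r → Prop, LNum Q (fun _ => 0) :=
    fun Q => LNum.zero (by omega)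
  have ha : ∀ Q j, LNum Q (fun e => e.F j (g e) (lexNum e.y)) := fun Q j => (hg Q).apply j
  have haa : ∀ Q j j', LNum Q (fun e => e.F j' (e.F j (g e) (lexNum e.y)) (lexNum e.y)) :=
    fun Q j j' => (ha Q j).apply j'
  -- The last time of a block is the fixed point of the cut-off successor.
  have hend : ∀ Q, LDef Q (fun e => g e + 1 = C * e.X.card ^ s) := fun Q =>
    (LDef.eq (hg Q).succ (hg Q)).congr fun e _ => by
      have := hlt e
      omega
  have hyend : ∀ Q : Env σ (CertSym (numAcc σ)) C s r → Prop,
      LDef Q (fun e => lexNum e.y + 1 = e.X.card ^ r) := fun Q => LDef.y_last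
  have hgs : ∀ Q : Env σ (CertSym (numAcc σ)) C s r → Prop, LNum
      (fun e => Q e ∧ g e + 1 ≠ C * e.X.card ^ s) (fun e => g e + 1) := fun Q =>
    (hg _).succ_of_lt fun e he => by
      have := hlt e
      have := he.2
      omega
  have hload : ∀ Q, LDef Q (fun e => e.F .load (g e) (lexNum e.y) =
      e.F .write (e.F .prev (g e) (lexNum e.y)) (lexNum e.y)) := fun Q =>
    LDef.eq (ha Q .load) (haa Q .prev .write)
  have hmem : ∀ Q, LDef Q (fun e => e.F .acc (e.F .last (g e) (lexNum e.y)) (lexNum e.y) = g e) :=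
    fun Q => LDef.eq (haa Q .last .acc) (hg Q)
  have hnm : ∀ P : Env σ (CertSym (numAcc σ)) C s r → Prop, LNum
      (fun e => (True ∧ lexNum e.y + 1 ≠ e.X.card ^ r) ∧ P e)
      (fun e => e.F .mem (g e) (lexNum e.y + 1)) := fun P =>
    (hg _).apply_next .mem fun e he => he.1.2
  have h₁ := ((LDef.eq (hg (fun _ => True)) (hzero _)).imp (LDef.y_zero.imp
    ((LDef.eq (ha _ .acc) (hzero _)).and ((LDef.eq (ha _ .line) (hzero _)).and
      (LDef.all fun b => LDef.eq (ha _ (.arg b)) (hzero _))))))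
  have h₂ := LDef.y_zero.imp (LDef.eq (ha (fun e => True ∧ lexNum e.y = 0) .mem) (hzero _))
  have h₃ := (hend (fun _ => True)).not.imp (LDef.local_step hs M hC (fun j => ha _ j)
    (fun j => (hgs _).apply j))
  have h₄ := (hend (fun _ => True)).imp ((hyend _).not.imp (LDef.local_step hs M hC
    (fun j => ha _ j) (fun j => (hzero _).apply_next j fun e he => he.2)))
  have h₅ := (hend (fun _ => True)).imp ((hyend _).imp
    (LDef.eq (ha _ .line) (LNum.const (m := M.len) (by omega))))
  have h₆ := ((LDef.eq (ha (fun _ => True) .prev) (hg _)).and ((LDef.eq (haa _ .acc .first)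
      (hg _)).and (LDef.eq (ha _ .load) (haa _ .acc .mem)))).or
    ((LDef.eq (ha (fun _ => True) .prev) (hg _)).not.and
      ((((LDef.eq (haa _ .witness .pair₁) (haa _ .prev .digit₁)).and
        (LDef.eq (haa _ .witness .pair₂) (ha _ .digit₁))).or
        ((LDef.eq (haa _ .prev .digit₁) (ha _ .digit₁)).and
          ((LDef.eq (haa _ .witness .pair₁) (haa _ .prev .digit₂)).and
            (LDef.eq (haa _ .witness .pair₂) (ha _ .digit₂))))).and
      ((LDef.eq (haa _ .prev .acc) (ha _ .acc)).and
        ((LDef.eq (haa _ .prev .next) (hg _)).and (hload _)))))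
  have h₇ := LDef.eq (((haa (fun _ => True) .acc .last)).apply .acc) (ha _ .acc)
  have h₈ := (hmem (fun _ => True)).imp (LDef.eq (haa _ .last .next) (ha _ .last))
  have h₉ := (hyend (fun _ => True)).not.imp (((hmem _).imp
    (LDef.eq (hnm _) (haa _ .last .write))).and
    ((hmem _).not.imp (LDef.eq (hnm _) (ha _ .mem))))
  have h₁₀ := (hend (fun _ => True)).not.imp
    ((LDef.eq_succ ((hgs _).apply .digit₁) (ha _ .digit₁)).or
      ((LDef.eq ((hgs _).apply .digit₁) (ha _ .digit₁)).and
        (LDef.eq_succ ((hgs _).apply .digit₂) (ha _ .digit₂))))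
  have h₁₁ := (LDef.eq_succ (ha (fun _ => True) .pair₂) (ha _ .pair₁)).or
    ((LDef.eq (haa _ .pred .pair₁) (ha _ .pair₁)).and
      (LDef.eq_succ (ha _ .pair₂) (haa _ .pred .pair₂)))
  refine (h₁.and (h₂.and (h₃.and (h₄.and (h₅.and (h₆.and (h₇.and (h₈.and (h₉.and
    (h₁₀.and h₁₁)))))))))).congr fun e _ => ⟨?_, ?_⟩
  · rintro ⟨h₁, h₂, h₃, h₄, h₅, h₆, h₇, h₈, h₉, h₁₀, h₁₁⟩
    exact ⟨h₁, h₂, h₃, h₄, h₅, h₆, h₇, h₈, h₉, h₁₀, h₁₁⟩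
  · rintro ⟨h₁, h₂, h₃, h₄, h₅, h₆, h₇, h₈, h₉, h₁₀, h₁₁⟩
    exact ⟨h₁, h₂, h₃, h₄, h₅, h₆, h₇, h₈, h₉, h₁₀, h₁₁⟩

theorem exists_ESO_of_mem_NTISP (hs : 1 ≤ s) (P : Problem σ)
    (hP : P ∈ NTISP σ (fun n => n ^ (s + r)) (fun n => n ^ s)) :
    ∃ φ : ESO σ s r, ∀ X : FinStr σ, X ∈ P ↔ X.Satisfies φ := by
  obtain ⟨M, c, hM⟩ := hP
  -- C exceeds c, so that register contents up to c·n^s are below C·n^s, and `M.len + 1`, so that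
  -- line numbers are constants.
  set C := c + M.len + 2 with hC
  -- The variables x range over s-tuples only; the leading digit k of the time is covered by a
  -- finite conjunction.
  obtain ⟨φ, hφ⟩ := LDef.all fun k : Fin C => LDef.cert (r := r) hs M (by omega)
    (g := fun e => e.num k fun i => .x i) (fun Q => LNum.num k _)
    (fun e => mul_pow_add_lexNum_lt k _)
  refine ⟨⟨certLang (CertSym (numAcc σ)) C s r, inferInstance, symArity_certLang, φ⟩, fun X => ?_⟩
  have hn := X.pos
  have hns : 1 ≤ X.card ^ s := Nat.pow_pos hn
  have hCN : C ≤ C * X.card ^ s := Nat.le_mul_of_pos_right _ hns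
  constructor
  · intro hX
    obtain ⟨t, D, hD, ht, -, hb⟩ := (hM X).2 hX
    have hmax : max X.card (X.card ^ s) = X.card ^ s := max_eq_right (Nat.le_self_pow (by omega) _)
    simp only [hmax] at hb
    have hlt : c * X.card ^ s < C * X.card ^ s := Nat.mul_lt_mul_of_pos_right (by omega) hns
    obtain ⟨F, hF, hcert⟩ := exists_cert_of_run (N := C * X.card ^ s) (Y := X.card ^ r) (by omega)
      (by omega) hD (by
        refine ht.trans ?_
        rw [mul_assoc, ← pow_add]
        exact Nat.mul_le_mul_right _ (by omega))
      (fun i hi => ⟨(hb i hi).1.trans_lt hlt, fun j => ((hb i hi).2.1 j).trans_lt hlt,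
        fun x => ((hb i hi).2.2 x).trans_lt hlt⟩)
    obtain ⟨I, hI⟩ := exists_structure hn F hF
    exact ⟨I, fun x y => (hφ ⟨X, I, F, hI, x, y⟩ trivial).2 fun k =>
      hcert _ (mul_pow_add_lexNum_lt k x) _ (lexNum_lt y)⟩
  · rintro ⟨I, hI⟩
    obtain ⟨F, hF⟩ := exists_decodes I
    refine (hM X).1.2 (exists_run_of_cert (N := C * X.card ^ s) (Y := X.card ^ r) (F := F)
      (by omega) (Nat.pow_pos hn) (fun j t ht w hw => hF.lt j ht hw) fun t ht w hw => ?_)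
    obtain ⟨k, x, rfl⟩ := exists_mul_pow_add_lexNum ht
    obtain ⟨y, rfl⟩ := exists_lexNum_eq hw
    exact (hφ ⟨X, I, F, hF, x, y⟩ trivial).1 (hI x y) k

end CertFormula

end TimeSpace

theorem mainTheorem2 (σ : FirstOrder.Language.{u, v}) [Finite σ.Symbols] (s r : ℕ) (hs : 1 ≤ s)
    (P : TimeSpace.Problem σ) :
    P ∈ TimeSpace.NTISP σ (fun n => n ^ (s + r)) (fun n => n ^ s) ↔
      ∃ φ : TimeSpace.ESO σ s r, ∀ X : TimeSpace.FinStr σ, X ∈ P ↔ X.Satisfies φ := by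
  exact ⟨TimeSpace.exists_ESO_of_mem_NTISP hs P, fun ⟨φ, hφ⟩ => TimeSpace.mem_NTISP_of_ESO hs P φ hφ⟩
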